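/- **Setting.** Let $d\in\{2,3\}$, $T>0$, $m\ge 1$, $k\ge 1$. Let $\widehat K=\{\widehat x\in\mathbb R^d:\widehat x_i\ge 0,\ \sum_i\widehat x_i\le 1\}$ and $\widehat E$ (the same set in $\mathbb R^{d-1}$) be the reference simplices, and $\widehat\Psi_l:\widehat E\to\widehat E_l$ the affine parametrizations of the $d+1$ facets $\widehat E_l$ of $\widehat K$, with outward normals $\widehat n_l$. Let $\mathcal T_h^0$ be a finite conforming mesh of a (closed) domain $\Omega_0\subset\mathbb R^d$ by curved simplices $K^0=\Phi_K^0(\widehat K)$, where $\Phi^0_K\in[\mathcal P^m(\widehat K)]^d$ is one-to-one with positive Jacobian determinant: two distinct elements meet in a common proper (possibly empty) face, on which their maps agree up to a relabelling of the vertices. Let $\phi_t:\Omega_0\to\Omega_t$, $t\in[0,T]$, be a given ALE map: for each $t$ it is continuous, one-to-one, $\Phi_K^t:=\phi_t\circ\Phi_K^0\in[\mathcal P^m(\widehat K)]^d$ and $J_K^t:=\det F_K^t>0$ on $\widehat K$ for all $K$, where $F_K^t:=\nabla_{\widehat x}\Phi_K^t$; and $\partial_t\phi_t(x_0)$ exists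 for all $x_0\in\Omega_0$, $t\in[0,T]$ (time derivatives are one-sided at $t=0,T$). The domain velocity is $\omega=(\partial_t\phi_t)\circ\phi_t^{-1}$. Put $K^t=\Phi_K^t(\widehat K)$, with outward unit normal $n=(F_K^t)^{-T}\widehat n_l/\|(F_K^t)^{-T}\widehat n_l\|$ on its facets $E=\Phi_K^t(\widehat E_l)$, $\Psi_E^t=\Phi_K^t\circ\widehat\Psi_l$, $F_E^t=\nabla\Psi_E^t$, $(F_E^t)^{-T}:=F_E^t((F_E^t)^TF_E^t)^{-1}$; let $\mathcal E_h^t$ be the set of facets, $\Gamma_h$ the set of boundary facets (those of only one element), and $\mathsf{tng}(v)=v-(v\cdot n)n$. Write $(\eta,\xi)_t=\sum_K\int_{K^t}\eta\cdot\xi\,dx$ and $\langle\eta,\xi\rangle_t=\sum_K\int_{\partial K^t}\eta\cdot\xi\,ds$. The finite element spaces at time $t$ are $W_h^k=\{w: w|_{K^t}\circ\Phi_K^t\in\mathcal P^k(\widehat K)\}$, $V_h^k=\{v: v|_{K^t}\circ\Phi_K^t=\tfrac1{J_K^t}F_K^t\widehat v,\ \widehat v\in[\mathcal P^k(\widehat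 K)]^d\}$, $\Sigma_h^k=\{\sigma\in[W_h^k]^{d\times d}:\sigma\text{ symmetric}\}$, and on the skeleton $\widetilde W_h^k=\{\widetilde w:\widetilde w|_E\circ\Psi_E^t\in\mathcal P^k(\widehat E)\}$, $\widetilde V_h^k=\{\widetilde v:\widetilde v|_E\circ\Psi_E^t=\mathsf{tng}((F_E^t)^{-T}\widehat v),\ \widehat v\in[\mathcal P^k(\widehat E)]^{d-1}\}$ (functions on the mesh being defined element by element, those on the skeleton facet by facet). **Scheme.** Let $\rho,\mu,\alpha>0$ be constants (for instance $\alpha=2\mu$) and let $f(\cdot,t)$ be an integrable body force on $\Omega_t$. A solution of the semi-discrete scheme on $[0,T]$ consists, for every $t\in[0,T]$, of $(p_h,\epsilon_h,u_h,\widetilde\sigma_h,\widetilde u_h)\in W_h^{k-1}\times\Sigma_h^k\times V_h^k\times\widetilde W_h^k\times\widetilde V_h^k$ with $\widetilde u_h|_{\Gamma_h}=0$, such that the time derivative $\partial_tu_h|_{x_0}$ along the trajectories $t\mapsto\phi_t(x_0)$ exists on every element and $$(\rho\,\partial_tu_h|_{x_0},v)_t+(\rho(\operatorname{div}\omega)u_h,v)_t-(\rho(u_h-\omega)\otimes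 u_h,\nabla v)_t+2\mu(\epsilon_h,\nabla v)_t-(p_h,\operatorname{div}v)_t-\langle\mathrm{Fl}_v-\mathrm{Fl}_c,v\rangle_t=(\rho f,v)_t,$$ $$2\mu(\epsilon_h-D(u_h),G)_t+2\mu\langle\mathsf{tng}(u_h-\widetilde u_h),Gn\rangle_t=0,\quad(\operatorname{div}u_h,q)_t=0,\quad\langle u_h\cdot n,\widetilde\tau\rangle_t=0,\quad\langle\mathrm{Fl}_v-\mathrm{Fl}_c,\mathsf{tng}(\widetilde v)\rangle_t=0$$ for all $(q,G,v,\widetilde\tau,\widetilde v)\in W_h^{k-1}\times\Sigma_h^k\times V_h^k\times\widetilde W_h^k\times\widetilde V_h^k$ with $\widetilde v|_{\Gamma_h}=0$. Here $(a\otimes b)_{ij}=a_ib_j$, $(\nabla v)_{ij}=\partial_iv_j$, $D(u)=\frac12(\nabla u+\nabla u^T)$, all derivatives are taken elementwise, and $$\mathrm{Fl}_v=\widetilde\sigma_hn+2\mu\,\mathsf{tng}(\epsilon_hn)-\alpha\,\mathsf{tng}(u_h-\widetilde u_h),\qquad\mathrm{Fl}_c=\rho\,(u_h-\omega)\cdot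 n\,\big((u_h\cdot n)n+\mathsf{tng}(\check u_h)\big),$$ with the upwind value $\mathsf{tng}(\check u_h)=\mathsf{tng}(u_h)$ where $(u_h-\omega)\cdot n>0$ and $\mathsf{tng}(\check u_h)=\mathsf{tng}(\widetilde u_h)$ where $(u_h-\omega)\cdot n\le0$. **Theorem.** For every solution and every $t\in[0,T]$, $(\rho u_h,u_h)_t$ is differentiable in $t$ and $$\frac12\frac{d}{dt}(\rho u_h,u_h)_t+2\mu(\epsilon_h,\epsilon_h)_t+\big\langle\gamma_h|\mathsf{tng}(u_h-\widetilde u_h)|^2,1\big\rangle_t=(\rho f,u_h)_t,$$ where $\gamma_h:=\alpha+\tfrac12\rho\,|(u_h-\omega)\cdot n|$ is positive on all facets. -/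

import Mathlib

open MeasureTheory Set

noncomputable section

namespace ALEHDG

/-- `ℝᵈ` with the Euclidean norm. -/
abbrev Vec (d : ℕ) : Type := EuclideanSpace ℝ (Fin d)

/-! ### The reference simplex

Throughout, the space dimension is `d = n + 1`, so that facets have dimension `n`. -/

/-- The reference simplex `{x : xᵢ ≥ 0, ∑ xᵢ ≤ 1}` in `ℝⁿ`. -/
def refSimplex (n : ℕ) : Set (Vec n) := {x | (∀ i, 0 ≤ x i) ∧ ∑ i, x i ≤ 1}

/-- Barycentric coordinates `(1 - ∑ xᵢ, x₁, …, xₙ)`. -/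
def bary {n : ℕ} (x : Vec n) : Fin (n + 1) → ℝ := Fin.cons (1 - ∑ i, x i) (fun i => x i)

/-- The vertices `0, e₁, …, eₙ` of the reference simplex. -/
def refVertex {n : ℕ} : Fin (n + 1) → Vec n := Fin.cons 0 (fun i => EuclideanSpace.single i 1)

/-- The closed face of the reference simplex spanned by the vertices in `S`. -/
def face {n : ℕ} (S : Finset (Fin (n + 1))) : Set (Vec n) :=
  {x | x ∈ refSimplex n ∧ ∀ i, i ∉ S → bary x i = 0}

/-- The affine map of the reference simplex that sends the vertex `i` to the vertex `σ i`. -/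
def relabel {n : ℕ} (σ : Equiv.Perm (Fin (n + 1))) (x : Vec n) : Vec n :=
  ∑ i, bary x i • refVertex (σ i)

/-- The affine parametrization of the `l`-th facet (the one opposite to the vertex `l`) of the
reference simplex of dimension `n + 1` by the reference simplex of dimension `n`. -/
def refFacetMap {n : ℕ} (l : Fin (n + 2)) (z : Vec n) : Vec (n + 1) :=
  ∑ j : Fin (n + 1), bary z j • refVertex (l.succAbove j)

/-- The outward unit normal of the `l`-th facet of the reference simplex. -/
def refNormal {n : ℕ} (l : Fin (n + 2)) : Vec (n + 1) :=
  Fin.cases (motive := fun _ => Vec (n + 1))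
    ((Real.sqrt ((n : ℝ) + 1))⁻¹ • WithLp.toLp 2 (fun _ : Fin (n + 1) => (1 : ℝ)))
    (fun i => -EuclideanSpace.single i 1) l

/-- `g` is, on the reference simplex, a polynomial of degree at most `k`. -/
def IsPoly {n : ℕ} (k : ℕ) (g : Vec n → ℝ) : Prop :=
  ∃ p : MvPolynomial (Fin n) ℝ, p.totalDegree ≤ k ∧
    ∀ x ∈ refSimplex n, g x = MvPolynomial.eval (fun i => x i) p

/-- `g` is, on the reference simplex, a vector of polynomials of degree at most `k`. -/
def IsVecPoly {n d : ℕ} (k : ℕ) (g : Vec n → Vec d) : Prop :=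
  ∀ i, IsPoly k (fun x => g x i)

/-! ### Vector calculus -/

/-- Tangential component with respect to the unit normal `ν`. -/
def tng {d : ℕ} (ν v : Vec d) : Vec d := v - inner ℝ v ν • ν

/-- Gradient of the restriction of `v` to the set `s`, with the convention
`(∇v) i j = ∂ᵢ vⱼ`. -/
def grad {d : ℕ} (s : Set (Vec d)) (v : Vec d → Vec d) (x : Vec d) :
    Matrix (Fin d) (Fin d) ℝ :=
  Matrix.of fun i j => fderivWithin ℝ v s x (EuclideanSpace.single i 1) j

/-- Divergence of the restriction of `v` to the set `s`. -/
def divg {d : ℕ} (s : Set (Vec d)) (v : Vec d → Vec d) (x : Vec d) : ℝ :=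
  (grad s v x).trace

/-- Symmetric gradient of the restriction of `v` to the set `s`. -/
def symGrad {d : ℕ} (s : Set (Vec d)) (v : Vec d → Vec d) (x : Vec d) :
    Matrix (Fin d) (Fin d) ℝ :=
  (1 / 2 : ℝ) • (grad s v x + (grad s v x).transpose)

/-- Frobenius product of matrices. -/
def frob {d : ℕ} (A B : Matrix (Fin d) (Fin d) ℝ) : ℝ := ∑ i, ∑ j, A i j * B i j

/-- The tensor product `(a ⊗ b) i j = aᵢ bⱼ`. -/
def tens {d : ℕ} (a b : Vec d) : Matrix (Fin d) (Fin d) ℝ := Matrix.of fun i j => a i * b j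

/-- Matrix times vector in `ℝᵈ`. -/
def app {d : ℕ} (A : Matrix (Fin d) (Fin d) ℝ) (v : Vec d) : Vec d :=
  WithLp.toLp 2 (fun i => ∑ j, A i j * v j)

/-! ### Meshes -/

/-- A conforming mesh of curved simplices in `ℝⁿ⁺¹` whose element maps are polynomials of
degree at most `m`, one-to-one on the (closed) reference simplex and with a positive Jacobian
determinant.  Two distinct elements meet in a common proper (possibly empty) face, on which
their maps agree up to a relabelling of the vertices. -/
structure Mesh (n m : ℕ) where
  Elem : Type
  [fintype : Fintype Elem]
  map : Elem → Vec (n + 1) → Vec (n + 1)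
  map_poly : ∀ K, IsVecPoly m (map K)
  map_inj : ∀ K, InjOn (map K) (refSimplex (n + 1))
  map_det : ∀ K, ∀ x ∈ refSimplex (n + 1),
    0 < (fderivWithin ℝ (map K) (refSimplex (n + 1)) x).det
  conforming : ∀ K K', K ≠ K' →
    ∃ (S : Finset (Fin (n + 2))) (σ : Equiv.Perm (Fin (n + 2))), S ≠ Finset.univ ∧
      map K '' refSimplex (n + 1) ∩ map K' '' refSimplex (n + 1) = map K '' face S ∧
      ∀ x ∈ face S, map K x = map K' (relabel σ x)

attribute [instance] Mesh.fintype

namespace Mesh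

variable {n m : ℕ} (M : Mesh n m)

/-- The closed initial domain, the union of the elements. -/
def domain : Set (Vec (n + 1)) := ⋃ K, M.map K '' refSimplex (n + 1)

/-- The `l`-th facet of the element `K` of the initial mesh. -/
def facetSet (K : M.Elem) (l : Fin (n + 2)) : Set (Vec (n + 1)) :=
  (fun z => M.map K (refFacetMap l z)) '' refSimplex n

/-- The mesh skeleton: the facets of the initial mesh, a facet shared by two elements being
one facet.  The facets of the moving mesh are labelled by those of the initial mesh. -/
def Facet : Type := {E : Set (Vec (n + 1)) // ∃ K l, E = M.facetSet K l}

/-- The `l`-th facet of `K` as an element of the mesh skeleton. -/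
def facet (K : M.Elem) (l : Fin (n + 2)) : M.Facet := ⟨M.facetSet K l, K, l, rfl⟩

/-- Boundary facets are those that belong to exactly one element. -/
def IsBdry (E : M.Facet) : Prop := ∃! q : M.Elem × Fin (n + 2), M.facet q.1 q.2 = E

end Mesh

/-- A continuous ALE map `φ` on `[0, T]`: at each time it is one-to-one on the closed domain,
on each element a polynomial of degree at most `m` in the reference variable, and the moving
mesh has positive Jacobian determinants; `∂φ/∂t` exists (one-sided at `0` and `T`). -/
structure ALEMap {n m : ℕ} (M : Mesh n m) (T : ℝ) where
  φ : ℝ → Vec (n + 1) → Vec (n + 1)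
  cont : ∀ t ∈ Icc 0 T, ContinuousOn (φ t) M.domain
  inj : ∀ t ∈ Icc 0 T, InjOn (φ t) M.domain
  poly : ∀ t ∈ Icc 0 T, ∀ K, IsVecPoly m (fun x => φ t (M.map K x))
  det_pos : ∀ t ∈ Icc 0 T, ∀ K, ∀ x ∈ refSimplex (n + 1),
    0 < (fderivWithin ℝ (fun y => φ t (M.map K y)) (refSimplex (n + 1)) x).det
  diff : ∀ t ∈ Icc 0 T, ∀ x ∈ M.domain,
    DifferentiableWithinAt ℝ (fun s => φ s x) (Icc 0 T) t

namespace ALEMap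

variable {n m : ℕ} {M : Mesh n m} {T : ℝ} (A : ALEMap M T)

/-- The element map `Φ_K^t`. -/
def elemMap (t : ℝ) (K : M.Elem) (x : Vec (n + 1)) : Vec (n + 1) := A.φ t (M.map K x)

/-- The element `K^t`. -/
def elem (t : ℝ) (K : M.Elem) : Set (Vec (n + 1)) := A.elemMap t K '' refSimplex (n + 1)

/-- The closed domain at time `t`. -/
def domain (t : ℝ) : Set (Vec (n + 1)) := A.φ t '' M.domain

/-- The Jacobian `F_K^t` at a point of the reference element. -/
def jac (t : ℝ) (K : M.Elem) (x : Vec (n + 1)) : Vec (n + 1) →L[ℝ] Vec (n + 1) :=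
  fderivWithin ℝ (A.elemMap t K) (refSimplex (n + 1)) x

/-- The inverse `(Φ_K^t)⁻¹ : K^t → K̂`. -/
def elemInv (t : ℝ) (K : M.Elem) (x : Vec (n + 1)) : Vec (n + 1) :=
  Function.invFunOn (A.elemMap t K) (refSimplex (n + 1)) x

/-- The facet map `Ψ_E^t = Φ_K^t ∘ Ψ̂_l` of the `l`-th facet of `K`. -/
def facetMap (t : ℝ) (K : M.Elem) (l : Fin (n + 2)) (z : Vec n) : Vec (n + 1) :=
  A.elemMap t K (refFacetMap l z)

/-- The `l`-th facet of `K^t`. -/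
def facetSet (t : ℝ) (K : M.Elem) (l : Fin (n + 2)) : Set (Vec (n + 1)) :=
  A.facetMap t K l '' refSimplex n

/-- The surface Jacobian `F_E^t`. -/
def facetJac (t : ℝ) (K : M.Elem) (l : Fin (n + 2)) (z : Vec n) : Vec n →L[ℝ] Vec (n + 1) :=
  fderivWithin ℝ (A.facetMap t K l) (refSimplex n) z

/-- The surface element `J_E^t = √det ((F_E^t)ᵀ F_E^t)`. -/
def facetDet (t : ℝ) (K : M.Elem) (l : Fin (n + 2)) (z : Vec n) : ℝ :=
  Real.sqrt ((ContinuousLinearMap.adjoint (A.facetJac t K l z)).comp (A.facetJac t K l z)).det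

/-- The transpose `(F_E^t)⁻ᵀ = F_E^t ((F_E^t)ᵀ F_E^t)⁻¹` of the Moore-Penrose inverse. -/
def facetPinvT (t : ℝ) (K : M.Elem) (l : Fin (n + 2)) (z : Vec n) : Vec n →L[ℝ] Vec (n + 1) :=
  (A.facetJac t K l z).comp
    (((ContinuousLinearMap.adjoint (A.facetJac t K l z)).comp (A.facetJac t K l z)).inverse)

/-- The outward unit normal of `K^t` on its `l`-th facet, the normalization of
`(F_K^t)⁻ᵀ n̂_l`, as a function of the physical point `x`. -/
def normal (t : ℝ) (K : M.Elem) (l : Fin (n + 2)) (x : Vec (n + 1)) : Vec (n + 1) :=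
  ‖ContinuousLinearMap.adjoint (A.jac t K (A.elemInv t K x)).inverse (refNormal l)‖⁻¹ •
    ContinuousLinearMap.adjoint (A.jac t K (A.elemInv t K x)).inverse (refNormal l)

/-- The inverse `φ_t⁻¹` of the ALE map. -/
def back (t : ℝ) (x : Vec (n + 1)) : Vec (n + 1) := Function.invFunOn (A.φ t) M.domain x

/-- The domain velocity `ω = (∂φ_t/∂t) ∘ φ_t⁻¹`. -/
def vel (t : ℝ) (x : Vec (n + 1)) : Vec (n + 1) :=
  derivWithin (fun s => A.φ s (A.back t x)) (Icc 0 T) t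

/-- The time derivative `∂u/∂t|_{x₀}` along the ALE trajectories of a piecewise field. -/
def aleDeriv (u : ℝ → M.Elem → Vec (n + 1) → Vec (n + 1)) (t : ℝ) (K : M.Elem)
    (x : Vec (n + 1)) : Vec (n + 1) :=
  derivWithin (fun s => u s K (A.φ s (A.back t x))) (Icc 0 T) t

/-- The volume integral `∑_K ∫_{K^t} g dx`. -/
def vol (t : ℝ) (g : M.Elem → Vec (n + 1) → ℝ) : ℝ := ∑ K, ∫ x in A.elem t K, g K x

/-- The element-boundary integral `∑_K ∫_{∂K^t} g ds`, the surface integrals over the facets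
being written in their parametrizations. -/
def bdry (t : ℝ) (g : M.Elem → Fin (n + 2) → Vec (n + 1) → ℝ) : ℝ :=
  ∑ K, ∑ l, ∫ z in refSimplex n, g K l (A.facetMap t K l z) * A.facetDet t K l z

/-! ### Finite element spaces at time `t`

A function on the mesh is a family of functions, one for each element `K`, of which only the
values on `K^t` matter; a function on the skeleton is a family of functions, one for each
facet. -/

/-- Discontinuous scalar space (pull-back). -/
def Wh (k : ℕ) (t : ℝ) : Set (M.Elem → Vec (n + 1) → ℝ) :=
  {w | ∀ K, ∃ wh : Vec (n + 1) → ℝ, IsPoly k wh ∧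
    ∀ y ∈ refSimplex (n + 1), w K (A.elemMap t K y) = wh y}

/-- Discontinuous vector space (Piola map). -/
def Vh (k : ℕ) (t : ℝ) : Set (M.Elem → Vec (n + 1) → Vec (n + 1)) :=
  {v | ∀ K, ∃ vh : Vec (n + 1) → Vec (n + 1), IsVecPoly k vh ∧
    ∀ y ∈ refSimplex (n + 1),
      v K (A.elemMap t K y) = (A.jac t K y).det⁻¹ • A.jac t K y (vh y)}

/-- Discontinuous symmetric tensor space (pull-back). -/
def Sh (k : ℕ) (t : ℝ) : Set (M.Elem → Vec (n + 1) → Matrix (Fin (n + 1)) (Fin (n + 1)) ℝ) :=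
  {G | (∀ i j, (fun K x => G K x i j) ∈ A.Wh k t) ∧ ∀ K, ∀ x ∈ A.elem t K, (G K x).IsSymm}

/-- Scalar skeleton space (pull-back). -/
def Wt (k : ℕ) (t : ℝ) : Set (M.Facet → Vec (n + 1) → ℝ) :=
  {w | ∀ K l, ∃ wh : Vec n → ℝ, IsPoly k wh ∧
    ∀ z ∈ refSimplex n, w (M.facet K l) (A.facetMap t K l z) = wh z}

/-- Tangential skeleton space (covariant map). -/
def Vt (k : ℕ) (t : ℝ) : Set (M.Facet → Vec (n + 1) → Vec (n + 1)) :=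
  {v | ∀ K l, ∃ vh : Vec n → Vec n, IsVecPoly k vh ∧
    ∀ z ∈ refSimplex n, v (M.facet K l) (A.facetMap t K l z) =
      tng (A.normal t K l (A.facetMap t K l z)) (A.facetPinvT t K l z (vh z))}

/-- The skeleton field `v` vanishes on the boundary facets. -/
def VanishBdry (t : ℝ) (v : M.Facet → Vec (n + 1) → Vec (n + 1)) : Prop :=
  ∀ K l, M.IsBdry (M.facet K l) → ∀ x ∈ A.facetSet t K l, v (M.facet K l) x = 0

/-! ### The scheme -/

/-- The viscous numerical flux on the `l`-th facet of `K^t`. -/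
def fluxV (μ α t : ℝ) (ε : M.Elem → Vec (n + 1) → Matrix (Fin (n + 1)) (Fin (n + 1)) ℝ)
    (u : M.Elem → Vec (n + 1) → Vec (n + 1)) (σt : M.Facet → Vec (n + 1) → ℝ)
    (ut : M.Facet → Vec (n + 1) → Vec (n + 1))
    (K : M.Elem) (l : Fin (n + 2)) (x : Vec (n + 1)) : Vec (n + 1) :=
  σt (M.facet K l) x • A.normal t K l x
    + (2 * μ) • tng (A.normal t K l x) (app (ε K x) (A.normal t K l x))
    - α • tng (A.normal t K l x) (u K x - ut (M.facet K l) x)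

/-- The normal component `(u - ω) · n` of the convective velocity on the `l`-th facet of
`K^t`. -/
def relVel (t : ℝ) (u : M.Elem → Vec (n + 1) → Vec (n + 1))
    (K : M.Elem) (l : Fin (n + 2)) (x : Vec (n + 1)) : ℝ :=
  inner ℝ (u K x - A.vel t x) (A.normal t K l x)

open Classical in
/-- The tangential upwind value on the `l`-th facet of `K^t`. -/
def upwind (t : ℝ) (u : M.Elem → Vec (n + 1) → Vec (n + 1))
    (ut : M.Facet → Vec (n + 1) → Vec (n + 1))
    (K : M.Elem) (l : Fin (n + 2)) (x : Vec (n + 1)) : Vec (n + 1) :=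
  if 0 < A.relVel t u K l x then tng (A.normal t K l x) (u K x)
  else tng (A.normal t K l x) (ut (M.facet K l) x)

/-- The convective numerical flux on the `l`-th facet of `K^t`. -/
def fluxC (ρ t : ℝ) (u : M.Elem → Vec (n + 1) → Vec (n + 1))
    (ut : M.Facet → Vec (n + 1) → Vec (n + 1))
    (K : M.Elem) (l : Fin (n + 2)) (x : Vec (n + 1)) : Vec (n + 1) :=
  (ρ * A.relVel t u K l x) •
    (inner ℝ (u K x) (A.normal t K l x) • A.normal t K l x + A.upwind t u ut K l x)

/-- `(p, ε, u, σt, ut)` is a solution on `[0, T]` of the semi-discrete scheme of degree `k` with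
density `ρ`, viscosity `μ`, stabilization parameter `α` and body force `f`. -/
structure IsSolution (k : ℕ) (ρ μ α : ℝ) (f : ℝ → Vec (n + 1) → Vec (n + 1))
    (p : ℝ → M.Elem → Vec (n + 1) → ℝ)
    (ε : ℝ → M.Elem → Vec (n + 1) → Matrix (Fin (n + 1)) (Fin (n + 1)) ℝ)
    (u : ℝ → M.Elem → Vec (n + 1) → Vec (n + 1))
    (σt : ℝ → M.Facet → Vec (n + 1) → ℝ)
    (ut : ℝ → M.Facet → Vec (n + 1) → Vec (n + 1)) : Prop where
  mem_p : ∀ t ∈ Icc 0 T, p t ∈ A.Wh (k - 1) t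
  mem_ε : ∀ t ∈ Icc 0 T, ε t ∈ A.Sh k t
  mem_u : ∀ t ∈ Icc 0 T, u t ∈ A.Vh k t
  mem_σt : ∀ t ∈ Icc 0 T, σt t ∈ A.Wt k t
  mem_ut : ∀ t ∈ Icc 0 T, ut t ∈ A.Vt k t
  ut_bdry : ∀ t ∈ Icc 0 T, A.VanishBdry t (ut t)
  diff_u : ∀ t ∈ Icc 0 T, ∀ K, ∀ y ∈ refSimplex (n + 1),
    DifferentiableWithinAt ℝ (fun s => u s K (A.elemMap s K y)) (Icc 0 T) t
  momentum : ∀ t ∈ Icc 0 T, ∀ v ∈ A.Vh k t,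
    A.vol t (fun K x => ρ * inner ℝ (A.aleDeriv u t K x) (v K x))
      + A.vol t (fun K x => ρ * divg (A.elem t K) (A.vel t) x * inner ℝ (u t K x) (v K x))
      - A.vol t (fun K x =>
          ρ * frob (tens (u t K x - A.vel t x) (u t K x)) (grad (A.elem t K) (v K) x))
      + 2 * μ * A.vol t (fun K x => frob (ε t K x) (grad (A.elem t K) (v K) x))
      - A.vol t (fun K x => p t K x * divg (A.elem t K) (v K) x)
      - A.bdry t (fun K l x =>
          inner ℝ (A.fluxV μ α t (ε t) (u t) (σt t) (ut t) K l x
            - A.fluxC ρ t (u t) (ut t) K l x) (v K x))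
      = A.vol t (fun K x => ρ * inner ℝ (f t x) (v K x))
  strain : ∀ t ∈ Icc 0 T, ∀ G ∈ A.Sh k t,
    2 * μ * A.vol t (fun K x => frob (ε t K x - symGrad (A.elem t K) (u t K) x) (G K x))
      + 2 * μ * A.bdry t (fun K l x =>
          inner ℝ (tng (A.normal t K l x) (u t K x - ut t (M.facet K l) x))
            (app (G K x) (A.normal t K l x))) = 0
  divergence : ∀ t ∈ Icc 0 T, ∀ q ∈ A.Wh (k - 1) t,
    A.vol t (fun K x => divg (A.elem t K) (u t K) x * q K x) = 0
  normal_cont : ∀ t ∈ Icc 0 T, ∀ τ ∈ A.Wt k t,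
    A.bdry t (fun K l x => inner ℝ (u t K x) (A.normal t K l x) * τ (M.facet K l) x) = 0
  flux_cont : ∀ t ∈ Icc 0 T, ∀ v ∈ A.Vt k t, A.VanishBdry t v →
    A.bdry t (fun K l x =>
      inner ℝ (A.fluxV μ α t (ε t) (u t) (σt t) (ut t) K l x
        - A.fluxC ρ t (u t) (ut t) K l x)
        (tng (A.normal t K l x) (v (M.facet K l) x))) = 0

/-- The dissipation coefficient `γ = α + ½ ρ |(u - ω) · n|`. -/
def gam (ρ α t : ℝ) (u : M.Elem → Vec (n + 1) → Vec (n + 1))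
    (K : M.Elem) (l : Fin (n + 2)) (x : Vec (n + 1)) : ℝ :=
  α + 1 / 2 * (ρ * |A.relVel t u K l x|)

end ALEMap

end ALEHDG

end

open MeasureTheory Set

noncomputable section

namespace ALEHDG

/-! ### Barycentric coordinates -/

section Bary

variable {n : ℕ}

/-! The identity is the momentum equation tested with the velocity itself. Pulled back to the fixed
reference simplex, Reynolds' formula gives half the time derivative of ρ|u|² as ρ u·∂ₜu plus one
half of ρ (div ω)|u|². The scheme contains the whole of ρ (div ω)|u|², and the surplus half is
cancelled by convection: if div u = 0 pointwise, integrating u·((u-ω)·∇)u by parts yields ½ (div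
ω)|u|² and the boundary term ½ (u-ω)·n |u|². This balance is `hasDerivWithinAt_energy`, resting on
`integral_convection` and `hasDerivWithinAt_integral_elem`. The pointwise constraint holds because
the Piola map turns J div u into the reference divergence, a polynomial of degree at most k-1 and
hence an admissible test function (`pev_div_piolaPoly_eq_zero`).

The pressure drops out by testing the divergence equation with p, and 2μ(ε, ∇u) becomes 2μ(ε, ε)
plus a facet term by testing the strain equation with ε (`vol_strain`). What remains lives on
facets. By `flux_identity`, the dissipation density equals the facet terms so obtained, up to three
quantities with zero integral: u·n times the skeleton unknown σ̃, the flux against the skeleton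
velocity ũ, and ρ/2 times (u-ω)·n ((u·n)² - |tng ũ|²). The first two are equations of the scheme.
The third cancels in `bdry_convection_eq_zero`: across an interior facet (u-ω)·n changes sign while
the squares agree, and on a boundary facet both squares vanish. This needs exact, not just weak,
normal continuity. It holds because u·n times the area element is a polynomial of degree at most k
on the reference facet, so that the jump itself can be used as test function
(`normalFlux_add_eq_zero`).

Two matters are implicit on paper. The ALE map and u are differentiable in time only point by point;
since the degrees are bounded, this forces the coefficients to be differentiable
(`exists_hasDerivWithinAt_poly`), so ω is polynomial on the reference element and differentiation
under the integral is legitimate. Moreover, that a facet has at most two sides, with opposite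
normals, has to be derived from conformity and injectivity (`normal_eq_neg`, `eq_of_facet_eq`). The
restriction to d = 2, 3 serves the explicit determinant computations in `sum_pderiv_adjugate`,
`hasDerivWithinAt_det` and `sq_det_refFacet`. -/

@[simp] theorem bary_zero (x : Vec n) : bary x 0 = 1 - ∑ i, x i := rfl

@[simp] theorem bary_succ (x : Vec n) (i : Fin n) : bary x i.succ = x i := rfl

theorem sum_bary (x : Vec n) : ∑ i, bary x i = 1 := by
  simp [Fin.sum_univ_succ]

theorem mem_refSimplex_iff (x : Vec n) : x ∈ refSimplex n ↔ ∀ i, 0 ≤ bary x i := by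
  simp [refSimplex, Fin.forall_fin_succ, and_comm]

@[simp] theorem refVertex_zero : refVertex (0 : Fin (n + 1)) = 0 := rfl

@[simp] theorem refVertex_succ (i : Fin n) :
    refVertex i.succ = EuclideanSpace.single i (1 : ℝ) := rfl

/-- The point with given barycentric coordinates. -/
def ofBary (w : Fin (n + 1) → ℝ) : Vec n := ∑ i, w i • refVertex i

theorem ofBary_apply (w : Fin (n + 1) → ℝ) (i : Fin n) : ofBary w i = w i.succ := by
  simp [ofBary, Fin.sum_univ_succ, Finset.sum_apply, Pi.single_apply]

theorem bary_ofBary {w : Fin (n + 1) → ℝ} (hw : ∑ i, w i = 1) : bary (ofBary w) = w := by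
  funext i
  refine Fin.cases ?_ (fun i => ?_) i
  · rw [Fin.sum_univ_succ] at hw
    simp only [bary_zero, ofBary_apply]; linarith
  · simp [ofBary_apply]

theorem ofBary_bary (x : Vec n) : ofBary (bary x) = x := by
  ext i; simp [ofBary_apply]

theorem bary_injective : Function.Injective (bary : Vec n → Fin (n + 1) → ℝ) := fun x y h => by
  rw [← ofBary_bary x, h, ofBary_bary]

theorem continuous_bary (i : Fin (n + 1)) : Continuous fun x : Vec n => bary x i := by
  refine Fin.cases ?_ (fun i => ?_) i
  · simp only [bary_zero]; fun_prop
  · simp only [bary_succ]; fun_prop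

/-- The interior of the reference simplex, in barycentric coordinates. -/
def openSimplex (n : ℕ) : Set (Vec n) := {x | ∀ i, 0 < bary x i}

theorem isOpen_openSimplex : IsOpen (openSimplex n) := by
  simp only [openSimplex, ofPred_forall]
  exact isOpen_iInter_of_finite fun i => isOpen_lt continuous_const (continuous_bary i)

theorem openSimplex_subset : openSimplex n ⊆ refSimplex n := fun x hx =>
  (mem_refSimplex_iff x).2 fun i => (hx i).le

theorem openSimplex_nonempty : (openSimplex n).Nonempty := by
  refine ⟨ofBary fun _ => ((n : ℝ) + 1)⁻¹, fun i => ?_⟩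
  rw [bary_ofBary]
  · positivity
  · simp; field_simp

theorem isClosed_refSimplex : IsClosed (refSimplex n) := by
  have : refSimplex n = ⋂ i, {x | 0 ≤ bary x i} := by
    ext x; simp [mem_refSimplex_iff]
  rw [this]
  exact isClosed_iInter fun i => isClosed_le continuous_const (continuous_bary i)

theorem le_one_of_mem_refSimplex {x : Vec n} (hx : x ∈ refSimplex n) (i : Fin n) : x i ≤ 1 :=
  (Finset.single_le_sum (fun j _ => hx.1 j) (Finset.mem_univ i)).trans hx.2

theorem isCompact_refSimplex : IsCompact (refSimplex n) := by
  have h : refSimplex n ⊆ WithLp.toLp 2 '' (Icc (0 : Fin n → ℝ) 1) := fun x hx =>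
    ⟨x.ofLp, ⟨fun i => hx.1 i, fun i => le_one_of_mem_refSimplex hx i⟩, rfl⟩
  exact (isCompact_Icc.image (PiLp.continuous_toLp 2 _)).of_isClosed_subset isClosed_refSimplex h

theorem measurableSet_refSimplex : MeasurableSet (refSimplex n) :=
  isClosed_refSimplex.measurableSet

theorem convex_refSimplex : Convex ℝ (refSimplex n) := by
  intro x hx y hy a b ha hb hab
  rw [mem_refSimplex_iff] at *
  intro i
  have : bary (a • x + b • y) i = a * bary x i + b * bary y i := by
    refine Fin.cases ?_ (fun i => ?_) i
    · simp [Finset.sum_add_distrib, ← Finset.mul_sum]; linear_combination -hab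
    · simp
  rw [this]
  exact add_nonneg (mul_nonneg ha (hx i)) (mul_nonneg hb (hy i))

theorem openSimplex_subset_interior : openSimplex n ⊆ interior (refSimplex n) :=
  interior_maximal openSimplex_subset isOpen_openSimplex

theorem uniqueDiffOn_refSimplex : UniqueDiffOn ℝ (refSimplex n) :=
  uniqueDiffOn_convex convex_refSimplex (openSimplex_nonempty.mono openSimplex_subset_interior)

theorem refSimplex_subset_closure : refSimplex n ⊆ closure (interior (refSimplex n)) := by
  rw [convex_refSimplex.closure_interior_eq_closure_of_nonempty_interior
    (openSimplex_nonempty.mono openSimplex_subset_interior)]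
  exact subset_closure

/-- The faces of the simplex are null sets. -/
theorem ae_mem_openSimplex : ∀ᵐ x ∂(volume.restrict (refSimplex n)), x ∈ openSimplex n := by
  have hfr : volume (frontier (refSimplex n)) = 0 :=
    convex_refSimplex.addHaar_frontier volume
  have hsub : ∀ x ∈ interior (refSimplex n), x ∈ openSimplex n := by
    intro x hx
    by_contra hcon
    simp only [openSimplex, mem_ofPred_eq, not_forall, not_lt] at hcon
    obtain ⟨i, hi⟩ := hcon
    have hxi : bary x i = 0 := le_antisymm hi ((mem_refSimplex_iff x).1 (interior_subset hx) i)
    -- Moving from x slightly away from an interior point o makes the vanishing coordinate i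
    -- negative, so x cannot be interior.
    obtain ⟨o, ho⟩ := openSimplex_nonempty (n := n)
    have hcont : Continuous fun s : ℝ => x + s • (x - o) := by fun_prop
    have hev : ∀ᶠ s : ℝ in nhds 0, x + s • (x - o) ∈ refSimplex n := by
      have : (fun s : ℝ => x + s • (x - o)) 0 ∈ interior (refSimplex n) := by simpa using hx
      exact (hcont.continuousAt.eventually (isOpen_interior.mem_nhds this)).mono
        fun s hs => interior_subset hs
    obtain ⟨s, hs, hs0⟩ : ∃ s : ℝ, x + s • (x - o) ∈ refSimplex n ∧ 0 < s :=
      ((hev.filter_mono nhdsWithin_le_nhds).and self_mem_nhdsWithin).exists (f := nhdsWithin 0 (Ioi 0))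
    have h1 := (mem_refSimplex_iff _).1 hs i
    have h2 : bary (x + s • (x - o)) i = bary x i + s * (bary x i - bary o i) := by
      refine Fin.cases ?_ (fun i => ?_) i
      · simp [Finset.sum_add_distrib, ← Finset.mul_sum]; ring
      · simp
    have h3 := ho i
    rw [h2, hxi] at h1
    nlinarith
  rw [ae_restrict_iff' measurableSet_refSimplex]
  have : ∀ᵐ x ∂(volume : Measure (Vec n)), x ∉ frontier (refSimplex n) := by
    rw [ae_iff]; simpa using hfr
  filter_upwards [this] with x hx hxs
  apply hsub
  by_contra h
  exact hx ⟨subset_closure hxs, h⟩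

theorem eqOn_of_ae_eq_refSimplex {f g : Vec n → ℝ}
    (h : f =ᵐ[volume.restrict (refSimplex n)] g) (hf : ContinuousOn f (refSimplex n))
    (hg : ContinuousOn g (refSimplex n)) : EqOn f g (refSimplex n) :=
  Measure.eqOn_of_ae_eq h hf hg refSimplex_subset_closure

/-- A continuous function whose square has integral zero vanishes. -/
theorem eq_zero_of_integral_sq_eq_zero {f : Vec n → ℝ} (hf : ContinuousOn f (refSimplex n))
    (h : ∫ x in refSimplex n, f x ^ 2 = 0) : ∀ x ∈ refSimplex n, f x = 0 := by
  have hinter : IntegrableOn (fun x => f x ^ 2) (refSimplex n) :=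
    (hf.pow 2).integrableOn_compact isCompact_refSimplex
  have h1 := (integral_eq_zero_iff_of_nonneg (fun x => sq_nonneg (f x)) hinter).1 h
  have h2 : f =ᵐ[volume.restrict (refSimplex n)] fun _ => 0 := by
    filter_upwards [h1] with x hx
    simpa using hx
  exact eqOn_of_ae_eq_refSimplex h2 hf continuousOn_const

/-! ### Affine maps given by the images of the vertices -/

/-- The linear part of the affine map of the reference simplex with vertices `V`. -/
def affLin {d : ℕ} (V : Fin (n + 1) → Vec d) : Vec n →L[ℝ] Vec d :=
  ∑ i, (EuclideanSpace.proj i : Vec n →L[ℝ] ℝ).smulRight (V i.succ - V 0)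

theorem affLin_apply {d : ℕ} (V : Fin (n + 1) → Vec d) (x : Vec n) :
    affLin V x = ∑ i, x i • (V i.succ - V 0) := by
  simp [affLin]

theorem sum_bary_smul {d : ℕ} (V : Fin (n + 1) → Vec d) (x : Vec n) :
    ∑ i, bary x i • V i = V 0 + affLin V x := by
  simp [Fin.sum_univ_succ, affLin_apply, smul_sub, sub_smul, Finset.sum_smul]
  abel

theorem hasStrictFDerivAt_sum_bary {d : ℕ} (V : Fin (n + 1) → Vec d) (x : Vec n) :
    HasStrictFDerivAt (fun x => ∑ i, bary x i • V i) (affLin V) x := by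
  simp only [sum_bary_smul]
  exact (affLin V).hasStrictFDerivAt.const_add _

theorem hasFDerivAt_relabel (σ : Equiv.Perm (Fin (n + 1))) (x : Vec n) :
    HasFDerivAt (relabel σ) (affLin fun i => refVertex (σ i)) x :=
  (hasStrictFDerivAt_sum_bary (fun i => refVertex (σ i)) x).hasFDerivAt

theorem hasFDerivAt_refFacetMap (l : Fin (n + 2)) (z : Vec n) :
    HasFDerivAt (refFacetMap l) (affLin fun i => refVertex (l.succAbove i)) z :=
  (hasStrictFDerivAt_sum_bary (fun i => refVertex (l.succAbove i)) z).hasFDerivAt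

theorem continuous_refFacetMap (l : Fin (n + 2)) : Continuous (refFacetMap l) :=
  continuous_iff_continuousAt.2 fun z => (hasFDerivAt_refFacetMap l z).continuousAt

theorem continuous_relabel (σ : Equiv.Perm (Fin (n + 1))) : Continuous (relabel σ) :=
  continuous_iff_continuousAt.2 fun z => (hasFDerivAt_relabel σ z).continuousAt

theorem relabel_eq_ofBary (σ : Equiv.Perm (Fin (n + 1))) (x : Vec n) :
    relabel σ x = ofBary fun i => bary x (σ.symm i) := by
  rw [relabel, ofBary, ← Equiv.sum_comp σ fun i => bary x (σ.symm i) • refVertex i]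
  simp only [Equiv.symm_apply_apply]

theorem bary_relabel (σ : Equiv.Perm (Fin (n + 1))) (x : Vec n) (i : Fin (n + 1)) :
    bary (relabel σ x) i = bary x (σ.symm i) := by
  rw [relabel_eq_ofBary, bary_ofBary]
  rw [← sum_bary x]
  exact Equiv.sum_comp σ.symm (bary x)

theorem relabel_relabel (σ τ : Equiv.Perm (Fin (n + 1))) (x : Vec n) :
    relabel σ (relabel τ x) = relabel (σ * τ) x := by
  apply bary_injective; funext i
  rw [bary_relabel, bary_relabel, bary_relabel]; rfl

theorem relabel_one (x : Vec n) : relabel 1 x = x := by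
  apply bary_injective; funext i
  rw [bary_relabel]; rfl

theorem relabel_symm_relabel (σ : Equiv.Perm (Fin (n + 1))) (x : Vec n) :
    relabel σ.symm (relabel σ x) = x := by
  rw [relabel_relabel, ← Equiv.Perm.inv_def, inv_mul_cancel, relabel_one]

theorem relabel_relabel_symm (σ : Equiv.Perm (Fin (n + 1))) (x : Vec n) :
    relabel σ (relabel σ.symm x) = x := by
  simpa using relabel_symm_relabel σ.symm x

theorem relabel_mem {σ : Equiv.Perm (Fin (n + 1))} {x : Vec n} (hx : x ∈ refSimplex n) :
    relabel σ x ∈ refSimplex n := by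
  rw [mem_refSimplex_iff] at *
  intro i; rw [bary_relabel]; exact hx _

theorem relabel_injective (σ : Equiv.Perm (Fin (n + 1))) : Function.Injective (relabel σ) :=
  Function.LeftInverse.injective (g := relabel σ.symm) (relabel_symm_relabel σ)

theorem image_relabel (σ : Equiv.Perm (Fin (n + 1))) :
    relabel σ '' refSimplex n = refSimplex n := by
  apply Subset.antisymm
  · rintro _ ⟨x, hx, rfl⟩; exact relabel_mem hx
  · intro x hx
    exact ⟨_, relabel_mem hx, relabel_relabel_symm σ x⟩

/-- Relabelling is multiplicative in the permutation and a permutation has finite order, so some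
positive power of the determinant is 1. -/
theorem abs_det_relabel (σ : Equiv.Perm (Fin (n + 1))) :
    |(affLin (fun i => refVertex (σ i)) : Vec n →L[ℝ] Vec n).det| = 1 := by
  have hmul : ∀ σ τ : Equiv.Perm (Fin (n + 1)),
      (affLin (fun i => refVertex ((σ * τ) i)) : Vec n →L[ℝ] Vec n) =
        (affLin fun i => refVertex (σ i)).comp (affLin fun i => refVertex (τ i)) := by
    intro σ τ
    have h1 := (hasFDerivAt_relabel σ (relabel τ 0)).comp 0 (hasFDerivAt_relabel τ 0)
    have h2 : relabel σ ∘ relabel τ = relabel (σ * τ) := funext (relabel_relabel σ τ)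
    rw [h2] at h1
    exact (hasFDerivAt_relabel (σ * τ) 0).unique h1
  have hone : (affLin (fun i => refVertex ((1 : Equiv.Perm (Fin (n + 1))) i)) :
      Vec n →L[ℝ] Vec n) = ContinuousLinearMap.id ℝ _ := by
    have h1 : relabel (1 : Equiv.Perm (Fin (n + 1))) = id := funext relabel_one
    have h2 := hasFDerivAt_relabel (1 : Equiv.Perm (Fin (n + 1))) (0 : Vec n)
    rw [h1] at h2
    exact h2.unique (hasFDerivAt_id _)
  have hpow : ∀ k : ℕ, (affLin (fun i => refVertex ((σ ^ k) i)) : Vec n →L[ℝ] Vec n).det =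
      (affLin (fun i => refVertex (σ i)) : Vec n →L[ℝ] Vec n).det ^ k := by
    intro k
    induction k with
    | zero => simp only [pow_zero]; rw [hone]; simp [ContinuousLinearMap.det]
    | succ k ih =>
      rw [pow_succ, hmul, pow_succ, ← ih]
      simp [ContinuousLinearMap.det]
  have h := hpow (orderOf σ)
  rw [pow_orderOf_eq_one, hone] at h
  have h1 : |(affLin (fun i => refVertex (σ i)) : Vec n →L[ℝ] Vec n).det| ^ orderOf σ = 1 := by
    rw [← abs_pow, ← h]; simp [ContinuousLinearMap.det]
  exact (pow_eq_one_iff_of_nonneg (abs_nonneg _) (orderOf_pos σ).ne').1 h1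

theorem integral_relabel (σ : Equiv.Perm (Fin (n + 1))) (g : Vec n → ℝ) :
    ∫ z in refSimplex n, g (relabel σ z) = ∫ z in refSimplex n, g z := by
  have h := integral_image_eq_integral_abs_det_fderiv_smul volume (measurableSet_refSimplex (n := n))
    (fun x _ => (hasFDerivAt_relabel σ x).hasFDerivWithinAt) (relabel_injective σ).injOn g
  rw [image_relabel] at h
  rw [h]; simp only [abs_det_relabel, one_smul]

/-! ### Facets of the reference simplex -/

theorem refFacetMap_eq_ofBary (l : Fin (n + 2)) (z : Vec n) :
    refFacetMap l z = ofBary (l.insertNth (α := fun _ => ℝ) 0 (bary z)) := by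
  rw [ofBary, Fin.sum_univ_succAbove _ l]
  simp [refFacetMap]

theorem bary_refFacetMap (l : Fin (n + 2)) (z : Vec n) :
    bary (refFacetMap l z) = l.insertNth (α := fun _ => ℝ) 0 (bary z) := by
  rw [refFacetMap_eq_ofBary, bary_ofBary]
  rw [Fin.sum_univ_succAbove _ l]
  simpa using sum_bary z

@[simp] theorem bary_refFacetMap_same (l : Fin (n + 2)) (z : Vec n) :
    bary (refFacetMap l z) l = 0 := by
  simp [bary_refFacetMap]

@[simp] theorem bary_refFacetMap_succAbove (l : Fin (n + 2)) (z : Vec n) (j : Fin (n + 1)) :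
    bary (refFacetMap l z) (l.succAbove j) = bary z j := by
  simp [bary_refFacetMap]

theorem refFacetMap_mem {l : Fin (n + 2)} {z : Vec n} (hz : z ∈ refSimplex n) :
    refFacetMap l z ∈ refSimplex (n + 1) := by
  rw [mem_refSimplex_iff] at *
  intro i
  rcases Fin.eq_self_or_eq_succAbove l i with rfl | ⟨j, rfl⟩
  · simp
  · simpa using hz j

theorem refFacetMap_injective (l : Fin (n + 2)) : Function.Injective (refFacetMap l) := by
  intro z z' h
  apply bary_injective; funext j
  rw [← bary_refFacetMap_succAbove l, h, bary_refFacetMap_succAbove]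

/-- The outward normal of the `l`-th reference facet, scaled by its area element. -/
def areaNormal (l : Fin (n + 2)) : Vec (n + 1) :=
  Fin.cases (motive := fun _ => Vec (n + 1)) (WithLp.toLp 2 (fun _ : Fin (n + 1) => (1 : ℝ)))
    (fun i => -EuclideanSpace.single i 1) l

/-- Physical normals are normalized after the transformation, so only the direction of the reference
normal matters; `areaNormal` is the representative with rational entries. -/
theorem refNormal_eq_smul (l : Fin (n + 2)) :
    ∃ c : ℝ, 0 < c ∧ refNormal l = c • areaNormal l := by
  refine Fin.cases ⟨(Real.sqrt ((n : ℝ) + 1))⁻¹, by positivity, rfl⟩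
    (fun i => ⟨1, one_pos, ?_⟩) l
  simp [refNormal, areaNormal]

/-- The area normal is minus the gradient of the affine function `bary · l`. Both its orthogonality
to the facet and its pointing outward are read off from this. -/
theorem bary_sub_bary (l : Fin (n + 2)) (x y : Vec (n + 1)) :
    bary y l - bary x l = -inner ℝ (y - x) (areaNormal l) := by
  refine Fin.cases ?_ (fun i => ?_) l
  · simp [areaNormal, PiLp.inner_apply]
  · simp [areaNormal, inner_neg_right, EuclideanSpace.inner_single_right]

theorem areaNormal_ne_zero (l : Fin (n + 2)) : areaNormal l ≠ 0 := by
  intro h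
  refine Fin.cases (fun h => ?_) (fun i h => ?_) l h
  · simpa [areaNormal] using congrArg (fun v : Vec (n + 1) => v 0) h
  · simpa [areaNormal] using congrArg (fun v : Vec (n + 1) => v i) h

end Bary


/-! ### Polynomials as functions -/

section Poly

variable {d : ℕ}

/-- The polynomial function on `ℝᵈ` of a polynomial. -/
def pev (p : MvPolynomial (Fin d) ℝ) (y : Vec d) : ℝ := MvPolynomial.eval (fun i => y i) p

@[simp] theorem pev_add (p q : MvPolynomial (Fin d) ℝ) (y : Vec d) :
    pev (p + q) y = pev p y + pev q y := by simp [pev]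

@[simp] theorem pev_sub (p q : MvPolynomial (Fin d) ℝ) (y : Vec d) :
    pev (p - q) y = pev p y - pev q y := by simp [pev]

@[simp] theorem pev_mul (p q : MvPolynomial (Fin d) ℝ) (y : Vec d) :
    pev (p * q) y = pev p y * pev q y := by simp [pev]

@[simp] theorem pev_sum {ι : Type*} (s : Finset ι) (p : ι → MvPolynomial (Fin d) ℝ) (y : Vec d) :
    pev (∑ i ∈ s, p i) y = ∑ i ∈ s, pev (p i) y := by simp [pev]

@[simp] theorem pev_smul (c : ℝ) (p : MvPolynomial (Fin d) ℝ) (y : Vec d) :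
    pev (c • p) y = c * pev p y := by simp [pev]

/-- The derivative of a polynomial function. -/
def pgrad (p : MvPolynomial (Fin d) ℝ) (y : Vec d) : Vec d →L[ℝ] ℝ :=
  ∑ i, pev (MvPolynomial.pderiv i p) y • (EuclideanSpace.proj i : Vec d →L[ℝ] ℝ)

theorem pgrad_apply (p : MvPolynomial (Fin d) ℝ) (y v : Vec d) :
    pgrad p y v = ∑ i, pev (MvPolynomial.pderiv i p) y * v i := by
  simp [pgrad]

/-- Strict differentiability is what the inverse function theorem in `eventually_mem_elem` asks for.
-/
theorem hasStrictFDerivAt_pev (p : MvPolynomial (Fin d) ℝ) (y : Vec d) :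
    HasStrictFDerivAt (pev p) (pgrad p y) y := by
  induction p using MvPolynomial.induction_on with
  | C a =>
    have h1 : pev (MvPolynomial.C a : MvPolynomial (Fin d) ℝ) = fun _ => a := by
      funext y; simp [pev]
    have h2 : pgrad (MvPolynomial.C a : MvPolynomial (Fin d) ℝ) y = 0 := by
      ext v; simp [pgrad_apply, pev]
    rw [h1, h2]; exact hasStrictFDerivAt_const _ _
  | add p q hp hq =>
    have h1 : pev (p + q) = fun y => pev p y + pev q y := by funext y; simp
    have h2 : pgrad (p + q) y = pgrad p y + pgrad q y := by
      ext v; simp [pgrad_apply, add_mul, Finset.sum_add_distrib]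
    rw [h1, h2]; exact hp.add hq
  | mul_X p j hp =>
    have h1 : pev (p * MvPolynomial.X j) = fun y => pev p y * y j := by funext y; simp [pev]
    have h2 : pgrad (p * MvPolynomial.X j) y =
        pev p y • (EuclideanSpace.proj j : Vec d →L[ℝ] ℝ) + (y j) • pgrad p y := by
      ext v
      simp only [pgrad_apply, MvPolynomial.pderiv_mul, pev_add, pev_mul, add_mul,
        Finset.sum_add_distrib, add_apply, smul_apply,
        smul_eq_mul, PiLp.proj_apply]
      rw [add_comm]
      congr 1
      · rw [Finset.sum_eq_single j]
        · simp [pev]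
        · intro b _ hb; simp [pev, MvPolynomial.pderiv_X_of_ne hb.symm]
        · simp
      · rw [Finset.mul_sum]
        refine Finset.sum_congr rfl fun i _ => ?_
        simp [pev]; ring
    rw [h1, h2]
    exact hp.mul (EuclideanSpace.proj j : Vec d →L[ℝ] ℝ).hasStrictFDerivAt

@[fun_prop]
theorem continuous_pev (p : MvPolynomial (Fin d) ℝ) : Continuous (pev p) :=
  continuous_iff_continuousAt.2 fun y => (hasStrictFDerivAt_pev p y).hasFDerivAt.continuousAt

/-- The commutator of two derivations is again a derivation, and this one kills every variable. -/
theorem pderiv_pderiv_comm (i j : Fin d) (p : MvPolynomial (Fin d) ℝ) :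
    MvPolynomial.pderiv i (MvPolynomial.pderiv j p) =
      MvPolynomial.pderiv j (MvPolynomial.pderiv i p) := by
  have h : ⁅MvPolynomial.pderiv (R := ℝ) i, MvPolynomial.pderiv (R := ℝ) j⁆ = 0 := by
    apply MvPolynomial.derivation_ext
    intro k
    simp only [Derivation.commutator_apply, MvPolynomial.pderiv_X, Derivation.coe_zero,
      Pi.zero_apply]
    rw [Pi.single_apply, Pi.single_apply]
    split_ifs <;> simp
  have h2 := congrArg (fun D : Derivation ℝ _ _ => D p) h
  simp only [Derivation.commutator_apply, Derivation.coe_zero, Pi.zero_apply] at h2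
  exact sub_eq_zero.1 h2

/-- Needed with the truncated `- 1`, to place the divergence of a field of degree k in the test
space of degree `k - 1`. A monomial without the variable i disappears; in the others the exponent of
i is at least 1 and the subtraction is exact. -/
theorem totalDegree_pderiv_le (i : Fin d) (p : MvPolynomial (Fin d) ℝ) :
    (MvPolynomial.pderiv i p).totalDegree ≤ p.totalDegree - 1 := by
  conv_lhs => rw [p.as_sum, map_sum]
  refine MvPolynomial.totalDegree_finsetSum_le fun m hm => ?_
  rw [MvPolynomial.pderiv_monomial]
  by_cases h0 : m i = 0
  · simp [h0]
  · refine (MvPolynomial.totalDegree_monomial_le _ _).trans ?_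
    change ((m - Finsupp.single i 1).sum fun _ e => e) ≤ _
    have h1 := MvPolynomial.le_totalDegree hm
    have h2 : m = (m - Finsupp.single i 1) + Finsupp.single i 1 := by
      ext j
      by_cases hj : j = i
      · subst hj; simp; omega
      · simp [Ne.symm hj]
    have h3 : (m.sum fun _ e => e) = ((m - Finsupp.single i 1).sum fun _ e => e) + 1 := by
      conv_lhs => rw [h2]
      rw [Finsupp.sum_add_index' (by simp) (by simp)]
      rw [Finsupp.sum_single_index rfl]
    omega

theorem totalDegree_bind_le {e : ℕ} (q : Fin d → MvPolynomial (Fin e) ℝ)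
    (hq : ∀ i, (q i).totalDegree ≤ 1) (p : MvPolynomial (Fin d) ℝ) :
    (MvPolynomial.bind₁ q p).totalDegree ≤ p.totalDegree := by
  conv_lhs => rw [p.as_sum, map_sum]
  refine MvPolynomial.totalDegree_finsetSum_le fun m hm => ?_
  rw [MvPolynomial.bind₁_monomial]
  refine (MvPolynomial.totalDegree_mul _ _).trans ?_
  rw [MvPolynomial.totalDegree_C, zero_add]
  refine (MvPolynomial.totalDegree_finsetProd _ _).trans (le_trans ?_
    (MvPolynomial.le_totalDegree hm))
  refine Finset.sum_le_sum fun i _ => (MvPolynomial.totalDegree_pow _ _).trans ?_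
  calc m i * (q i).totalDegree ≤ m i * 1 := Nat.mul_le_mul_left _ (hq i)
    _ = m i := mul_one _

theorem isPoly_pev {k : ℕ} {p : MvPolynomial (Fin d) ℝ} (hp : p.totalDegree ≤ k) :
    IsPoly k (pev p) := ⟨p, hp, fun _ _ => rfl⟩

theorem isPoly_zero {k : ℕ} : IsPoly k (fun _ : Vec d => (0 : ℝ)) := ⟨0, by simp, by simp⟩

theorem IsPoly.congr {k : ℕ} {f g : Vec d → ℝ} (hf : IsPoly k f)
    (h : ∀ x ∈ refSimplex d, g x = f x) : IsPoly k g := by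
  obtain ⟨p, hp, hpf⟩ := hf
  exact ⟨p, hp, fun x hx => (h x hx).trans (hpf x hx)⟩

theorem IsPoly.add {k : ℕ} {f g : Vec d → ℝ} (hf : IsPoly k f) (hg : IsPoly k g) :
    IsPoly k fun x => f x + g x := by
  obtain ⟨p, hp, hpf⟩ := hf
  obtain ⟨q, hq, hqg⟩ := hg
  exact ⟨p + q, (MvPolynomial.totalDegree_add p q).trans (max_le hp hq), fun x hx => by
    simp only [hpf x hx, hqg x hx, map_add]⟩

theorem IsPoly.continuousOn {k : ℕ} {f : Vec d → ℝ} (hf : IsPoly k f) :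
    ContinuousOn f (refSimplex d) := by
  obtain ⟨p, hp, hpf⟩ := hf
  exact (continuous_pev p).continuousOn.congr hpf

/-- Composition with an affine map does not raise the degree. This covers both restriction to a
facet and relabelling of the vertices of a facet. -/
theorem IsPoly.comp_sum_bary {e k : ℕ} {g : Vec d → ℝ} (hg : IsPoly k g)
    (V : Fin (e + 1) → Vec d)
    (hV : ∀ z ∈ refSimplex e, ∑ i, bary z i • V i ∈ refSimplex d) :
    IsPoly k fun z : Vec e => g (∑ i, bary z i • V i) := by
  obtain ⟨p, hp, hpg⟩ := hg
  let q : Fin d → MvPolynomial (Fin e) ℝ := fun a =>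
    MvPolynomial.C (V 0 a) + ∑ i, MvPolynomial.C (V i.succ a - V 0 a) * MvPolynomial.X i
  have hq : ∀ a, (q a).totalDegree ≤ 1 := by
    intro a
    refine (MvPolynomial.totalDegree_add _ _).trans (max_le (by simp) ?_)
    refine MvPolynomial.totalDegree_finsetSum_le fun i _ => ?_
    refine (MvPolynomial.totalDegree_mul _ _).trans ?_
    rw [MvPolynomial.totalDegree_C, MvPolynomial.totalDegree_X, zero_add]
  refine ⟨MvPolynomial.bind₁ q p, (totalDegree_bind_le q hq p).trans hp, fun z hz => ?_⟩
  simp only [hpg _ (hV z hz)]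
  rw [sum_bary_smul]
  rw [← MvPolynomial.coe_aeval_eq_eval, ← MvPolynomial.coe_aeval_eq_eval]
  simp only [RingHom.coe_coe, MvPolynomial.aeval_bind₁]
  congr 2
  funext a
  simp [q, affLin_apply, Finset.sum_apply, mul_comm]

/-! ### Curves of polynomials -/

theorem eq_of_eqOn_refSimplex {p q : MvPolynomial (Fin d) ℝ}
    (h : ∀ y ∈ refSimplex d, pev p y = pev q y) : p = q := by
  -- The simplex contains the cube with side 1/(d+1), a product of infinite sets; the denominator
  -- d+1 also serves d = 0.
  refine MvPolynomial.funext_set (fun _ => Icc (0 : ℝ) ((d : ℝ) + 1)⁻¹)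
    (fun _ => Icc_infinite (by positivity)) fun x hx => ?_
  refine h (WithLp.toLp 2 x) ⟨fun i => (hx i trivial).1, ?_⟩
  calc ∑ i, x i ≤ ∑ _i : Fin d, ((d : ℝ) + 1)⁻¹ := Finset.sum_le_sum fun i _ => (hx i trivial).2
    _ = d * ((d : ℝ) + 1)⁻¹ := by simp
    _ ≤ 1 := by rw [← div_eq_mul_inv, div_le_one (by positivity)]; linarith

/-- A curve of polynomials of bounded degree that is differentiable at each point of the reference
simplex is differentiable as a curve in the space of polynomials. -/
theorem exists_hasDerivWithinAt_poly {k : ℕ} {S : Set ℝ} {t : ℝ}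
    {P : ℝ → MvPolynomial (Fin d) ℝ} (hdeg : ∀ s, (P s).totalDegree ≤ k)
    (hdiff : ∀ y ∈ refSimplex d, DifferentiableWithinAt ℝ (fun s => pev (P s) y) S t) :
    ∃ P' : MvPolynomial (Fin d) ℝ, P'.totalDegree ≤ k ∧
      ∀ {E : Type} [NormedAddCommGroup E] [NormedSpace ℝ E] (Λ : MvPolynomial (Fin d) ℝ →ₗ[ℝ] E),
        HasDerivWithinAt (fun s => Λ (P s)) (Λ P') S t := by
  let V := MvPolynomial.restrictTotalDegree (Fin d) ℝ k
  let b := Module.finBasis ℝ V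
  let c : ℝ → (Fin (Module.finrank ℝ V) → ℝ) := fun s =>
    b.equivFun ⟨P s, (MvPolynomial.mem_restrictTotalDegree _ _ _).2 (hdeg s)⟩
  let I : (Fin (Module.finrank ℝ V) → ℝ) →ₗ[ℝ] (refSimplex d → ℝ) :=
    (LinearMap.pi fun y : refSimplex d =>
      (MvPolynomial.aeval fun i => (y : Vec d) i : MvPolynomial (Fin d) ℝ →ₐ[ℝ] ℝ).toLinearMap) ∘ₗ
      V.subtype ∘ₗ (b.equivFun.symm : _ →ₗ[ℝ] V)
  have hIw : ∀ w (y : refSimplex d),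
      I w y = pev ((b.equivFun.symm w : V) : MvPolynomial (Fin d) ℝ) y := fun w y => by
    simp only [I, pev, ← MvPolynomial.coe_aeval_eq_eval]; rfl
  -- An injective linear map from a finite-dimensional space is a closed embedding, here for the
  -- topology of pointwise convergence. Hence pointwise convergent difference quotients have a limit
  -- in the range, and their coefficients converge.
  have hI : Topology.IsClosedEmbedding I := by
    apply LinearMap.isClosedEmbedding_of_injective
    rw [LinearMap.ker_eq_bot]
    intro w w' h
    apply b.equivFun.symm.injective
    apply Subtype.ext
    exact eq_of_eqOn_refSimplex fun y hy => by
      rw [← hIw w ⟨y, hy⟩, ← hIw w' ⟨y, hy⟩, h]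
  have hIc : ∀ s (y : refSimplex d), I (c s) y = pev (P s) y := by
    intro s y
    simp [hIw, c]
  have hlim : Filter.Tendsto (fun s => I (slope c t s)) (nhdsWithin t (S \ {t}))
      (nhds fun y : refSimplex d => derivWithin (fun s => pev (P s) y) S t) := by
    rw [tendsto_pi_nhds]
    intro y
    have h := hasDerivWithinAt_iff_tendsto_slope.1 (hdiff y y.2).hasDerivWithinAt
    refine h.congr fun s => ?_
    simp only [slope, vsub_eq_sub, map_smul, map_sub, Pi.smul_apply, Pi.sub_apply, hIc]
  -- If t is not an accumulation point of S, any value is a derivative within S.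
  rcases Filter.eq_or_neBot (nhdsWithin t (S \ {t})) with hbot | hne
  · refine ⟨0, by simp, fun Λ => ?_⟩
    rw [hasDerivWithinAt_iff_tendsto_slope, hbot]
    exact Filter.tendsto_bot
  obtain ⟨c', hc'⟩ := hI.isClosed_range.mem_of_tendsto hlim
    (Filter.Eventually.of_forall fun s => mem_range_self _)
  have hc : HasDerivWithinAt c c' S t := by
    rw [hasDerivWithinAt_iff_tendsto_slope, hI.tendsto_nhds_iff, hc']
    exact hlim
  refine ⟨(b.equivFun.symm c' : V), ?_, fun {E} _ _ Λ => ?_⟩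
  · exact (MvPolynomial.mem_restrictTotalDegree _ _ _).1 (b.equivFun.symm c').2
  · let L : (Fin (Module.finrank ℝ V) → ℝ) →ₗ[ℝ] E :=
      Λ ∘ₗ V.subtype ∘ₗ (b.equivFun.symm : _ →ₗ[ℝ] V)
    have h := (LinearMap.toContinuousLinearMap L).hasFDerivAt.comp_hasDerivWithinAt t hc
    have h2 : (⇑(LinearMap.toContinuousLinearMap L) ∘ c) = fun s => Λ (P s) := by
      funext s; simp [L, c]
    rw [h2] at h
    exact h

end Poly


/-! ### The divergence theorem on the reference simplex -/

section Divergence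

variable {n : ℕ}

/-- Insert the coordinate `a` at the place `i`. -/
def insertCoord (i : Fin (n + 1)) (a : ℝ) (z : Vec n) : Vec (n + 1) :=
  WithLp.toLp 2 (i.insertNth (α := fun _ => ℝ) a fun j => z j)

@[simp] theorem insertCoord_same (i : Fin (n + 1)) (a : ℝ) (z : Vec n) :
    insertCoord i a z i = a := by simp [insertCoord]

@[simp] theorem insertCoord_succAbove (i : Fin (n + 1)) (a : ℝ) (z : Vec n) (j : Fin n) :
    insertCoord i a z (i.succAbove j) = z j := by simp [insertCoord]

theorem insertCoord_zero (i : Fin (n + 1)) (z : Vec n) :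
    insertCoord i 0 z = refFacetMap i.succ z := by
  ext k
  rw [← bary_succ (refFacetMap i.succ z)]
  rcases Fin.eq_self_or_eq_succAbove i k with rfl | ⟨j, rfl⟩
  · rw [bary_refFacetMap_same]; simp
  · rw [← Fin.succ_succAbove_succ, bary_refFacetMap_succAbove]; simp

/-- The line in direction i leaves the simplex through the slanted facet. Parametrizing that facet
by the other coordinates lists its vertices in another order than `refFacetMap 0` does, the
difference being a cycle. -/
theorem insertCoord_one_sub (i : Fin (n + 1)) (z : Vec n) :
    insertCoord i (1 - ∑ j, z j) z = refFacetMap 0 (relabel i.cycleRange.symm z) := by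
  ext k
  rw [← bary_succ (refFacetMap 0 (relabel i.cycleRange.symm z)), ← Fin.zero_succAbove k,
    bary_refFacetMap_succAbove, bary_relabel, Equiv.symm_symm]
  rcases Fin.eq_self_or_eq_succAbove i k with rfl | ⟨j, rfl⟩
  · simp
  · have : i.cycleRange (i.succAbove j) = j.succ := by
      rw [← Fin.cycleRange_symm_succ, Equiv.apply_symm_apply]
    rw [this]; simp

theorem insertCoord_mem_iff (i : Fin (n + 1)) (a : ℝ) (z : Vec n) :
    insertCoord i a z ∈ refSimplex (n + 1) ↔
      z ∈ refSimplex n ∧ a ∈ Icc 0 (1 - ∑ j, z j) := by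
  simp only [refSimplex, mem_ofPred_eq, mem_Icc, Fin.sum_univ_succAbove _ i, insertCoord_same,
    insertCoord_succAbove, Fin.forall_iff_succAbove i]
  constructor
  · rintro ⟨⟨h1, h2⟩, h3⟩
    exact ⟨⟨h2, by linarith⟩, h1, by linarith⟩
  · rintro ⟨⟨h1, h2⟩, h3, h4⟩
    exact ⟨⟨h3, h1⟩, by linarith⟩

theorem hasDerivAt_insertCoord (i : Fin (n + 1)) (a : ℝ) (z : Vec n) :
    HasDerivAt (fun a => insertCoord i a z) (EuclideanSpace.single i (1 : ℝ)) a := by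
  have h : (fun a => insertCoord i a z) =
      fun a => insertCoord i 0 z + a • EuclideanSpace.single i (1 : ℝ) := by
    funext a
    ext k
    rcases Fin.eq_self_or_eq_succAbove i k with rfl | ⟨j, rfl⟩
    · simp
    · simp [Fin.succAbove_ne]
  rw [h]
  simpa using ((hasDerivAt_id a).smul_const (EuclideanSpace.single i (1 : ℝ))).const_add
    (insertCoord i 0 z)

/-- Fubini along the i-th axis: the base is the reference simplex one dimension lower, and each
fibre is an interval from the facet `i.succ` to the facet 0. -/
theorem integral_refSimplex_eq (i : Fin (n + 1)) {h : Vec (n + 1) → ℝ}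
    (hh : IntegrableOn h (refSimplex (n + 1))) :
    ∫ x in refSimplex (n + 1), h x =
      ∫ z in refSimplex n, ∫ a in (0 : ℝ)..(1 - ∑ j, z j), h (insertCoord i a z) := by
  set H : Vec (n + 1) → ℝ := (refSimplex (n + 1)).indicator h with hH
  have hinter : Integrable H := hh.integrable_indicator measurableSet_refSimplex
  have e1 := PiLp.volume_preserving_toLp (Fin (n + 1))
  have e2 := (volume_preserving_piFinSuccAbove (fun _ : Fin (n + 1) => ℝ) i).symm
  have e3 := PiLp.volume_preserving_toLp (Fin n)
  have m1 : MeasurableEmbedding (WithLp.toLp 2 : (Fin (n + 1) → ℝ) → Vec (n + 1)) :=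
    (MeasurableEquiv.toLp 2 (Fin (n + 1) → ℝ)).measurableEmbedding
  have m3 : MeasurableEmbedding (WithLp.toLp 2 : (Fin n → ℝ) → Vec n) :=
    (MeasurableEquiv.toLp 2 (Fin n → ℝ)).measurableEmbedding
  have m2 := (MeasurableEquiv.piFinSuccAbove (fun _ : Fin (n + 1) => ℝ) i).symm.measurableEmbedding
  have e12 := e1.comp e2
  have hint2 : Integrable (fun p : ℝ × (Fin n → ℝ) => H (insertCoord i p.1 (WithLp.toLp 2 p.2)))
      (volume.prod volume) :=
    (e12.integrable_comp_emb (m1.comp m2)).2 hinter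
  calc ∫ x in refSimplex (n + 1), h x = ∫ x, H x :=
        (integral_indicator measurableSet_refSimplex).symm
    _ = ∫ p : ℝ × (Fin n → ℝ), H (insertCoord i p.1 (WithLp.toLp 2 p.2)) :=
        (e12.integral_comp (m1.comp m2) H).symm
    _ = ∫ z : Fin n → ℝ, ∫ a : ℝ, H (insertCoord i a (WithLp.toLp 2 z)) :=
        integral_prod_symm _ hint2
    _ = ∫ z : Vec n, ∫ a : ℝ, H (insertCoord i a z) :=
        e3.integral_comp m3 fun z => ∫ a : ℝ, H (insertCoord i a z)
    _ = ∫ z : Vec n, (refSimplex n).indicator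
          (fun z => ∫ a in (0 : ℝ)..(1 - ∑ j, z j), h (insertCoord i a z)) z := by
        refine integral_congr_ae (Filter.Eventually.of_forall fun z => ?_)
        by_cases hz : z ∈ refSimplex n
        · have h0 : 0 ≤ 1 - ∑ j, z j := by linarith [hz.2]
          simp only [indicator_of_mem hz]
          rw [intervalIntegral.integral_of_le h0, ← integral_Icc_eq_integral_Ioc,
            ← integral_indicator measurableSet_Icc]
          refine integral_congr_ae (Filter.Eventually.of_forall fun a => ?_)
          simp only [hH, indicator, insertCoord_mem_iff, hz, true_and]
        · simp [hH, indicator, insertCoord_mem_iff, hz]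
    _ = _ := integral_indicator measurableSet_refSimplex

/-- The fundamental theorem of calculus on each fibre. The cyclic reordering at the upper endpoint
disappears upon integration by `integral_relabel`. -/
theorem integral_partial_refSimplex (i : Fin (n + 1)) {g : Vec (n + 1) → ℝ}
    {g' : Vec (n + 1) → Vec (n + 1) →L[ℝ] ℝ}
    (hg : ∀ x ∈ refSimplex (n + 1), HasFDerivAt g (g' x) x)
    (hg' : ContinuousOn (fun x => g' x (EuclideanSpace.single i 1)) (refSimplex (n + 1))) :
    ∫ x in refSimplex (n + 1), g' x (EuclideanSpace.single i 1) =
      (∫ z in refSimplex n, g (refFacetMap 0 z)) - ∫ z in refSimplex n, g (refFacetMap i.succ z) := by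
  have hgc : ContinuousOn g (refSimplex (n + 1)) := fun x hx =>
    (hg x hx).continuousAt.continuousWithinAt
  have hfac : ∀ l, IntegrableOn (fun z => g (refFacetMap l z)) (refSimplex n) := fun l =>
    (hgc.comp (continuous_refFacetMap l).continuousOn
      fun z hz => refFacetMap_mem hz).integrableOn_compact isCompact_refSimplex
  rw [integral_refSimplex_eq i (hg'.integrableOn_compact isCompact_refSimplex),
    ← integral_relabel i.cycleRange.symm fun z => g (refFacetMap 0 z), ← integral_sub]
  · refine setIntegral_congr_fun measurableSet_refSimplex fun z hz => ?_
    simp only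
    rw [← insertCoord_one_sub, ← insertCoord_zero]
    have h0 : 0 ≤ 1 - ∑ j, z j := by linarith [hz.2]
    have hmem : ∀ a ∈ uIcc 0 (1 - ∑ j, z j), insertCoord i a z ∈ refSimplex (n + 1) := by
      intro a ha
      rw [uIcc_of_le h0] at ha
      exact (insertCoord_mem_iff i a z).2 ⟨hz, ha⟩
    have hcont : ContinuousOn (fun a => insertCoord i a z) (uIcc 0 (1 - ∑ j, z j)) :=
      fun a _ => (hasDerivAt_insertCoord i a z).continuousAt.continuousWithinAt
    exact intervalIntegral.integral_eq_sub_of_hasDerivAt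
      (f := fun a => g (insertCoord i a z))
      (fun a ha => (hg _ (hmem a ha)).comp_hasDerivAt a (hasDerivAt_insertCoord i a z))
      (hg'.comp hcont hmem).intervalIntegrable
  · have hc : ContinuousOn (fun z => g (refFacetMap 0 (relabel i.cycleRange.symm z)))
        (refSimplex n) :=
      hgc.comp ((continuous_refFacetMap 0).comp (continuous_relabel _)).continuousOn
        fun z hz => refFacetMap_mem (relabel_mem hz)
    exact hc.integrableOn_compact isCompact_refSimplex
  · exact hfac _

/-- The divergence theorem on the reference simplex. -/
theorem integral_div_refSimplex {X : Fin (n + 1) → Vec (n + 1) → ℝ}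
    {X' : Fin (n + 1) → Vec (n + 1) → Vec (n + 1) →L[ℝ] ℝ}
    (hX : ∀ i, ∀ x ∈ refSimplex (n + 1), HasFDerivAt (X i) (X' i x) x)
    (hX' : ∀ i, ContinuousOn (fun x => X' i x (EuclideanSpace.single i 1)) (refSimplex (n + 1))) :
    ∫ x in refSimplex (n + 1), ∑ i, X' i x (EuclideanSpace.single i 1) =
      ∑ l, ∫ z in refSimplex n, ∑ i, X i (refFacetMap l z) * areaNormal l i := by
  have hXc : ∀ i, ContinuousOn (X i) (refSimplex (n + 1)) := fun i x hx =>
    (hX i x hx).continuousAt.continuousWithinAt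
  have hfac : ∀ i l, IntegrableOn (fun z => X i (refFacetMap l z)) (refSimplex n) := fun i l =>
    ((hXc i).comp (continuous_refFacetMap l).continuousOn
      fun z hz => refFacetMap_mem hz).integrableOn_compact isCompact_refSimplex
  rw [integral_finsetSum _ fun i _ => (hX' i).integrableOn_compact isCompact_refSimplex]
  simp_rw [fun i => integral_partial_refSimplex i (hX i) (hX' i)]
  -- The facet 0 has area normal (1, …, 1) and collects the upper endpoints from every direction;
  -- the facet `i.succ` has -eᵢ and receives only the lower endpoints of direction i.
  rw [Fin.sum_univ_succ (n := n + 1), Finset.sum_sub_distrib, sub_eq_add_neg, ← Finset.sum_neg_distrib]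
  congr 1
  · rw [← integral_finsetSum _ fun i _ => hfac i 0]
    simp [areaNormal]
  · refine Finset.sum_congr rfl fun i _ => ?_
    rw [← integral_neg]
    refine setIntegral_congr_fun measurableSet_refSimplex fun z hz => ?_
    simp only [areaNormal, Fin.cases_succ, PiLp.neg_apply]
    rw [Finset.sum_eq_single i]
    · simp
    · intro b _ hb; simp [hb]
    · simp

end Divergence


/-! ### Linear algebra -/

section LinAlg

theorem apply_eq_sum {d e : ℕ} (F : Vec d →L[ℝ] Vec e) (v : Vec d) (i : Fin e) :
    F v i = ∑ j, F (EuclideanSpace.single j 1) i * v j := by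
  conv_lhs => rw [← (EuclideanSpace.basisFun (Fin d) ℝ).sum_repr v]
  simp [Finset.sum_apply, mul_comm]

theorem clm_det_eq {d : ℕ} (F : Vec d →L[ℝ] Vec d) :
    F.det = (Matrix.of fun i j => F (EuclideanSpace.single j 1) i).det := by
  rw [ContinuousLinearMap.det, ← LinearMap.det_toMatrix (EuclideanSpace.basisFun (Fin d) ℝ).toBasis]
  congr 1

/-- The square matrix with columns `ν` and the images of the basis vectors under `B`. -/
def colMat {n : ℕ} (ν : Vec (n + 1)) (B : Vec n →L[ℝ] Vec (n + 1)) :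
    Matrix (Fin (n + 1)) (Fin (n + 1)) ℝ :=
  Matrix.of fun i j => (Fin.cons ν (fun j => B (EuclideanSpace.single j 1)) :
    Fin (n + 1) → Vec (n + 1)) j i

/-- With a unit column ν orthogonal to the range of B added, the Gram matrix becomes block diagonal
with blocks 1 and BᵀB, and the matrix becomes square, so that its determinant is multiplicative
under linear maps. -/
theorem det_gram_eq {n : ℕ} (B : Vec n →L[ℝ] Vec (n + 1)) {ν : Vec (n + 1)} (hν : ‖ν‖ = 1)
    (hB : ∀ z, inner ℝ (B z) ν = 0) :
    ((ContinuousLinearMap.adjoint B).comp B).det = (colMat ν B).det ^ 2 := by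
  have hent : ∀ j k, ((colMat ν B).transpose * colMat ν B) j k =
      inner ℝ ((Fin.cons ν (fun j => B (EuclideanSpace.single j 1)) :
        Fin (n + 1) → Vec (n + 1)) j) ((Fin.cons ν (fun j => B (EuclideanSpace.single j 1)) :
        Fin (n + 1) → Vec (n + 1)) k) := by
    intro j k
    simp [Matrix.mul_apply, colMat, PiLp.inner_apply, mul_comm]
  have h1 : (colMat ν B).det ^ 2 = ((colMat ν B).transpose * colMat ν B).det := by
    rw [Matrix.det_mul, Matrix.det_transpose, sq]
  rw [h1, Matrix.det_succ_row_zero, Fin.sum_univ_succ]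
  have h2 : ∀ k : Fin n, ((colMat ν B).transpose * colMat ν B) 0 k.succ = 0 := by
    intro k
    rw [hent]
    simp only [Fin.cons_zero, Fin.cons_succ]
    rw [real_inner_comm]; exact hB _
  have h3 : ((colMat ν B).transpose * colMat ν B) 0 0 = 1 := by
    rw [hent]
    simp only [Fin.cons_zero]
    rw [real_inner_self_eq_norm_sq, hν]; norm_num
  simp only [h2, h3, mul_zero, zero_mul, Finset.sum_const_zero, add_zero]
  rw [clm_det_eq]
  simp only [Fin.val_zero, pow_zero, one_mul]
  congr 1
  ext j k
  rw [Matrix.submatrix_apply, Fin.zero_succAbove, hent]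
  simp only [Fin.cons_succ, Matrix.of_apply, ContinuousLinearMap.comp_apply]
  rw [← ContinuousLinearMap.adjoint_inner_right, EuclideanSpace.inner_single_left]
  simp

theorem colMat_comp {n : ℕ} (F : Vec (n + 1) →L[ℝ] Vec (n + 1)) (v : Vec (n + 1))
    (B : Vec n →L[ℝ] Vec (n + 1)) :
    (colMat (F v) (F.comp B)).det = F.det * (colMat v B).det := by
  rw [clm_det_eq, ← Matrix.det_mul]
  congr 1
  ext i j
  rw [Matrix.mul_apply]
  refine Fin.cases ?_ (fun j => ?_) j
  · simp only [colMat, Matrix.of_apply, Fin.cons_zero]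
    rw [apply_eq_sum]
  · simp only [colMat, Matrix.of_apply, Fin.cons_succ, ContinuousLinearMap.comp_apply]
    rw [apply_eq_sum]

/-- As a function of v, the determinant with the edge vectors of the facet as remaining columns is
the inner product with their generalized cross product, which is plus or minus the area normal.
Squaring removes the sign, which depends on l. -/
theorem sq_det_refFacet {n : ℕ} (hn : n = 1 ∨ n = 2) (l : Fin (n + 2)) (v : Vec (n + 1)) :
    (colMat v (affLin fun i => refVertex (l.succAbove i))).det ^ 2 =
      inner ℝ v (areaNormal l) ^ 2 := by
  have key : ∀ j : Fin n, affLin (fun i => refVertex (l.succAbove i) : Fin (n + 1) → Vec (n + 1))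
      (EuclideanSpace.single j 1) =
        refVertex (l.succAbove j.succ) - refVertex (l.succAbove 0) := by
    intro j
    rw [affLin_apply, Finset.sum_eq_single j]
    · simp
    · intro b _ hb; simp [hb]
    · simp
  unfold colMat
  simp only [key]
  rcases hn with rfl | rfl
  · rw [Matrix.det_fin_two]
    fin_cases l <;>
      simp [PiLp.inner_apply, areaNormal, Fin.sum_univ_succ, refVertex, Fin.succAbove, Fin.cons,
        Fin.cases, Fin.induction, Fin.induction.go, Fin.lt_def]
  · rw [Matrix.det_fin_three]
    fin_cases l <;>
      simp [PiLp.inner_apply, areaNormal, Fin.sum_univ_succ, refVertex, Fin.succAbove, Fin.cons,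
        Fin.cases, Fin.induction, Fin.induction.go, Fin.lt_def] <;> ring

/-- The facet lies in a level set of `bary · l`, whose gradient is minus the area normal. -/
theorem inner_affLin_areaNormal {n : ℕ} (l : Fin (n + 2)) (z : Vec n) :
    inner ℝ (affLin (fun i => refVertex (l.succAbove i)) z) (areaNormal l) = 0 := by
  have h := bary_sub_bary l (refFacetMap l 0) (refFacetMap l z)
  have e : ∀ z : Vec n, refFacetMap l z = refVertex (l.succAbove 0) +
      affLin (fun i => refVertex (l.succAbove i)) z := fun z => sum_bary_smul _ z
  rw [bary_refFacetMap_same, bary_refFacetMap_same, e z, e 0] at h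
  simp only [map_zero, add_zero, add_sub_cancel_left] at h
  linarith

/-! ### Inverses, adjoints and cofactors of invertible operators -/

section Inverse

variable {d : ℕ} {F : Vec d →L[ℝ] Vec d}

theorem exists_equiv_of_det_ne_zero (hF : F.det ≠ 0) :
    ∃ e : Vec d ≃L[ℝ] Vec d, (e : Vec d →L[ℝ] Vec d) = F :=
  ⟨F.toContinuousLinearEquivOfDetNeZero hF, F.coe_toContinuousLinearEquivOfDetNeZero hF⟩

theorem inverse_apply_self (hF : F.det ≠ 0) (v : Vec d) : F.inverse (F v) = v := by
  obtain ⟨e, rfl⟩ := exists_equiv_of_det_ne_zero hF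
  simp

theorem self_apply_inverse (hF : F.det ≠ 0) (v : Vec d) : F (F.inverse v) = v := by
  obtain ⟨e, rfl⟩ := exists_equiv_of_det_ne_zero hF
  simp

theorem adjoint_inverse_ne_zero (hF : F.det ≠ 0) {v : Vec d} (hv : v ≠ 0) :
    ContinuousLinearMap.adjoint F.inverse v ≠ 0 := by
  intro h
  apply hv
  refine ext_inner_left ℝ fun w => ?_
  have h1 := ContinuousLinearMap.adjoint_inner_right F.inverse (F w) v
  rw [h, inner_zero_right, inverse_apply_self hF] at h1
  rw [← h1, inner_zero_right]

/-- Cramer's rule. It replaces the inverse Jacobian, rational in the reference variable, by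
cofactors, which are polynomials. -/
theorem det_smul_inverse_apply (hF : F.det ≠ 0) (v : Vec d) (i : Fin d) :
    F.det * F.inverse v i =
      ∑ j, (Matrix.of fun i j => F (EuclideanSpace.single j 1) i).adjugate i j * v j := by
  set A : Matrix (Fin d) (Fin d) ℝ := Matrix.of fun i j => F (EuclideanSpace.single j 1) i with hA
  have hdet : F.det = A.det := clm_det_eq F
  have h1 : ∀ j, v j = (A.mulVec fun k => F.inverse v k) j := by
    intro j
    conv_lhs => rw [← self_apply_inverse hF v, apply_eq_sum]
    rfl
  have h2 : (A.adjugate.mulVec (A.mulVec fun k => F.inverse v k)) i = A.det * F.inverse v i := by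
    rw [Matrix.mulVec_mulVec, Matrix.adjugate_mul]
    simp [Matrix.smul_mulVec]
  rw [hdet, ← h2]
  simp only [Matrix.mulVec, dotProduct] at h1 ⊢
  refine Finset.sum_congr rfl fun j _ => ?_
  rw [h1 j]

end Inverse

/-- The area element of a facet is the Jacobian determinant times the length of the transformed
area normal. -/
theorem sqrt_det_gram_facet {n : ℕ} (hn : n = 1 ∨ n = 2) {F : Vec (n + 1) →L[ℝ] Vec (n + 1)}
    (hF : 0 < F.det) (l : Fin (n + 2)) :
    Real.sqrt ((ContinuousLinearMap.adjoint
        (F.comp (affLin fun i => refVertex (l.succAbove i)))).comp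
        (F.comp (affLin fun i => refVertex (l.succAbove i)))).det =
      F.det * ‖ContinuousLinearMap.adjoint F.inverse (areaNormal l)‖ := by
  set a := ContinuousLinearMap.adjoint F.inverse (areaNormal l) with ha
  have ha0 : a ≠ 0 := adjoint_inverse_ne_zero hF.ne' (areaNormal_ne_zero l)
  have hν : ‖‖a‖⁻¹ • a‖ = 1 := by
    rw [norm_smul, norm_inv, norm_norm, inv_mul_cancel₀ (norm_ne_zero_iff.2 ha0)]
  have horth : ∀ z, inner ℝ (F.comp (affLin fun i => refVertex (l.succAbove i)) z)
      (‖a‖⁻¹ • a) = 0 := by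
    intro z
    rw [inner_smul_right, ha, ContinuousLinearMap.adjoint_inner_right,
      ContinuousLinearMap.comp_apply, inverse_apply_self hF.ne', inner_affLin_areaNormal, mul_zero]
  rw [det_gram_eq _ hν horth, Real.sqrt_eq_iff_mul_self_eq (by positivity) (by positivity), ← sq]
  -- Writing the unit normal as F applied to F⁻¹ν makes F a common factor of all columns. What is
  -- left is ⟨F⁻¹ν, N⟩ = ⟨ν, F⁻ᵀN⟩ = ‖a‖.
  conv_lhs => rw [← self_apply_inverse hF.ne' (‖a‖⁻¹ • a)]
  rw [colMat_comp, mul_pow, mul_pow, sq_det_refFacet hn, map_smul, inner_smul_left,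
    ← ContinuousLinearMap.adjoint_inner_right, ← ha, real_inner_self_eq_norm_sq]
  have := norm_ne_zero_iff.2 ha0
  simp only [conj_trivial]
  field_simp

end LinAlg

/-! ### Polynomial maps -/

section PolyMap

variable {d : ℕ}

/-- The polynomial map with given components. -/
def polyMap (P : Fin d → MvPolynomial (Fin d) ℝ) (y : Vec d) : Vec d :=
  WithLp.toLp 2 fun i => pev (P i) y

/-- The Jacobian matrix of a polynomial map, as a matrix of polynomials. -/
def jacPoly (P : Fin d → MvPolynomial (Fin d) ℝ) : Matrix (Fin d) (Fin d) (MvPolynomial (Fin d) ℝ) :=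
  Matrix.of fun i j => MvPolynomial.pderiv j (P i)

/-- The Jacobian matrix of a polynomial map at a point. -/
def jacMat (P : Fin d → MvPolynomial (Fin d) ℝ) (y : Vec d) : Matrix (Fin d) (Fin d) ℝ :=
  Matrix.of fun i j => pev (MvPolynomial.pderiv j (P i)) y

/-- The derivative of a polynomial map. -/
def polyJac (P : Fin d → MvPolynomial (Fin d) ℝ) (y : Vec d) : Vec d →L[ℝ] Vec d :=
  Matrix.toEuclideanCLM (𝕜 := ℝ) (jacMat P y)

theorem polyJac_apply (P : Fin d → MvPolynomial (Fin d) ℝ) (y v : Vec d) (i : Fin d) :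
    polyJac P y v i = ∑ j, jacMat P y i j * v j := by
  rw [polyJac, Matrix.ofLp_toEuclideanCLM]
  rfl

theorem polyJac_single (P : Fin d → MvPolynomial (Fin d) ℝ) (y : Vec d) (i j : Fin d) :
    polyJac P y (EuclideanSpace.single j 1) i = jacMat P y i j := by
  rw [polyJac_apply, Finset.sum_eq_single j]
  · simp
  · intro b _ hb; simp [hb]
  · simp

theorem hasStrictFDerivAt_polyMap (P : Fin d → MvPolynomial (Fin d) ℝ) (y : Vec d) :
    HasStrictFDerivAt (polyMap P) (polyJac P y) y := by
  rw [hasStrictFDerivAt_euclidean]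
  intro i
  have h : (PiLp.proj 2 (fun _ : Fin d => ℝ) i : Vec d →L[ℝ] ℝ).comp (polyJac P y) =
      pgrad (P i) y := by
    refine ContinuousLinearMap.ext fun v => ?_
    rw [pgrad_apply, ContinuousLinearMap.comp_apply, PiLp.proj_apply, polyJac_apply]
    rfl
  rw [h]
  exact hasStrictFDerivAt_pev (P i) y

theorem jacMat_eq_map (P : Fin d → MvPolynomial (Fin d) ℝ) (y : Vec d) :
    jacMat P y = (jacPoly P).map (MvPolynomial.eval fun i => y i) := rfl

theorem det_polyJac (P : Fin d → MvPolynomial (Fin d) ℝ) (y : Vec d) :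
    (polyJac P y).det = pev (jacPoly P).det y := by
  rw [clm_det_eq, pev, RingHom.map_det]
  congr 1
  ext i j
  rw [Matrix.of_apply, polyJac_single]
  rfl

theorem adjugate_jacMat (P : Fin d → MvPolynomial (Fin d) ℝ) (y : Vec d) (i j : Fin d) :
    (jacMat P y).adjugate i j = pev ((jacPoly P).adjugate i j) y := by
  rw [jacMat_eq_map, ← RingHom.mapMatrix_apply, ← RingHom.map_adjugate]
  rfl

theorem det_smul_inverse_polyJac {P : Fin d → MvPolynomial (Fin d) ℝ} {y : Vec d}
    (h : (polyJac P y).det ≠ 0) (v : Vec d) (i : Fin d) :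
    (polyJac P y).det * (polyJac P y).inverse v i =
      ∑ j, pev ((jacPoly P).adjugate i j) y * v j := by
  rw [det_smul_inverse_apply h]
  refine Finset.sum_congr rfl fun j _ => ?_
  rw [← adjugate_jacMat]
  congr 3
  ext i j
  exact polyJac_single P y i j

/-- The columns of the cofactor matrix of a Jacobian are divergence free. -/
theorem sum_pderiv_adjugate (hd : d = 2 ∨ d = 3) (P : Fin d → MvPolynomial (Fin d) ℝ) (j : Fin d) :
    ∑ i, MvPolynomial.pderiv i ((jacPoly P).adjugate i j) = 0 := by
  -- Written out, every second derivative occurs twice with opposite signs once the order of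
  -- differentiation is fixed.
  rcases hd with rfl | rfl
  · rw [Matrix.adjugate_fin_two]
    fin_cases j <;>
      simp [Fin.sum_univ_two, jacPoly, pderiv_pderiv_comm (1 : Fin 2) 0]
  · rw [Matrix.adjugate_fin_three]
    fin_cases j <;>
      simp [Fin.sum_univ_three, jacPoly, pderiv_pderiv_comm (1 : Fin 3) 0,
        pderiv_pderiv_comm (2 : Fin 3) 0, pderiv_pderiv_comm (2 : Fin 3) 1] <;> ring

/-- Jacobi's formula. -/
theorem hasDerivWithinAt_det (hd : d = 2 ∨ d = 3) {A : ℝ → Matrix (Fin d) (Fin d) ℝ}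
    {A' : Matrix (Fin d) (Fin d) ℝ} {S : Set ℝ} {t : ℝ}
    (hA : ∀ i j, HasDerivWithinAt (fun s => A s i j) (A' i j) S t) :
    HasDerivWithinAt (fun s => (A s).det) (∑ i, ∑ j, (A t).adjugate i j * A' j i) S t := by
  rcases hd with rfl | rfl
  · simp only [Matrix.det_fin_two, Matrix.adjugate_fin_two]
    refine HasDerivWithinAt.congr_deriv (((hA 0 0).mul (hA 1 1)).sub ((hA 0 1).mul (hA 1 0))) ?_
    simp [Fin.sum_univ_two]; ring
  · simp only [Matrix.det_fin_three, Matrix.adjugate_fin_three]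
    refine HasDerivWithinAt.congr_deriv ((((((((hA 0 0).mul (hA 1 1)).mul (hA 2 2)).sub
      (((hA 0 0).mul (hA 1 2)).mul (hA 2 1))).sub (((hA 0 1).mul (hA 1 0)).mul (hA 2 2))).add
      (((hA 0 1).mul (hA 1 2)).mul (hA 2 0))).add (((hA 0 2).mul (hA 1 0)).mul (hA 2 1))).sub
      (((hA 0 2).mul (hA 1 1)).mul (hA 2 0))) ?_
    simp [Fin.sum_univ_three]; ring

end PolyMap


/-! ### Piola transforms on the reference element -/

section Piola

variable {d : ℕ}

/-- Numerator of the Piola transform of `Q` under the polynomial map `P`. -/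
def piolaNum (P Q : Fin d → MvPolynomial (Fin d) ℝ) (i : Fin d) : MvPolynomial (Fin d) ℝ :=
  ∑ j, jacPoly P i j * Q j

/-- The Piola transform of `Q` under the polynomial map `P`, in the reference variable. -/
def piola (P Q : Fin d → MvPolynomial (Fin d) ℝ) (y : Vec d) : Vec d :=
  WithLp.toLp 2 fun i => pev (piolaNum P Q i) y / pev (jacPoly P).det y

theorem piola_eq (P Q : Fin d → MvPolynomial (Fin d) ℝ) (y : Vec d) :
    piola P Q y = (polyJac P y).det⁻¹ • polyJac P y (polyMap Q y) := by
  ext i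
  rw [PiLp.smul_apply, polyJac_apply, det_polyJac, smul_eq_mul, ← div_eq_inv_mul]
  simp [piola, piolaNum, jacMat, jacPoly, polyMap]

/-- This recovers Q from its Piola transform without division; both the divergence identity and the
time regularity of Q come from it. -/
theorem sum_adjugate_mul_piolaNum (P Q : Fin d → MvPolynomial (Fin d) ℝ) (b : Fin d) :
    ∑ i, (jacPoly P).adjugate b i * piolaNum P Q i = (jacPoly P).det * Q b := by
  have h : (jacPoly P).adjugate.mulVec ((jacPoly P).mulVec Q) b = (jacPoly P).det * Q b := by
    rw [Matrix.mulVec_mulVec, Matrix.adjugate_mul]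
    simp [Matrix.smul_mulVec]
  rw [← h]
  rfl

/-- The derivative of a quotient of polynomials. -/
def quoDeriv (p q : MvPolynomial (Fin d) ℝ) (y : Vec d) : Vec d →L[ℝ] ℝ :=
  (pev q y ^ 2)⁻¹ • (pev q y • pgrad p y - pev p y • pgrad q y)

theorem hasFDerivAt_quo {p q : MvPolynomial (Fin d) ℝ} {y : Vec d} (hq : pev q y ≠ 0) :
    HasFDerivAt (fun y => pev p y / pev q y) (quoDeriv p q y) y := by
  have h := (hasStrictFDerivAt_pev p y).hasFDerivAt.mul
    ((hasDerivAt_inv hq).comp_hasFDerivAt y (hasStrictFDerivAt_pev q y).hasFDerivAt)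
  refine HasFDerivAt.congr_fderiv (f := fun y => pev p y / pev q y) h ?_
  refine ContinuousLinearMap.ext fun v => ?_
  simp only [quoDeriv, Function.comp_apply, smul_apply, sub_apply, add_apply, smul_eq_mul]
  field_simp
  ring

theorem pgrad_single (p : MvPolynomial (Fin d) ℝ) (y : Vec d) (b : Fin d) :
    pgrad p y (EuclideanSpace.single b 1) = pev (MvPolynomial.pderiv b p) y := by
  rw [pgrad_apply, Finset.sum_eq_single b]
  · simp
  · intro c _ hc; simp [hc]
  · simp

theorem hasFDerivAt_piola {P : Fin d → MvPolynomial (Fin d) ℝ} (Q : Fin d → MvPolynomial (Fin d) ℝ)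
    {y : Vec d} (hP : pev (jacPoly P).det y ≠ 0) :
    HasFDerivAt (piola P Q) (fderiv ℝ (piola P Q) y) y := by
  refine DifferentiableAt.hasFDerivAt (differentiableAt_euclidean.2 fun i => ?_)
  exact (hasFDerivAt_quo (p := piolaNum P Q i) hP).differentiableAt

theorem fderiv_piola_apply {P : Fin d → MvPolynomial (Fin d) ℝ} (Q : Fin d → MvPolynomial (Fin d) ℝ)
    {y : Vec d} (hP : pev (jacPoly P).det y ≠ 0) (v : Vec d) (i : Fin d) :
    fderiv ℝ (piola P Q) y v i = quoDeriv (piolaNum P Q i) (jacPoly P).det y v := by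
  have h1 := (PiLp.proj 2 (fun _ : Fin d => ℝ) i : Vec d →L[ℝ] ℝ).hasFDerivAt.comp y
    (hasFDerivAt_piola Q hP)
  exact congrArg (fun L : Vec d →L[ℝ] ℝ => L v)
    (h1.unique (hasFDerivAt_quo (p := piolaNum P Q i) hP))

theorem continuousOn_fderiv_piola {P : Fin d → MvPolynomial (Fin d) ℝ}
    (Q : Fin d → MvPolynomial (Fin d) ℝ) {s : Set (Vec d)}
    (hP : ∀ y ∈ s, pev (jacPoly P).det y ≠ 0) (b i : Fin d) :
    ContinuousOn (fun y => fderiv ℝ (piola P Q) y (EuclideanSpace.single b 1) i) s := by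
  have h : ContinuousOn (fun y => (pev (jacPoly P).det y ^ 2)⁻¹ *
      (pev (jacPoly P).det y * pev (MvPolynomial.pderiv b (piolaNum P Q i)) y -
        pev (piolaNum P Q i) y * pev (MvPolynomial.pderiv b (jacPoly P).det) y)) s := by
    refine ContinuousOn.mul (ContinuousOn.inv₀ ?_ fun y hy => pow_ne_zero 2 (hP y hy)) ?_ <;>
      fun_prop
  refine h.congr fun y hy => ?_
  simp only [fderiv_piola_apply Q (hP y hy), quoDeriv, smul_apply, sub_apply,
    smul_eq_mul, pgrad_single]

theorem continuousOn_piola {P : Fin d → MvPolynomial (Fin d) ℝ}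
    (Q : Fin d → MvPolynomial (Fin d) ℝ) {s : Set (Vec d)}
    (hP : ∀ y ∈ s, pev (jacPoly P).det y ≠ 0) : ContinuousOn (piola P Q) s := fun y hy =>
  (hasFDerivAt_piola Q (hP y hy)).continuousAt.continuousWithinAt

/-- The Piola transform preserves the divergence up to the Jacobian determinant. -/
theorem sum_adjugate_mul_fderiv_piola (hd : d = 2 ∨ d = 3) {P : Fin d → MvPolynomial (Fin d) ℝ}
    (Q : Fin d → MvPolynomial (Fin d) ℝ) {y : Vec d} (hP : pev (jacPoly P).det y ≠ 0) :
    ∑ i, ∑ b, pev ((jacPoly P).adjugate b i) y *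
        fderiv ℝ (piola P Q) y (EuclideanSpace.single b 1) i =
      pev (∑ b, MvPolynomial.pderiv b (Q b)) y := by
  -- The divergence of adj(F) F Q = J Q: by the product rule derivatives fall on the cofactors as
  -- well, but those contributions vanish because the columns of the cofactor matrix are divergence
  -- free. The derivative of J on the right will cancel against that of the factor 1/J in the Piola
  -- transform.
  have h1 : ∑ b, ∑ i, (jacPoly P).adjugate b i * MvPolynomial.pderiv b (piolaNum P Q i) =
      ∑ b, MvPolynomial.pderiv b ((jacPoly P).det * Q b) := by
    have h2 : ∀ b, MvPolynomial.pderiv b ((jacPoly P).det * Q b) =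
        ∑ i, (MvPolynomial.pderiv b ((jacPoly P).adjugate b i) * piolaNum P Q i +
          (jacPoly P).adjugate b i * MvPolynomial.pderiv b (piolaNum P Q i)) := by
      intro b
      rw [← sum_adjugate_mul_piolaNum, map_sum]
      simp only [MvPolynomial.pderiv_mul]
    simp only [h2, Finset.sum_add_distrib]
    have h3 : ∑ b, ∑ i, MvPolynomial.pderiv b ((jacPoly P).adjugate b i) * piolaNum P Q i = 0 := by
      rw [Finset.sum_comm]
      simp only [← Finset.sum_mul, sum_pderiv_adjugate hd, zero_mul, Finset.sum_const_zero]
    rw [h3, zero_add]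
  have h1' := congrArg (fun p => pev p y) h1
  simp only [pev_sum, pev_mul, MvPolynomial.pderiv_mul, pev_add, Finset.sum_add_distrib] at h1'
  have h4 : ∀ b, ∑ i, pev ((jacPoly P).adjugate b i) y * pev (piolaNum P Q i) y =
      pev (jacPoly P).det y * pev (Q b) y := by
    intro b
    rw [← pev_mul, ← sum_adjugate_mul_piolaNum, pev_sum]
    simp only [pev_mul]
  simp only [fderiv_piola_apply Q hP, quoDeriv, smul_apply, sub_apply, smul_eq_mul, pgrad_single]
  rw [Finset.sum_comm]
  set J := pev (jacPoly P).det y with hJ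
  have h5 : ∀ b i, pev ((jacPoly P).adjugate b i) y * ((J ^ 2)⁻¹ *
      (J * pev (MvPolynomial.pderiv b (piolaNum P Q i)) y -
        pev (piolaNum P Q i) y * pev (MvPolynomial.pderiv b (jacPoly P).det) y)) =
      J⁻¹ * (pev ((jacPoly P).adjugate b i) y * pev (MvPolynomial.pderiv b (piolaNum P Q i)) y) -
      (J ^ 2)⁻¹ * (pev (MvPolynomial.pderiv b (jacPoly P).det) y *
        (pev ((jacPoly P).adjugate b i) y * pev (piolaNum P Q i) y)) := by
    intro b i; field_simp
  simp only [h5, Finset.sum_sub_distrib, ← Finset.mul_sum, h4, h1']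
  simp only [pev_sum]
  have h6 : ∑ b, pev (MvPolynomial.pderiv b (jacPoly P).det) y * (J * pev (Q b) y) =
      J * ∑ b, pev (MvPolynomial.pderiv b (jacPoly P).det) y * pev (Q b) y := by
    rw [Finset.mul_sum]; exact Finset.sum_congr rfl fun b _ => by ring
  rw [h6]
  field_simp
  ring

/-- The reference convective flux `Q - adj(F) R`. -/
def convFlux (P Q R : Fin d → MvPolynomial (Fin d) ℝ) (b : Fin d) : MvPolynomial (Fin d) ℝ :=
  Q b - ∑ j, (jacPoly P).adjugate b j * R j

/-- As cofactors are divergence free, only derivatives of R survive. For R the domain velocity, the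
subtracted term is J div ω. -/
theorem sum_pderiv_convFlux (hd : d = 2 ∨ d = 3) (P Q R : Fin d → MvPolynomial (Fin d) ℝ) :
    ∑ b, MvPolynomial.pderiv b (convFlux P Q R b) =
      ∑ b, MvPolynomial.pderiv b (Q b) -
        ∑ b, ∑ j, (jacPoly P).adjugate b j * MvPolynomial.pderiv b (R j) := by
  simp only [convFlux, map_sub, map_sum, MvPolynomial.pderiv_mul, Finset.sum_add_distrib,
    Finset.sum_sub_distrib]
  have h3 : ∑ b, ∑ i, MvPolynomial.pderiv b ((jacPoly P).adjugate b i) * R i = 0 := by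
    rw [Finset.sum_comm]
    simp only [← Finset.sum_mul, sum_pderiv_adjugate hd, zero_mul, Finset.sum_const_zero]
  rw [h3, zero_add]

/-- Reference form of the integration by parts of the convective term. -/
theorem integral_convection {n : ℕ} (hn : n = 1 ∨ n = 2)
    (P Q R : Fin (n + 1) → MvPolynomial (Fin (n + 1)) ℝ)
    (hP : ∀ y ∈ refSimplex (n + 1), pev (jacPoly P).det y ≠ 0)
    (hQ : ∀ y ∈ refSimplex (n + 1), pev (∑ b, MvPolynomial.pderiv b (Q b)) y = 0) :
    ∫ y in refSimplex (n + 1), (inner ℝ (piola P Q y)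
          (fderiv ℝ (piola P Q) y (polyMap (convFlux P Q R) y)) -
        1 / 2 * ‖piola P Q y‖ ^ 2 *
          pev (∑ b, ∑ j, (jacPoly P).adjugate b j * MvPolynomial.pderiv b (R j)) y) =
      ∑ l, ∫ z in refSimplex n, inner ℝ (polyMap (convFlux P Q R) (refFacetMap l z)) (areaNormal l) *
        (1 / 2 * ‖piola P Q (refFacetMap l z)‖ ^ 2) := by
  have hE : ∀ y ∈ refSimplex (n + 1), HasFDerivAt (fun y => 1 / 2 * ‖piola P Q y‖ ^ 2)
      ((1 / 2 : ℝ) • (2 • (innerSL ℝ (piola P Q y)).comp (fderiv ℝ (piola P Q) y))) y :=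
    fun y hy => ((hasFDerivAt_piola Q (hP y hy)).norm_sq).const_mul _
  have hX : ∀ b, ∀ y ∈ refSimplex (n + 1),
      HasFDerivAt (fun y => pev (convFlux P Q R b) y * (1 / 2 * ‖piola P Q y‖ ^ 2))
        (pev (convFlux P Q R b) y • ((1 / 2 : ℝ) •
          (2 • (innerSL ℝ (piola P Q y)).comp (fderiv ℝ (piola P Q) y))) +
          (1 / 2 * ‖piola P Q y‖ ^ 2) • pgrad (convFlux P Q R b) y) y := fun b y hy =>
    (hasStrictFDerivAt_pev _ y).hasFDerivAt.mul (hE y hy)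
  have hval : ∀ b y, (pev (convFlux P Q R b) y • ((1 / 2 : ℝ) •
          (2 • (innerSL ℝ (piola P Q y)).comp (fderiv ℝ (piola P Q) y))) +
          (1 / 2 * ‖piola P Q y‖ ^ 2) • pgrad (convFlux P Q R b) y :
          Vec (n + 1) →L[ℝ] ℝ) (EuclideanSpace.single b 1) =
      pev (convFlux P Q R b) y *
        inner ℝ (piola P Q y) (fderiv ℝ (piola P Q) y (EuclideanSpace.single b 1)) +
      (1 / 2 * ‖piola P Q y‖ ^ 2) * pev (MvPolynomial.pderiv b (convFlux P Q R b)) y := by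
    intro b y
    simp [pgrad_single]
  have hU := continuousOn_piola Q hP
  -- The divergence theorem for ½|U|² times the reference flux. Since div Q = 0, the flux has
  -- divergence -adj(F):∇R, which is the source of the half divergence term.
  have hdiv := integral_div_refSimplex (X := fun b y =>
      pev (convFlux P Q R b) y * (1 / 2 * ‖piola P Q y‖ ^ 2)) hX (fun b => by
    simp only [hval]
    have hDU : ContinuousOn (fun y => fderiv ℝ (piola P Q) y (EuclideanSpace.single b 1))
        (refSimplex (n + 1)) := by
      have := continuousOn_pi.2 fun i => continuousOn_fderiv_piola Q hP b i
      exact (PiLp.continuous_toLp 2 _).comp_continuousOn this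
    exact ((continuous_pev _).continuousOn.mul (hU.inner hDU)).add
      ((continuousOn_const.mul (hU.norm.pow 2)).mul (continuous_pev _).continuousOn))
  simp only [hval] at hdiv
  have hL : ∫ y in refSimplex (n + 1), (inner ℝ (piola P Q y)
          (fderiv ℝ (piola P Q) y (polyMap (convFlux P Q R) y)) -
        1 / 2 * ‖piola P Q y‖ ^ 2 *
          pev (∑ b, ∑ j, (jacPoly P).adjugate b j * MvPolynomial.pderiv b (R j)) y) =
      ∫ y in refSimplex (n + 1), ∑ b, (pev (convFlux P Q R b) y *
        inner ℝ (piola P Q y) (fderiv ℝ (piola P Q) y (EuclideanSpace.single b 1)) +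
      (1 / 2 * ‖piola P Q y‖ ^ 2) * pev (MvPolynomial.pderiv b (convFlux P Q R b)) y) := by
    refine setIntegral_congr_fun measurableSet_refSimplex fun y hy => ?_
    rw [Finset.sum_add_distrib, ← Finset.mul_sum, ← pev_sum, sum_pderiv_convFlux (by omega),
      pev_sub, hQ y hy, zero_sub, mul_neg, ← sub_eq_add_neg]
    congr 1
    conv_lhs => rw [← (EuclideanSpace.basisFun (Fin (n + 1)) ℝ).sum_repr (polyMap (convFlux P Q R) y)]
    rw [map_sum, inner_sum]
    refine Finset.sum_congr rfl fun b _ => ?_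
    rw [map_smul, inner_smul_right]
    simp [polyMap]
  rw [hL, hdiv]
  refine Finset.sum_congr rfl fun l _ => ?_
  refine setIntegral_congr_fun measurableSet_refSimplex fun z hz => ?_
  simp only [PiLp.inner_apply, polyMap, Finset.sum_mul]
  refine Finset.sum_congr rfl fun b _ => ?_
  simp; ring

end Piola


/-- A continuous injection of a compact set into a Hausdorff space is an embedding, so its inverse
is continuous on the image, including at boundary points. -/
theorem tendsto_invFunOn_image {E F : Type*} [TopologicalSpace E] [TopologicalSpace F] [T2Space F]
    [Nonempty E] {f : E → F} {s : Set E} (hs : IsCompact s) (hf : ContinuousOn f s)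
    (hi : InjOn f s) {x : E} (hx : x ∈ s) :
    Filter.Tendsto (Function.invFunOn f s) (nhdsWithin (f x) (f '' s)) (nhdsWithin x s) := by
  have := isCompact_iff_compactSpace.1 hs
  have hemb : Topology.IsClosedEmbedding (fun y : s => f y) :=
    Continuous.isClosedEmbedding (continuousOn_iff_continuous_domRestrict.1 hf)
      (injOn_iff_injective.1 hi)
  have h1 : nhdsWithin (f x) (f '' s) = Filter.map (fun y : s => f y) (nhds ⟨x, hx⟩) := by
    have := hemb.isEmbedding.map_nhds_eq ⟨x, hx⟩
    rw [this, image_eq_range]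
  rw [h1, nhdsWithin_eq_map_subtype_coe hx, Filter.tendsto_map'_iff]
  have h2 : Function.invFunOn f s ∘ (fun y : s => f y) = Subtype.val := by
    funext y
    exact hi.leftInvOn_invFunOn y.2
  rw [h2]
  exact Filter.tendsto_map

namespace ALEMap

variable {n m : ℕ} {M : Mesh n m} {T : ℝ} (A : ALEMap M T)

/-! ### Element maps as polynomial maps -/

theorem exists_elemPoly {t : ℝ} (ht : t ∈ Icc 0 T) (K : M.Elem) :
    ∃ P : Fin (n + 1) → MvPolynomial (Fin (n + 1)) ℝ, (∀ i, (P i).totalDegree ≤ m) ∧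
      ∀ y ∈ refSimplex (n + 1), A.elemMap t K y = polyMap P y := by
  choose P hdeg hP using A.poly t ht K
  refine ⟨P, hdeg, fun y hy => ?_⟩
  ext i
  exact hP i y hy

open Classical in
/-- Polynomials that represent the element map on the reference simplex. -/
def elemPoly (t : ℝ) (K : M.Elem) : Fin (n + 1) → MvPolynomial (Fin (n + 1)) ℝ :=
  if h : ∃ P : Fin (n + 1) → MvPolynomial (Fin (n + 1)) ℝ, (∀ i, (P i).totalDegree ≤ m) ∧
      ∀ y ∈ refSimplex (n + 1), A.elemMap t K y = polyMap P y then h.choose else 0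

theorem totalDegree_elemPoly_le (t : ℝ) (K : M.Elem) (i : Fin (n + 1)) :
    (A.elemPoly t K i).totalDegree ≤ m := by
  unfold elemPoly
  split_ifs with h
  · exact h.choose_spec.1 i
  · simp

theorem elemMap_eq {t : ℝ} (ht : t ∈ Icc 0 T) (K : M.Elem)
    {y : Vec (n + 1)} (hy : y ∈ refSimplex (n + 1)) :
    A.elemMap t K y = polyMap (A.elemPoly t K) y := by
  have h := A.exists_elemPoly ht K
  unfold elemPoly
  rw [dif_pos h]
  exact h.choose_spec.2 y hy

theorem hasFDerivWithinAt_elemMap {t : ℝ} (ht : t ∈ Icc 0 T) (K : M.Elem)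
    {y : Vec (n + 1)} (hy : y ∈ refSimplex (n + 1)) :
    HasFDerivWithinAt (A.elemMap t K) (polyJac (A.elemPoly t K) y) (refSimplex (n + 1)) y :=
  (hasStrictFDerivAt_polyMap _ y).hasFDerivAt.hasFDerivWithinAt.congr
    (fun _ hx => A.elemMap_eq ht K hx) (A.elemMap_eq ht K hy)

theorem jac_eq {t : ℝ} (ht : t ∈ Icc 0 T) (K : M.Elem)
    {y : Vec (n + 1)} (hy : y ∈ refSimplex (n + 1)) :
    A.jac t K y = polyJac (A.elemPoly t K) y :=
  (A.hasFDerivWithinAt_elemMap ht K hy).fderivWithin (uniqueDiffOn_refSimplex y hy)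

theorem det_jac_pos {t : ℝ} (ht : t ∈ Icc 0 T) (K : M.Elem)
    {y : Vec (n + 1)} (hy : y ∈ refSimplex (n + 1)) :
    0 < (polyJac (A.elemPoly t K) y).det := by
  rw [← A.jac_eq ht K hy]
  exact A.det_pos t ht K y hy

theorem pev_det_pos {t : ℝ} (ht : t ∈ Icc 0 T) (K : M.Elem)
    {y : Vec (n + 1)} (hy : y ∈ refSimplex (n + 1)) :
    0 < pev (jacPoly (A.elemPoly t K)).det y := by
  rw [← det_polyJac]
  exact A.det_jac_pos ht K hy

theorem map_mem_domain (K : M.Elem) {y : Vec (n + 1)} (hy : y ∈ refSimplex (n + 1)) :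
    M.map K y ∈ M.domain := mem_iUnion.2 ⟨K, y, hy, rfl⟩

theorem injOn_elemMap {t : ℝ} (ht : t ∈ Icc 0 T) (K : M.Elem)
    : InjOn (A.elemMap t K) (refSimplex (n + 1)) := fun _ hx _ hy h =>
  M.map_inj K hx hy (A.inj t ht (map_mem_domain K hx) (map_mem_domain K hy) h)

theorem elemInv_elemMap {t : ℝ} (ht : t ∈ Icc 0 T) (K : M.Elem)
    {y : Vec (n + 1)} (hy : y ∈ refSimplex (n + 1)) :
    A.elemInv t K (A.elemMap t K y) = y :=
  (A.injOn_elemMap ht K).leftInvOn_invFunOn hy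

theorem back_elemMap {t : ℝ} (ht : t ∈ Icc 0 T) (K : M.Elem)
    {y : Vec (n + 1)} (hy : y ∈ refSimplex (n + 1)) :
    A.back t (A.elemMap t K y) = M.map K y :=
  (A.inj t ht).leftInvOn_invFunOn (map_mem_domain K hy)

theorem continuousOn_elemMap {t : ℝ} (ht : t ∈ Icc 0 T) (K : M.Elem)
    : ContinuousOn (A.elemMap t K) (refSimplex (n + 1)) := fun _ hy =>
  (A.hasFDerivWithinAt_elemMap ht K hy).continuousWithinAt

theorem integral_elem {t : ℝ} (ht : t ∈ Icc 0 T) (K : M.Elem) (g : Vec (n + 1) → ℝ) :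
    ∫ x in A.elem t K, g x =
      ∫ y in refSimplex (n + 1), pev (jacPoly (A.elemPoly t K)).det y * g (A.elemMap t K y) := by
  rw [elem, integral_image_eq_integral_abs_det_fderiv_smul volume measurableSet_refSimplex
    (fun y hy => A.hasFDerivWithinAt_elemMap ht K hy) (A.injOn_elemMap ht K) g]
  refine setIntegral_congr_fun measurableSet_refSimplex fun y hy => ?_
  simp only [smul_eq_mul]
  rw [abs_of_pos (A.det_jac_pos ht K hy), det_polyJac]

/-! ### Derivatives in the physical variable -/

/-- The chain rule through the inverse element map. The derivative within the closed curved element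
is meaningful up to its boundary because an invertible derivative transports unique
differentiability from the simplex. -/
theorem fderivWithin_push {t : ℝ} (ht : t ∈ Icc 0 T) (K : M.Elem) {v V : Vec (n + 1) → Vec (n + 1)}
    {V' : Vec (n + 1) →L[ℝ] Vec (n + 1)} {y : Vec (n + 1)} (hy : y ∈ refSimplex (n + 1))
    (hv : ∀ y ∈ refSimplex (n + 1), v (A.elemMap t K y) = V y) (hV : HasFDerivAt V V' y) :
    fderivWithin ℝ v (A.elem t K) (A.elemMap t K y) =
      V'.comp (polyJac (A.elemPoly t K) y).inverse := by
  obtain ⟨e, he⟩ := exists_equiv_of_det_ne_zero (A.det_jac_pos ht K hy).ne'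
  have h1 := A.hasFDerivWithinAt_elemMap ht K hy
  rw [← he] at h1 ⊢
  have hinv : HasFDerivWithinAt (A.elemInv t K) (e.symm : Vec (n + 1) →L[ℝ] Vec (n + 1))
      (A.elem t K) (A.elemMap t K y) := by
    refine HasFDerivWithinAt.of_local_left_inverse (f := A.elemMap t K) (t := refSimplex (n + 1))
      ?_ ?_ ⟨y, hy, rfl⟩ ?_
    · rw [A.elemInv_elemMap ht K hy]
      exact tendsto_invFunOn_image isCompact_refSimplex (A.continuousOn_elemMap ht K)
        (A.injOn_elemMap ht K) hy
    · rwa [A.elemInv_elemMap ht K hy]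
    · filter_upwards [self_mem_nhdsWithin] with x hx
      exact Function.invFunOn_eq hx
  have huniq : UniqueDiffWithinAt ℝ (A.elem t K) (A.elemMap t K y) :=
    h1.uniqueDiffWithinAt_of_continuousLinearEquiv e (uniqueDiffOn_refSimplex y hy)
  have hV2 : HasFDerivAt V V' (A.elemInv t K (A.elemMap t K y)) := by
    rwa [A.elemInv_elemMap ht K hy]
  have h2 := hV2.comp_hasFDerivWithinAt _ hinv
  have h3 : HasFDerivWithinAt v (V'.comp (e.symm : Vec (n + 1) →L[ℝ] Vec (n + 1))) (A.elem t K)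
      (A.elemMap t K y) := by
    refine h2.congr ?_ ?_
    · rintro _ ⟨z, hz, rfl⟩
      rw [Function.comp_apply, A.elemInv_elemMap ht K hz, hv z hz]
    · rw [Function.comp_apply, A.elemInv_elemMap ht K hy, hv y hy]
  rw [h3.fderivWithin huniq, ContinuousLinearMap.inverse_equiv]

theorem grad_push {t : ℝ} (ht : t ∈ Icc 0 T) (K : M.Elem) {v V : Vec (n + 1) → Vec (n + 1)}
    {V' : Vec (n + 1) →L[ℝ] Vec (n + 1)} {y : Vec (n + 1)} (hy : y ∈ refSimplex (n + 1))
    (hv : ∀ y ∈ refSimplex (n + 1), v (A.elemMap t K y) = V y) (hV : HasFDerivAt V V' y)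
    (i j : Fin (n + 1)) :
    grad (A.elem t K) v (A.elemMap t K y) i j =
      V' ((polyJac (A.elemPoly t K) y).inverse (EuclideanSpace.single i 1)) j := by
  rw [grad, Matrix.of_apply, A.fderivWithin_push ht K hy hv hV]
  rfl

/-- The gradient in the physical variable, through the cofactors of the Jacobian. -/
theorem det_mul_grad_push {t : ℝ} (ht : t ∈ Icc 0 T) (K : M.Elem) {v V : Vec (n + 1) → Vec (n + 1)}
    {V' : Vec (n + 1) →L[ℝ] Vec (n + 1)} {y : Vec (n + 1)} (hy : y ∈ refSimplex (n + 1))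
    (hv : ∀ y ∈ refSimplex (n + 1), v (A.elemMap t K y) = V y) (hV : HasFDerivAt V V' y)
    (i j : Fin (n + 1)) :
    pev (jacPoly (A.elemPoly t K)).det y * grad (A.elem t K) v (A.elemMap t K y) i j =
      ∑ b, pev ((jacPoly (A.elemPoly t K)).adjugate b i) y *
        V' (EuclideanSpace.single b 1) j := by
  rw [A.grad_push ht K hy hv hV, apply_eq_sum V', Finset.mul_sum]
  refine Finset.sum_congr rfl fun b _ => ?_
  have h := det_smul_inverse_polyJac (A.det_jac_pos ht K hy).ne' (EuclideanSpace.single i 1) b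
  rw [Finset.sum_eq_single i (fun c _ hc => by simp [hc]) (by simp)] at h
  rw [det_polyJac] at h
  simp only [PiLp.single_apply, if_true, mul_one] at h
  rw [← h]; ring

theorem det_mul_divg_push {t : ℝ} (ht : t ∈ Icc 0 T) (K : M.Elem) {v V : Vec (n + 1) → Vec (n + 1)}
    {V' : Vec (n + 1) →L[ℝ] Vec (n + 1)} {y : Vec (n + 1)} (hy : y ∈ refSimplex (n + 1))
    (hv : ∀ y ∈ refSimplex (n + 1), v (A.elemMap t K y) = V y) (hV : HasFDerivAt V V' y) :
    pev (jacPoly (A.elemPoly t K)).det y * divg (A.elem t K) v (A.elemMap t K y) =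
      ∑ i, ∑ b, pev ((jacPoly (A.elemPoly t K)).adjugate b i) y *
        V' (EuclideanSpace.single b 1) i := by
  rw [divg, Matrix.trace, Finset.mul_sum]
  exact Finset.sum_congr rfl fun i _ => A.det_mul_grad_push ht K hy hv hV i i

/-- In the convention (∇v)ᵢⱼ = ∂ᵢvⱼ, the contraction (a ⊗ b):∇v is b·(a·∇)v, a directional
derivative along F⁻¹a in the reference variable. -/
theorem det_mul_frob_tens_grad {t : ℝ} (ht : t ∈ Icc 0 T) (K : M.Elem)
    {v V : Vec (n + 1) → Vec (n + 1)}
    {V' : Vec (n + 1) →L[ℝ] Vec (n + 1)} {y : Vec (n + 1)} (hy : y ∈ refSimplex (n + 1))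
    (hv : ∀ y ∈ refSimplex (n + 1), v (A.elemMap t K y) = V y) (hV : HasFDerivAt V V' y)
    (a b : Vec (n + 1)) :
    frob (tens a b) (grad (A.elem t K) v (A.elemMap t K y)) =
      inner ℝ b (V' ((polyJac (A.elemPoly t K) y).inverse a)) := by
  simp only [frob, tens, Matrix.of_apply, A.grad_push ht K hy hv hV, PiLp.inner_apply]
  rw [Finset.sum_comm]
  refine Finset.sum_congr rfl fun j _ => ?_
  have h := apply_eq_sum (V'.comp (polyJac (A.elemPoly t K) y).inverse) a j
  simp only [ContinuousLinearMap.comp_apply] at h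
  rw [h]
  simp only [RCLike.inner_apply, conj_trivial, Finset.sum_mul]
  exact Finset.sum_congr rfl fun i _ => by ring

/-! ### The domain velocity -/

/-- Pointwise differentiability of the ALE map is upgraded to differentiability of the element map
as a polynomial. The velocity is therefore polynomial in the reference variable, and taking Λ to be
a spatial derivative followed by evaluation lets ∂ₜ commute with it. -/
theorem exists_velPoly {t : ℝ} (ht : t ∈ Icc 0 T) (K : M.Elem)
    : ∃ R : Fin (n + 1) → MvPolynomial (Fin (n + 1)) ℝ,
    ∀ i, ∀ {E : Type} [NormedAddCommGroup E] [NormedSpace ℝ E]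
      (Λ : MvPolynomial (Fin (n + 1)) ℝ →ₗ[ℝ] E),
      HasDerivWithinAt (fun s => Λ (A.elemPoly s K i)) (Λ (R i)) (Icc 0 T) t := by
  have h : ∀ i, ∀ y ∈ refSimplex (n + 1),
      DifferentiableWithinAt ℝ (fun s => pev (A.elemPoly s K i) y) (Icc 0 T) t := by
    intro i y hy
    have h1 := differentiableWithinAt_euclidean.1 (A.diff t ht _ (map_mem_domain K hy)) i
    have h2 : ∀ s ∈ Icc 0 T, pev (A.elemPoly s K i) y = A.φ s (M.map K y) i := fun s hs =>
      congrArg (fun v : Vec (n + 1) => v i) (A.elemMap_eq hs K hy).symm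
    exact h1.congr h2 (h2 t ht)
  choose R hdeg hR using fun i =>
    exists_hasDerivWithinAt_poly (fun s => A.totalDegree_elemPoly_le s K i) (h i)
  exact ⟨R, fun i {E} _ _ Λ => hR i Λ⟩

/-- Polynomials that represent the domain velocity in the reference variable. -/
def velPoly {t : ℝ} (ht : t ∈ Icc 0 T) (K : M.Elem)
    : Fin (n + 1) → MvPolynomial (Fin (n + 1)) ℝ := (A.exists_velPoly ht K).choose

theorem hasDerivWithinAt_elemPoly {t : ℝ} (ht : t ∈ Icc 0 T) (K : M.Elem)
    (i : Fin (n + 1)) {E : Type} [NormedAddCommGroup E]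
    [NormedSpace ℝ E] (Λ : MvPolynomial (Fin (n + 1)) ℝ →ₗ[ℝ] E) :
    HasDerivWithinAt (fun s => Λ (A.elemPoly s K i)) (Λ (A.velPoly ht K i)) (Icc 0 T) t :=
  (A.exists_velPoly ht K).choose_spec i Λ

/-- Evaluation of polynomials at a point, as a linear map. -/
def pevLin (y : Vec (n + 1)) : MvPolynomial (Fin (n + 1)) ℝ →ₗ[ℝ] ℝ :=
  (MvPolynomial.aeval fun i => y i : MvPolynomial (Fin (n + 1)) ℝ →ₐ[ℝ] ℝ).toLinearMap

theorem pevLin_apply (y : Vec (n + 1)) (p : MvPolynomial (Fin (n + 1)) ℝ) :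
    pevLin y p = pev p y := by
  rw [pev, ← MvPolynomial.coe_aeval_eq_eval]; rfl

theorem vel_elemMap {t : ℝ} (ht : t ∈ Icc 0 T) (K : M.Elem)
    (hT : 0 < T) {y : Vec (n + 1)} (hy : y ∈ refSimplex (n + 1)) :
    A.vel t (A.elemMap t K y) = polyMap (A.velPoly ht K) y := by
  rw [vel, A.back_elemMap ht K hy]
  have h : HasDerivWithinAt (fun s => A.φ s (M.map K y)) (polyMap (A.velPoly ht K) y)
      (Icc 0 T) t := by
    rw [hasDerivWithinAt_iff_hasFDerivWithinAt, hasFDerivWithinAt_euclidean]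
    intro i
    have h1 := A.hasDerivWithinAt_elemPoly ht K i (pevLin y)
    simp only [pevLin_apply] at h1
    have h2 : ∀ s ∈ Icc 0 T, A.φ s (M.map K y) i = pev (A.elemPoly s K i) y := fun s hs =>
      congrArg (fun v : Vec (n + 1) => v i) (A.elemMap_eq hs K hy)
    have h3 := (h1.congr h2 (h2 t ht)).hasFDerivWithinAt
    refine h3.congr_fderiv ?_
    ext
    simp [polyMap]
  exact h.derivWithin (uniqueDiffOn_Icc hT t ht)

end ALEMap


/-! ### Curves of continuous functions on the reference simplex -/

instance compactSpace_refSimplex (d : ℕ) : CompactSpace (refSimplex d) :=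
  isCompact_iff_compactSpace.1 isCompact_refSimplex

/-- Lebesgue measure on the reference simplex. -/
def refMeasure (d : ℕ) : Measure (refSimplex d) := (volume : Measure (Vec d)).comap Subtype.val

instance isFiniteMeasure_refMeasure (d : ℕ) : IsFiniteMeasure (refMeasure d) :=
  ⟨by
    rw [refMeasure, comap_subtype_coe_apply measurableSet_refSimplex]
    simpa using isCompact_refSimplex.measure_lt_top⟩

/-- Polynomials as continuous functions on the reference simplex. -/
def pevC (d : ℕ) : MvPolynomial (Fin d) ℝ →ₐ[ℝ] C(refSimplex d, ℝ) :=
  MvPolynomial.aeval fun i => ⟨fun y => (y : Vec d) i, by fun_prop⟩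

theorem pevC_apply {d : ℕ} (p : MvPolynomial (Fin d) ℝ) (y : refSimplex d) :
    pevC d p y = pev p y := by
  have h : ((ContinuousMap.evalAlgHom ℝ ℝ y).comp (pevC d)) =
      (MvPolynomial.aeval fun i => (y : Vec d) i) := by
    apply MvPolynomial.algHom_ext
    intro i
    simp [pevC]
  rw [pev, ← MvPolynomial.coe_aeval_eq_eval]
  exact congrArg (fun f : MvPolynomial (Fin d) ℝ →ₐ[ℝ] ℝ => f p) h

/-- The integral over the reference simplex as a continuous linear functional. -/
def integralC (d : ℕ) : C(refSimplex d, ℝ) →L[ℝ] ℝ :=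
  LinearMap.mkContinuous
    { toFun := fun f => ∫ y, f y ∂(refMeasure d)
      map_add' := fun f g => integral_add
        (f.continuous.integrable_of_hasCompactSupport (HasCompactSupport.of_compactSpace _))
        (g.continuous.integrable_of_hasCompactSupport (HasCompactSupport.of_compactSpace _))
      map_smul' := fun c f => integral_const_mul c _ }
    ((refMeasure d).real univ)
    (fun f => by
      have h := norm_integral_le_of_norm_le_const (μ := refMeasure d)
        (f := fun y => f y) (C := ‖f‖) (Filter.Eventually.of_forall fun y => f.norm_coe_le_norm y)
      rw [mul_comm] at h
      exact h)

theorem integralC_apply {d : ℕ} (f : C(refSimplex d, ℝ)) {g : Vec d → ℝ}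
    (hfg : ∀ y : refSimplex d, f y = g y) :
    integralC d f = ∫ y in refSimplex d, g y := by
  rw [← integral_subtype_comap measurableSet_refSimplex]
  exact integral_congr_ae (Filter.Eventually.of_forall hfg)

/-- Differentiation under the integral sign for curves of continuous functions. -/
theorem hasDerivWithinAt_integral_refSimplex {d : ℕ} {S : Set ℝ} {t : ℝ} (ht : t ∈ S)
    (hS : UniqueDiffWithinAt ℝ S t) {h : ℝ → C(refSimplex d, ℝ)}
    (hh : DifferentiableWithinAt ℝ h S t) {g : ℝ → Vec d → ℝ} {g' : Vec d → ℝ}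
    (hg : ∀ s ∈ S, ∀ y : refSimplex d, h s y = g s y)
    (hg' : ∀ y ∈ refSimplex d, HasDerivWithinAt (fun s => g s y) (g' y) S t) :
    IntegrableOn g' (refSimplex d) ∧
      HasDerivWithinAt (fun s => ∫ y in refSimplex d, g s y) (∫ y in refSimplex d, g' y) S t := by
  have h1 := (integralC d).hasFDerivAt.comp_hasDerivWithinAt t hh.hasDerivWithinAt
  -- Evaluations are continuous functionals, so the derivative of the curve in C(K̂) is the
  -- pointwise one. In particular `g'` is continuous, whence integrable.
  have hd : ∀ y : refSimplex d, derivWithin h S t y = g' y := by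
    intro y
    have h3 := (ContinuousMap.evalCLM ℝ y).hasFDerivAt.comp_hasDerivWithinAt t hh.hasDerivWithinAt
    have h4 : HasDerivWithinAt (fun s => h s y) (g' y) S t :=
      (hg' y y.2).congr (fun s hs => hg s hs y) (hg t ht y)
    exact hS.eq_deriv _ h3 h4
  rw [integralC_apply _ hd] at h1
  refine ⟨ContinuousOn.integrableOn_compact isCompact_refSimplex ?_, ?_⟩
  · rw [continuousOn_iff_continuous_domRestrict]
    exact (derivWithin h S t).continuous.congr hd
  exact h1.congr (fun s hs => (integralC_apply _ (hg s hs)).symm) (integralC_apply _ (hg t ht)).symm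

/-- The entries lie in a general normed algebra because the lemma is applied to C(K̂) as well as to
ℝ. -/
theorem differentiableWithinAt_det {𝔸 : Type*} [NormedCommRing 𝔸] [NormedAlgebra ℝ 𝔸] {d : ℕ}
    {B : ℝ → Matrix (Fin d) (Fin d) 𝔸} {S : Set ℝ} {t : ℝ}
    (hB : ∀ i j, DifferentiableWithinAt ℝ (fun s => B s i j) S t) :
    DifferentiableWithinAt ℝ (fun s => (B s).det) S t := by
  simp only [Matrix.det_apply']
  exact DifferentiableWithinAt.fun_sum fun σ _ =>
    (DifferentiableWithinAt.fun_finsetProd fun i _ => hB _ _).const_mul _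

theorem differentiableWithinAt_adjugate {d : ℕ}
    {B : ℝ → Matrix (Fin d) (Fin d) ℝ} {S : Set ℝ} {t : ℝ}
    (hB : ∀ i j, DifferentiableWithinAt ℝ (fun s => B s i j) S t) (i j : Fin d) :
    DifferentiableWithinAt ℝ (fun s => (B s).adjugate i j) S t := by
  simp only [Matrix.adjugate_apply]
  refine differentiableWithinAt_det fun a b => ?_
  by_cases h : a = j
  · subst h; simp [differentiableWithinAt_const]
  · simpa [Matrix.updateRow_ne h] using hB a b

namespace ALEMap

variable {n m : ℕ} {M : Mesh n m} {T : ℝ} (A : ALEMap M T)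

/-! ### Fields of the Piola space as curves of polynomials -/

variable {k : ℕ} {u : ℝ → M.Elem → Vec (n + 1) → Vec (n + 1)}

theorem exists_piolaPoly {t : ℝ} (ht : t ∈ Icc 0 T) {v : M.Elem → Vec (n + 1) → Vec (n + 1)}
    (hv : v ∈ A.Vh k t) (K : M.Elem) :
    ∃ Q : Fin (n + 1) → MvPolynomial (Fin (n + 1)) ℝ, (∀ i, (Q i).totalDegree ≤ k) ∧
      ∀ y ∈ refSimplex (n + 1), v K (A.elemMap t K y) = piola (A.elemPoly t K) Q y := by
  obtain ⟨vh, hpoly, hvh⟩ := hv K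
  choose Q hdeg hQ using hpoly
  refine ⟨Q, hdeg, fun y hy => ?_⟩
  have h : vh y = polyMap Q y := by ext i; exact hQ i y hy
  rw [hvh y hy, piola_eq, h, A.jac_eq ht K hy]

open Classical in
/-- Polynomials whose Piola transform represents a field on an element. -/
def piolaPoly (k : ℕ) (v : M.Elem → Vec (n + 1) → Vec (n + 1)) (t : ℝ) (K : M.Elem) :
    Fin (n + 1) → MvPolynomial (Fin (n + 1)) ℝ :=
  if h : ∃ Q : Fin (n + 1) → MvPolynomial (Fin (n + 1)) ℝ, (∀ i, (Q i).totalDegree ≤ k) ∧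
      ∀ y ∈ refSimplex (n + 1), v K (A.elemMap t K y) = piola (A.elemPoly t K) Q y
  then h.choose else 0

theorem totalDegree_piolaPoly_le (v : M.Elem → Vec (n + 1) → Vec (n + 1)) (t : ℝ) (K : M.Elem)
    (i : Fin (n + 1)) : (A.piolaPoly k v t K i).totalDegree ≤ k := by
  unfold piolaPoly
  split_ifs with h
  · exact h.choose_spec.1 i
  · simp

theorem eq_piola {t : ℝ} (ht : t ∈ Icc 0 T) {v : M.Elem → Vec (n + 1) → Vec (n + 1)}
    (hv : v ∈ A.Vh k t) (K : M.Elem) {y : Vec (n + 1)} (hy : y ∈ refSimplex (n + 1)) :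
    v K (A.elemMap t K y) = piola (A.elemPoly t K) (A.piolaPoly k v t K) y := by
  have h := A.exists_piolaPoly ht hv K
  unfold piolaPoly
  rw [dif_pos h]
  exact h.choose_spec.2 y hy

theorem differentiableWithinAt_pevC_jacPoly {t : ℝ} (ht : t ∈ Icc 0 T) (K : M.Elem)
    (i j : Fin (n + 1)) :
    DifferentiableWithinAt ℝ (fun s => pevC (n + 1) (jacPoly (A.elemPoly s K) i j)) (Icc 0 T) t :=
  (A.hasDerivWithinAt_elemPoly ht K i ((pevC (n + 1)).toLinearMap ∘ₗ
    (MvPolynomial.pderiv j : Derivation ℝ _ _).toLinearMap)).differentiableWithinAt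

theorem hasDerivWithinAt_jacMat {t : ℝ} (ht : t ∈ Icc 0 T) (K : M.Elem) (y : Vec (n + 1))
    (i j : Fin (n + 1)) :
    HasDerivWithinAt (fun s => jacMat (A.elemPoly s K) y i j)
      (pev (MvPolynomial.pderiv j (A.velPoly ht K i)) y) (Icc 0 T) t := by
  have h := A.hasDerivWithinAt_elemPoly ht K i (pevLin y ∘ₗ
    (MvPolynomial.pderiv j : Derivation ℝ _ _).toLinearMap)
  simp only [LinearMap.comp_apply, pevLin_apply] at h
  exact h

/-- The polynomial vector is Q = adj(F) (u ∘ Φ), a product of quantities already known to be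
differentiable in time at each reference point. -/
theorem differentiableWithinAt_piolaPoly {t : ℝ} (ht : t ∈ Icc 0 T)
    (hu : ∀ t ∈ Icc 0 T, u t ∈ A.Vh k t) (K : M.Elem)
    (hdiff : ∀ y ∈ refSimplex (n + 1),
      DifferentiableWithinAt ℝ (fun s => u s K (A.elemMap s K y)) (Icc 0 T) t)
    (i : Fin (n + 1)) {y : Vec (n + 1)} (hy : y ∈ refSimplex (n + 1)) :
    DifferentiableWithinAt ℝ (fun s => pev (A.piolaPoly k (u s) s K i) y) (Icc 0 T) t := by
  have h1 : ∀ s ∈ Icc 0 T, pev (A.piolaPoly k (u s) s K i) y =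
      ∑ j, (jacMat (A.elemPoly s K) y).adjugate i j * u s K (A.elemMap s K y) j := by
    intro s hs
    have hJ := (A.pev_det_pos hs K hy).ne'
    have h2 := congrArg (fun p => pev p y)
      (sum_adjugate_mul_piolaNum (A.elemPoly s K) (A.piolaPoly k (u s) s K) i)
    simp only [pev_sum, pev_mul] at h2
    simp only [A.eq_piola hs (hu s hs) K hy, adjugate_jacMat, piola]
    simp only [← mul_div_assoc, ← Finset.sum_div]
    rw [h2]
    field_simp
  refine DifferentiableWithinAt.congr ?_ h1 (h1 t ht)
  refine DifferentiableWithinAt.fun_sum fun j _ => DifferentiableWithinAt.fun_mul ?_ ?_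
  · exact differentiableWithinAt_adjugate
      (fun a b => (A.hasDerivWithinAt_jacMat ht K y a b).differentiableWithinAt) i j
  · exact differentiableWithinAt_euclidean.1 (hdiff y hy) j

/-- Bounded degree turns differentiability at each point into differentiability in the uniform norm.
-/
theorem differentiableWithinAt_pevC_piolaPoly {t : ℝ} (ht : t ∈ Icc 0 T)
    (hu : ∀ t ∈ Icc 0 T, u t ∈ A.Vh k t) (K : M.Elem)
    (hdiff : ∀ y ∈ refSimplex (n + 1),
      DifferentiableWithinAt ℝ (fun s => u s K (A.elemMap s K y)) (Icc 0 T) t)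
    (i : Fin (n + 1)) :
    DifferentiableWithinAt ℝ (fun s => pevC (n + 1) (A.piolaPoly k (u s) s K i)) (Icc 0 T) t := by
  obtain ⟨Q', -, hQ'⟩ := exists_hasDerivWithinAt_poly
    (fun s => A.totalDegree_piolaPoly_le (k := k) (u s) s K i)
    (fun y hy => A.differentiableWithinAt_piolaPoly ht hu K hdiff i hy)
  exact (hQ' (pevC (n + 1)).toLinearMap).differentiableWithinAt

/-- The reference form of the domain divergence times the Jacobian determinant. -/
def velDiv {t : ℝ} (ht : t ∈ Icc 0 T) (K : M.Elem) : MvPolynomial (Fin (n + 1)) ℝ :=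
  ∑ b, ∑ j, (jacPoly (A.elemPoly t K)).adjugate b j *
    MvPolynomial.pderiv b (A.velPoly ht K j)

/-- Jacobi's formula, with the time derivative of F replaced by the gradient of the velocity
polynomial; the result is J div ω. -/
theorem hasDerivWithinAt_det_elem (hn : n = 1 ∨ n = 2) {t : ℝ} (ht : t ∈ Icc 0 T) (K : M.Elem)
    (y : Vec (n + 1)) :
    HasDerivWithinAt (fun s => pev (jacPoly (A.elemPoly s K)).det y)
      (pev (A.velDiv ht K) y) (Icc 0 T) t := by
  have h := hasDerivWithinAt_det (by omega) (A.hasDerivWithinAt_jacMat ht K y)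
  have h1 : ∀ s, (Matrix.det fun i j => jacMat (A.elemPoly s K) y i j) =
      pev (jacPoly (A.elemPoly s K)).det y := by
    intro s
    rw [pev, RingHom.map_det]; rfl
  have h2 : ∀ s, (jacMat (A.elemPoly s K) y).det = pev (jacPoly (A.elemPoly s K)).det y := h1
  simp only [h2, adjugate_jacMat] at h
  simp only [velDiv, pev_sum, pev_mul]
  exact h

/-- Reynolds' transport theorem on an element. -/
theorem hasDerivWithinAt_integral_elem (hn : n = 1 ∨ n = 2) (hT : 0 < T) {t : ℝ}
    (ht : t ∈ Icc 0 T) (hu : ∀ t ∈ Icc 0 T, u t ∈ A.Vh k t) (K : M.Elem)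
    (hdiff : ∀ y ∈ refSimplex (n + 1),
      DifferentiableWithinAt ℝ (fun s => u s K (A.elemMap s K y)) (Icc 0 T) t) :
    IntegrableOn (fun y => pev (A.velDiv ht K) y * ‖u t K (A.elemMap t K y)‖ ^ 2 +
        pev (jacPoly (A.elemPoly t K)).det y * (2 * inner ℝ (u t K (A.elemMap t K y))
          (derivWithin (fun s => u s K (A.elemMap s K y)) (Icc 0 T) t))) (refSimplex (n + 1)) ∧
    HasDerivWithinAt (fun s => ∫ x in A.elem s K, ‖u s K x‖ ^ 2)
      (∫ y in refSimplex (n + 1), (pev (A.velDiv ht K) y * ‖u t K (A.elemMap t K y)‖ ^ 2 +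
        pev (jacPoly (A.elemPoly t K)).det y * (2 * inner ℝ (u t K (A.elemMap t K y))
          (derivWithin (fun s => u s K (A.elemMap s K y)) (Icc 0 T) t)))) (Icc 0 T) t := by
  have hS := uniqueDiffOn_Icc hT t ht
  -- The integrand J|u|² is J⁻¹|FQ|², a curve in the Banach algebra C(K̂). There J is a unit because
  -- it vanishes nowhere on the simplex, and inversion is differentiable at units.
  have key := hasDerivWithinAt_integral_refSimplex (d := n + 1) ht hS
    (h := fun s => Ring.inverse (pevC (n + 1) (jacPoly (A.elemPoly s K)).det) *
      ∑ i, pevC (n + 1) (piolaNum (A.elemPoly s K) (A.piolaPoly k (u s) s K) i) ^ 2) ?_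
    (g := fun s y => pev (jacPoly (A.elemPoly s K)).det y * ‖u s K (A.elemMap s K y)‖ ^ 2)
    (g' := fun y => pev (A.velDiv ht K) y * ‖u t K (A.elemMap t K y)‖ ^ 2 +
        pev (jacPoly (A.elemPoly t K)).det y * (2 * inner ℝ (u t K (A.elemMap t K y))
          (derivWithin (fun s => u s K (A.elemMap s K y)) (Icc 0 T) t))) ?_ ?_
  · exact ⟨key.1, key.2.congr (fun s hs => A.integral_elem hs K _) (A.integral_elem ht K _)⟩
  · refine DifferentiableWithinAt.fun_mul ?_ ?_
    · refine DifferentiableWithinAt.inverse ?_ ?_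
      · have h1 : ∀ s, pevC (n + 1) (jacPoly (A.elemPoly s K)).det =
            ((jacPoly (A.elemPoly s K)).map (pevC (n + 1))).det := fun s => AlgHom.map_det _ _
        simp only [h1]
        exact differentiableWithinAt_det fun i j =>
          A.differentiableWithinAt_pevC_jacPoly ht K i j
      · rw [ContinuousMap.isUnit_iff_forall_ne_zero]
        intro y
        rw [pevC_apply]
        exact (A.pev_det_pos ht K y.2).ne'
    · refine DifferentiableWithinAt.fun_sum fun i _ => DifferentiableWithinAt.fun_pow ?_ 2
      simp only [piolaNum, map_sum, map_mul]
      exact DifferentiableWithinAt.fun_sum fun j _ =>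
        (A.differentiableWithinAt_pevC_jacPoly ht K i j).fun_mul
          (A.differentiableWithinAt_pevC_piolaPoly ht hu K hdiff j)
  · intro s hs y
    have hJ := (A.pev_det_pos hs K y.2).ne'
    have hunit : IsUnit (pevC (n + 1) (jacPoly (A.elemPoly s K)).det) := by
      rw [ContinuousMap.isUnit_iff_forall_ne_zero]
      intro y
      rw [pevC_apply]
      exact (A.pev_det_pos hs K y.2).ne'
    have hinv : Ring.inverse (pevC (n + 1) (jacPoly (A.elemPoly s K)).det) y =
        (pev (jacPoly (A.elemPoly s K)).det y)⁻¹ := by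
      have h1 := congrArg (fun f : C(refSimplex (n + 1), ℝ) => f y)
        (Ring.inverse_mul_cancel _ hunit)
      simp only [ContinuousMap.mul_apply, pevC_apply, ContinuousMap.one_apply] at h1
      exact eq_inv_of_mul_eq_one_left h1
    rw [A.eq_piola hs (hu s hs) K y.2, EuclideanSpace.norm_sq_eq]
    simp only [ContinuousMap.mul_apply, hinv, ContinuousMap.sum_apply, ContinuousMap.pow_apply,
      pevC_apply, piola, Real.norm_eq_abs, sq_abs, div_pow, ← Finset.sum_div]
    field_simp
  · intro y hy
    exact (A.hasDerivWithinAt_det_elem hn ht K y).fun_mul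
      (hdiff y hy).hasDerivWithinAt.norm_sq

end ALEMap


theorem det_smul_inverse_piola {d : ℕ} {P : Fin d → MvPolynomial (Fin d) ℝ}
    (Q : Fin d → MvPolynomial (Fin d) ℝ) {y : Vec d} (h : (polyJac P y).det ≠ 0) :
    (polyJac P y).det • (polyJac P y).inverse (piola P Q y) = polyMap Q y := by
  rw [piola_eq, map_smul, inverse_apply_self h, smul_smul, mul_inv_cancel₀ h, one_smul]

/-- The reference flux is J F⁻¹(u - ω), the relative velocity pulled back by the inverse Piola map.
-/
theorem det_smul_inverse_convFlux {d : ℕ} {P : Fin d → MvPolynomial (Fin d) ℝ}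
    (Q R : Fin d → MvPolynomial (Fin d) ℝ) {y : Vec d} (h : (polyJac P y).det ≠ 0) :
    (polyJac P y).det • (polyJac P y).inverse (piola P Q y - polyMap R y) =
      polyMap (convFlux P Q R) y := by
  rw [map_sub, smul_sub, det_smul_inverse_piola Q h]
  ext i
  rw [PiLp.sub_apply, PiLp.smul_apply, smul_eq_mul, det_smul_inverse_polyJac h]
  simp [polyMap, convFlux]

theorem continuous_polyMap {d : ℕ} (P : Fin d → MvPolynomial (Fin d) ℝ) :
    Continuous (polyMap P) :=
  (PiLp.continuous_toLp 2 _).comp (continuous_pi fun i => continuous_pev (P i))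

namespace ALEMap

variable {n m : ℕ} {M : Mesh n m} {T : ℝ} (A : ALEMap M T)

/-! ### Facets -/

/-- The transformed area normal `F⁻ᵀ N`. -/
def conormal (t : ℝ) (K : M.Elem) (l : Fin (n + 2)) (y : Vec (n + 1)) : Vec (n + 1) :=
  ContinuousLinearMap.adjoint (polyJac (A.elemPoly t K) y).inverse (areaNormal l)

theorem conormal_ne_zero {t : ℝ} (ht : t ∈ Icc 0 T) (K : M.Elem) (l : Fin (n + 2))
    {y : Vec (n + 1)} (hy : y ∈ refSimplex (n + 1)) : A.conormal t K l y ≠ 0 :=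
  adjoint_inverse_ne_zero (A.det_jac_pos ht K hy).ne' (areaNormal_ne_zero l)

theorem normal_elemMap {t : ℝ} (ht : t ∈ Icc 0 T) (K : M.Elem) (l : Fin (n + 2))
    {y : Vec (n + 1)} (hy : y ∈ refSimplex (n + 1)) :
    A.normal t K l (A.elemMap t K y) = ‖A.conormal t K l y‖⁻¹ • A.conormal t K l y := by
  obtain ⟨c, hc, hcN⟩ := refNormal_eq_smul l
  rw [normal, A.elemInv_elemMap ht K hy, A.jac_eq ht K hy, hcN, map_smul]
  change ‖c • A.conormal t K l y‖⁻¹ • c • A.conormal t K l y = _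
  rw [norm_smul, Real.norm_of_nonneg hc.le, smul_smul, mul_inv]
  congr 1
  field_simp

theorem norm_normal {t : ℝ} (ht : t ∈ Icc 0 T) (K : M.Elem) (l : Fin (n + 2))
    {y : Vec (n + 1)} (hy : y ∈ refSimplex (n + 1)) :
    ‖A.normal t K l (A.elemMap t K y)‖ = 1 := by
  rw [A.normal_elemMap ht K l hy, norm_smul, norm_inv, norm_norm,
    inv_mul_cancel₀ (norm_ne_zero_iff.2 (A.conormal_ne_zero ht K l hy))]

theorem hasFDerivWithinAt_facetMap {t : ℝ} (ht : t ∈ Icc 0 T) (K : M.Elem) (l : Fin (n + 2))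
    {z : Vec n} (hz : z ∈ refSimplex n) :
    HasFDerivWithinAt (A.facetMap t K l) ((polyJac (A.elemPoly t K) (refFacetMap l z)).comp
      (affLin fun i => refVertex (l.succAbove i))) (refSimplex n) z :=
  (A.hasFDerivWithinAt_elemMap ht K (refFacetMap_mem hz)).comp z
    (hasFDerivAt_refFacetMap l z).hasFDerivWithinAt fun _ hz => refFacetMap_mem hz

theorem facetJac_eq {t : ℝ} (ht : t ∈ Icc 0 T) (K : M.Elem) (l : Fin (n + 2))
    {z : Vec n} (hz : z ∈ refSimplex n) :
    A.facetJac t K l z = (polyJac (A.elemPoly t K) (refFacetMap l z)).comp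
      (affLin fun i => refVertex (l.succAbove i)) :=
  (A.hasFDerivWithinAt_facetMap ht K l hz).fderivWithin (uniqueDiffOn_refSimplex z hz)

theorem facetDet_eq (hn : n = 1 ∨ n = 2) {t : ℝ} (ht : t ∈ Icc 0 T) (K : M.Elem) (l : Fin (n + 2))
    {z : Vec n} (hz : z ∈ refSimplex n) :
    A.facetDet t K l z = (polyJac (A.elemPoly t K) (refFacetMap l z)).det *
      ‖A.conormal t K l (refFacetMap l z)‖ := by
  rw [facetDet, A.facetJac_eq ht K l hz,
    sqrt_det_gram_facet hn (A.det_jac_pos ht K (refFacetMap_mem hz)) l]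
  rfl

theorem facetDet_pos (hn : n = 1 ∨ n = 2) {t : ℝ} (ht : t ∈ Icc 0 T) (K : M.Elem) (l : Fin (n + 2))
    {z : Vec n} (hz : z ∈ refSimplex n) : 0 < A.facetDet t K l z := by
  rw [A.facetDet_eq hn ht K l hz]
  exact mul_pos (A.det_jac_pos ht K (refFacetMap_mem hz))
    (norm_pos_iff.2 (A.conormal_ne_zero ht K l (refFacetMap_mem hz)))

/-- Nanson's formula. The length of F⁻ᵀN cancels between the unit normal and the area element, so
normal fluxes contain no square roots. -/
theorem inner_normal_mul_facetDet (hn : n = 1 ∨ n = 2) {t : ℝ} (ht : t ∈ Icc 0 T) (K : M.Elem)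
    (l : Fin (n + 2)) {z : Vec n} (hz : z ∈ refSimplex n) (v : Vec (n + 1)) :
    inner ℝ v (A.normal t K l (A.facetMap t K l z)) * A.facetDet t K l z =
      inner ℝ ((polyJac (A.elemPoly t K) (refFacetMap l z)).det •
        (polyJac (A.elemPoly t K) (refFacetMap l z)).inverse v) (areaNormal l) := by
  have hy := refFacetMap_mem (l := l) hz
  have h0 := norm_ne_zero_iff.2 (A.conormal_ne_zero ht K l hy)
  rw [A.facetDet_eq hn ht K l hz, facetMap, A.normal_elemMap ht K l hy, inner_smul_right,
    inner_smul_left, ← ContinuousLinearMap.adjoint_inner_right]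
  change _ = _ * inner ℝ v (A.conormal t K l (refFacetMap l z))
  simp only [conj_trivial]
  field_simp

variable {k : ℕ} {u : ℝ → M.Elem → Vec (n + 1) → Vec (n + 1)}

theorem inner_normal_mul_facetDet_piola (hn : n = 1 ∨ n = 2) {t : ℝ} (ht : t ∈ Icc 0 T)
    {v : M.Elem → Vec (n + 1) → Vec (n + 1)} (hv : v ∈ A.Vh k t) (K : M.Elem)
    (l : Fin (n + 2)) {z : Vec n} (hz : z ∈ refSimplex n) :
    inner ℝ (v K (A.facetMap t K l z)) (A.normal t K l (A.facetMap t K l z)) *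
        A.facetDet t K l z =
      inner ℝ (polyMap (A.piolaPoly k v t K) (refFacetMap l z)) (areaNormal l) := by
  rw [A.inner_normal_mul_facetDet hn ht K l hz, facetMap,
    A.eq_piola ht hv K (refFacetMap_mem hz),
    det_smul_inverse_piola _ (A.det_jac_pos ht K (refFacetMap_mem hz)).ne']

theorem relVel_mul_facetDet (hn : n = 1 ∨ n = 2) (hT : 0 < T) {t : ℝ} (ht : t ∈ Icc 0 T)
    {v : M.Elem → Vec (n + 1) → Vec (n + 1)} (hv : v ∈ A.Vh k t) (K : M.Elem)
    (l : Fin (n + 2)) {z : Vec n} (hz : z ∈ refSimplex n) :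
    A.relVel t v K l (A.facetMap t K l z) * A.facetDet t K l z =
      inner ℝ (polyMap (convFlux (A.elemPoly t K) (A.piolaPoly k v t K) (A.velPoly ht K))
        (refFacetMap l z)) (areaNormal l) := by
  rw [relVel, A.inner_normal_mul_facetDet hn ht K l hz, facetMap,
    A.eq_piola ht hv K (refFacetMap_mem hz), A.vel_elemMap ht K hT (refFacetMap_mem hz),
    det_smul_inverse_convFlux _ _ (A.det_jac_pos ht K (refFacetMap_mem hz)).ne']

/-! ### Divergence of the velocity -/

theorem det_mul_divg_piola (hn : n = 1 ∨ n = 2) {t : ℝ} (ht : t ∈ Icc 0 T)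
    {v : M.Elem → Vec (n + 1) → Vec (n + 1)} (hv : v ∈ A.Vh k t) (K : M.Elem)
    {y : Vec (n + 1)} (hy : y ∈ refSimplex (n + 1)) :
    pev (jacPoly (A.elemPoly t K)).det y * divg (A.elem t K) (v K) (A.elemMap t K y) =
      pev (∑ b, MvPolynomial.pderiv b (A.piolaPoly k v t K b)) y := by
  rw [A.det_mul_divg_push ht K hy (fun y hy => A.eq_piola ht hv K hy)
    (hasFDerivAt_piola _ (A.pev_det_pos ht K hy).ne'),
    sum_adjugate_mul_fderiv_piola (by omega) _ (A.pev_det_pos ht K hy).ne']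

theorem det_mul_divg_vel (hT : 0 < T) {t : ℝ} (ht : t ∈ Icc 0 T) (K : M.Elem)
    {y : Vec (n + 1)} (hy : y ∈ refSimplex (n + 1)) :
    pev (jacPoly (A.elemPoly t K)).det y * divg (A.elem t K) (A.vel t) (A.elemMap t K y) =
      pev (A.velDiv ht K) y := by
  rw [A.det_mul_divg_push ht K hy (fun y hy => A.vel_elemMap ht K hT hy)
    (hasStrictFDerivAt_polyMap _ y).hasFDerivAt, Finset.sum_comm]
  simp only [velDiv, pev_sum, pev_mul, polyJac_single]
  rfl

/-- A field of the Piola space that is weakly divergence free is divergence free. -/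
theorem pev_div_piolaPoly_eq_zero (hn : n = 1 ∨ n = 2) {t : ℝ} (ht : t ∈ Icc 0 T)
    {v : M.Elem → Vec (n + 1) → Vec (n + 1)} (hv : v ∈ A.Vh k t)
    (hdiv : ∀ q ∈ A.Wh (k - 1) t, A.vol t (fun K x => divg (A.elem t K) (v K) x * q K x) = 0)
    (K : M.Elem) {y : Vec (n + 1)} (hy : y ∈ refSimplex (n + 1)) :
    pev (∑ b, MvPolynomial.pderiv b (A.piolaPoly k v t K b)) y = 0 := by
  set D : M.Elem → MvPolynomial (Fin (n + 1)) ℝ := fun K =>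
    ∑ b, MvPolynomial.pderiv b (A.piolaPoly k v t K b) with hD
  have hdeg : ∀ K, (D K).totalDegree ≤ k - 1 := fun K =>
    MvPolynomial.totalDegree_finsetSum_le fun b _ => (totalDegree_pderiv_le b _).trans
      (Nat.sub_le_sub_right (A.totalDegree_piolaPoly_le v t K b) 1)
  -- The test function is the reference divergence itself. The factor J of the change of variables
  -- turns div u into the same polynomial, and the equation becomes a sum of integrals of squares.
  have hq : (fun K x => pev (D K) (A.elemInv t K x)) ∈ A.Wh (k - 1) t := fun K =>
    ⟨pev (D K), isPoly_pev (hdeg K), fun y hy => by simp only [A.elemInv_elemMap ht K hy]⟩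
  have h := hdiv _ hq
  have h1 : ∀ K, ∫ x in A.elem t K, divg (A.elem t K) (v K) x * pev (D K) (A.elemInv t K x) =
      ∫ y in refSimplex (n + 1), pev (D K) y ^ 2 := by
    intro K
    rw [A.integral_elem ht K]
    refine setIntegral_congr_fun measurableSet_refSimplex fun y hy => ?_
    simp only [A.elemInv_elemMap ht K hy]
    rw [← mul_assoc, A.det_mul_divg_piola hn ht hv K hy, sq]
  simp only [vol, h1] at h
  rw [Finset.sum_eq_zero_iff_of_nonneg
    fun K _ => integral_nonneg fun y => sq_nonneg (pev (D K) y)] at h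
  exact eq_zero_of_integral_sq_eq_zero (continuous_pev (D K)).continuousOn
    (h K (Finset.mem_univ K)) y hy

/-! ### The energy balance of an element -/

/-- Write f1, f2, f3 for the reference densities of u·∂ₜu, (div ω)|u|² and the convective term.
Reynolds gives f2 + 2 f1, while integration by parts says that the facet term is the integral of f3
- ½ f2; hence 2(f1 + f2 - f3 + (f3 - ½ f2)) is the same derivative. -/
theorem hasDerivWithinAt_energy (hn : n = 1 ∨ n = 2) (hT : 0 < T) {t : ℝ}
    (ht : t ∈ Icc 0 T) (hu : ∀ t ∈ Icc 0 T, u t ∈ A.Vh k t) (K : M.Elem)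
    (hdiff : ∀ y ∈ refSimplex (n + 1),
      DifferentiableWithinAt ℝ (fun s => u s K (A.elemMap s K y)) (Icc 0 T) t)
    (hdiv : ∀ y ∈ refSimplex (n + 1),
      pev (∑ b, MvPolynomial.pderiv b (A.piolaPoly k (u t) t K b)) y = 0) (ρ : ℝ) :
    HasDerivWithinAt (fun s => ∫ x in A.elem s K, ρ * inner ℝ (u s K x) (u s K x))
      (2 * ((∫ x in A.elem t K, ρ * inner ℝ (A.aleDeriv u t K x) (u t K x))
        + (∫ x in A.elem t K,
            ρ * divg (A.elem t K) (A.vel t) x * inner ℝ (u t K x) (u t K x))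
        - (∫ x in A.elem t K, ρ * frob (tens (u t K x - A.vel t x) (u t K x))
            (grad (A.elem t K) (u t K) x))
        + ∑ l, ∫ z in refSimplex n, ρ * A.relVel t (u t) K l (A.facetMap t K l z) *
            (1 / 2 * ‖u t K (A.facetMap t K l z)‖ ^ 2) * A.facetDet t K l z)) (Icc 0 T) t := by
  obtain ⟨hinter, hder⟩ := A.hasDerivWithinAt_integral_elem hn hT ht hu K hdiff
  set P := A.elemPoly t K with hPdef
  set Q := A.piolaPoly k (u t) t K with hQdef
  set R := A.velPoly ht K with hRdef
  have hP : ∀ y ∈ refSimplex (n + 1), pev (jacPoly P).det y ≠ 0 := fun y hy =>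
    (A.pev_det_pos ht K hy).ne'
  have hU : ∀ y ∈ refSimplex (n + 1), u t K (A.elemMap t K y) = piola P Q y := fun y hy =>
    A.eq_piola ht (hu t ht) K hy
  have hUc := continuousOn_piola Q hP
  have hibp := integral_convection hn P Q R hP hdiv
  set dU : Vec (n + 1) → Vec (n + 1) := fun y =>
    derivWithin (fun s => u s K (A.elemMap s K y)) (Icc 0 T) t with hdU
  set f1 : Vec (n + 1) → ℝ := fun y => pev (jacPoly P).det y * inner ℝ (piola P Q y) (dU y)
    with hf1
  set f2 : Vec (n + 1) → ℝ := fun y => pev (A.velDiv ht K) y * ‖piola P Q y‖ ^ 2 with hf2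
  set f3 : Vec (n + 1) → ℝ := fun y =>
    inner ℝ (piola P Q y) (fderiv ℝ (piola P Q) y (polyMap (convFlux P Q R) y)) with hf3
  have hD : ∫ y in refSimplex (n + 1), (pev (A.velDiv ht K) y * ‖u t K (A.elemMap t K y)‖ ^ 2 +
        pev (jacPoly P).det y * (2 * inner ℝ (u t K (A.elemMap t K y)) (dU y))) =
      ∫ y in refSimplex (n + 1), (f2 y + 2 * f1 y) :=
    setIntegral_congr_fun measurableSet_refSimplex fun y hy => by
      simp only [hf1, hf2, hU y hy]; ring
  have hi2 : IntegrableOn f2 (refSimplex (n + 1)) :=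
    ((continuous_pev _).continuousOn.mul (hUc.norm.pow 2)).integrableOn_compact
      isCompact_refSimplex
  -- Integrability of the term with the time derivative is read off from Reynolds' integrand f2 + 2
  -- f1 by subtracting f2.
  have hi1 : IntegrableOn f1 (refSimplex (n + 1)) := by
    refine IntegrableOn.congr_fun ((hinter.sub hi2).const_mul (1 / 2 : ℝ)) (fun y hy => ?_)
      measurableSet_refSimplex
    simp only [hf1, hf2, hU y hy, Pi.sub_apply]; ring
  have hi3 : IntegrableOn f3 (refSimplex (n + 1)) := by
    refine ContinuousOn.integrableOn_compact isCompact_refSimplex (hUc.inner ?_)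
    have : ContinuousOn (fun y => WithLp.toLp 2 fun i => ∑ b,
        fderiv ℝ (piola P Q) y (EuclideanSpace.single b 1) i * polyMap (convFlux P Q R) y b)
        (refSimplex (n + 1)) := by
      refine (PiLp.continuous_toLp 2 _).comp_continuousOn (continuousOn_pi.2 fun i => ?_)
      exact continuousOn_finsetSum _ fun b _ => (continuousOn_fderiv_piola Q hP b i).mul
        (continuous_pev _).continuousOn
    refine this.congr fun y hy => ?_
    ext i
    exact apply_eq_sum _ _ _
  have hV1 : ∫ x in A.elem t K, ρ * inner ℝ (A.aleDeriv u t K x) (u t K x) =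
      ρ * ∫ y in refSimplex (n + 1), f1 y := by
    rw [A.integral_elem ht K, ← integral_const_mul]
    refine setIntegral_congr_fun measurableSet_refSimplex fun y hy => ?_
    simp only [hf1, aleDeriv, A.back_elemMap ht K hy, hU y hy]
    rw [real_inner_comm]
    simp only [hdU, elemMap]
    ring
  have hV2 : ∫ x in A.elem t K, ρ * divg (A.elem t K) (A.vel t) x * inner ℝ (u t K x) (u t K x) =
      ρ * ∫ y in refSimplex (n + 1), f2 y := by
    rw [A.integral_elem ht K, ← integral_const_mul]
    refine setIntegral_congr_fun measurableSet_refSimplex fun y hy => ?_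
    simp only [hf2, ← A.det_mul_divg_vel hT ht K hy, hU y hy, real_inner_self_eq_norm_sq]
    ring
  have hV3 : ∫ x in A.elem t K, ρ * frob (tens (u t K x - A.vel t x) (u t K x))
        (grad (A.elem t K) (u t K) x) = ρ * ∫ y in refSimplex (n + 1), f3 y := by
    rw [A.integral_elem ht K, ← integral_const_mul]
    refine setIntegral_congr_fun measurableSet_refSimplex fun y hy => ?_
    simp only [hf3]
    rw [A.det_mul_frob_tens_grad ht K hy hU (hasFDerivAt_piola Q (hP y hy)), hU y hy,
      A.vel_elemMap ht K hT hy, ← det_smul_inverse_convFlux Q R (A.det_jac_pos ht K hy).ne',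
      map_smul, inner_smul_right, det_polyJac]
    ring
  have hB : ∑ l, ∫ z in refSimplex n, ρ * A.relVel t (u t) K l (A.facetMap t K l z) *
            (1 / 2 * ‖u t K (A.facetMap t K l z)‖ ^ 2) * A.facetDet t K l z =
      ρ * (∫ y in refSimplex (n + 1), f3 y - 1 / 2 * f2 y) := by
    have h1 : ∫ y in refSimplex (n + 1), (f3 y - 1 / 2 * f2 y) = ∫ y in refSimplex (n + 1),
        (inner ℝ (piola P Q y) (fderiv ℝ (piola P Q) y (polyMap (convFlux P Q R) y)) -
        1 / 2 * ‖piola P Q y‖ ^ 2 *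
          pev (∑ b, ∑ j, (jacPoly P).adjugate b j * MvPolynomial.pderiv b (R j)) y) :=
      setIntegral_congr_fun measurableSet_refSimplex fun y hy => by
        simp only [hf3, hf2, velDiv]; ring
    rw [h1, hibp, Finset.mul_sum]
    refine Finset.sum_congr rfl fun l _ => ?_
    rw [← integral_const_mul]
    refine setIntegral_congr_fun measurableSet_refSimplex fun z hz => ?_
    have h2 := A.relVel_mul_facetDet hn hT ht (hu t ht) K l hz
    rw [← hPdef, ← hQdef, ← hRdef] at h2
    rw [← h2, ← hU _ (refFacetMap_mem hz)]
    simp only [facetMap]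
    ring
  rw [hD] at hder
  have hfin := hder.const_mul ρ
  have hfun : (fun s => ∫ x in A.elem s K, ρ * inner ℝ (u s K x) (u s K x)) =
      fun s => ρ * ∫ x in A.elem s K, ‖u s K x‖ ^ 2 := by
    funext s
    simp only [real_inner_self_eq_norm_sq, integral_const_mul]
  rw [hfun]
  refine hfin.congr_deriv ?_
  rw [hV1, hV2, hV3, hB, integral_add hi2 (hi1.const_mul 2),
    integral_sub hi3 (hi2.const_mul _), integral_const_mul, integral_const_mul]
  ring

end ALEMap


/-! ### Facets shared by two elements -/

namespace Mesh

variable {n m : ℕ} {M : Mesh n m}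

theorem facetSet_eq_of_facet_eq {K K' : M.Elem} {l l' : Fin (n + 2)}
    (h : M.facet K l = M.facet K' l') : M.facetSet K l = M.facetSet K' l' :=
  congrArg Subtype.val h

theorem bary_refFacetMap_pos {l i : Fin (n + 2)} {z : Vec n} (hz : z ∈ openSimplex n)
    (hi : i ≠ l) : 0 < bary (refFacetMap l z) i := by
  obtain ⟨j, rfl⟩ := Fin.exists_succAbove_eq hi
  simpa using hz j

/-- A point in the relative interior of a facet has exactly one vanishing barycentric coordinate,
which identifies the facet within its element. -/
theorem index_eq_of_facet_eq {K : M.Elem} {l l' : Fin (n + 2)}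
    (h : M.facet K l = M.facet K l') : l = l' := by
  obtain ⟨z, hz⟩ := openSimplex_nonempty (n := n)
  have hz' := openSimplex_subset hz
  have hmem : M.map K (refFacetMap l z) ∈ M.facetSet K l' := by
    rw [← facetSet_eq_of_facet_eq h]; exact ⟨z, hz', rfl⟩
  obtain ⟨w, hw, hwz⟩ := hmem
  have heq := M.map_inj K (refFacetMap_mem hw) (refFacetMap_mem hz') hwz
  by_contra hne
  have h1 := bary_refFacetMap_pos hz (Ne.symm hne)
  rw [← heq, bary_refFacetMap_same] at h1
  exact lt_irrefl _ h1

theorem elem_ne_of_facet_eq {q q' : M.Elem × Fin (n + 2)} (hq : q ≠ q')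
    (h : M.facet q.1 q.2 = M.facet q'.1 q'.2) : q.1 ≠ q'.1 := by
  obtain ⟨K, l⟩ := q
  obtain ⟨K', l'⟩ := q'
  rintro rfl
  exact hq (Prod.ext rfl (index_eq_of_facet_eq h))

/-- The two parametrizations of a facet shared by two elements differ by a relabelling of the
vertices. -/
theorem exists_relabel {K K' : M.Elem} {l l' : Fin (n + 2)} (hK : K ≠ K')
    (h : M.facet K l = M.facet K' l') : ∃ τ : Equiv.Perm (Fin (n + 1)), ∀ z ∈ refSimplex n,
      M.map K (refFacetMap l z) = M.map K' (refFacetMap l' (relabel τ z)) := by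
  obtain ⟨S, σ, hS, hinter, hσ⟩ := M.conforming K K' hK
  have hset := facetSet_eq_of_facet_eq h
  -- Every point of the shared facet lies in both elements, hence in their common face, where the
  -- conformity relation applies.
  have hface : ∀ z ∈ refSimplex n, refFacetMap l z ∈ face S := by
    intro z hz
    have h1 : M.map K (refFacetMap l z) ∈
        M.map K '' refSimplex (n + 1) ∩ M.map K' '' refSimplex (n + 1) := by
      refine ⟨⟨_, refFacetMap_mem hz, rfl⟩, ?_⟩
      have h2 : M.map K (refFacetMap l z) ∈ M.facetSet K' l' := by
        rw [← hset]; exact ⟨z, hz, rfl⟩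
      obtain ⟨w, hw, hwz⟩ := h2
      exact ⟨_, refFacetMap_mem hw, hwz⟩
    rw [hinter] at h1
    obtain ⟨x, hx, hxz⟩ := h1
    rwa [← M.map_inj K hx.1 (refFacetMap_mem hz) hxz]
  obtain ⟨o, ho⟩ := openSimplex_nonempty (n := n)
  -- At a relative interior point only coordinate l vanishes on the side of K and coordinate l'
  -- vanishes on the side of K'; σ must match them.
  have hσl : σ l = l' := by
    have ho' := openSimplex_subset ho
    have h1 : M.map K (refFacetMap l o) ∈ M.facetSet K' l' := by
      rw [← hset]; exact ⟨o, ho', rfl⟩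
    obtain ⟨w, hw, hwo⟩ := h1
    beta_reduce at hwo
    rw [hσ _ (hface o ho')] at hwo
    have heq := M.map_inj K' (refFacetMap_mem hw) (relabel_mem (refFacetMap_mem ho')) hwo
    have h2 : bary (refFacetMap l o) (σ.symm l') = 0 := by
      rw [← bary_relabel, ← heq, bary_refFacetMap_same]
    by_contra hne
    have h3 : σ.symm l' ≠ l := fun h => hne (by rw [← h, Equiv.apply_symm_apply])
    exact (bary_refFacetMap_pos ho h3).ne' h2
  -- Since σ sends l to l', it restricts to a bijection between the remaining vertices, those of the
  -- two facets; this restriction is τ.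
  have hex : ∀ j, ∃ i, l'.succAbove i = σ (l.succAbove j) := fun j =>
    Fin.exists_succAbove_eq (by
      rw [← hσl]
      exact fun h => Fin.succAbove_ne l j (σ.injective h))
  choose f hf using hex
  have hfinj : Function.Injective f := by
    intro i j hij
    have h1 : σ (l.succAbove i) = σ (l.succAbove j) := by rw [← hf, ← hf, hij]
    exact Fin.succAbove_right_injective (σ.injective h1)
  let τ : Equiv.Perm (Fin (n + 1)) := Equiv.ofBijective f (Finite.injective_iff_bijective.1 hfinj)
  refine ⟨τ, fun z hz => ?_⟩
  rw [hσ _ (hface z hz)]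
  congr 1
  apply bary_injective; funext i
  rw [bary_relabel]
  rcases Fin.eq_self_or_eq_succAbove l' i with rfl | ⟨j, rfl⟩
  · rw [bary_refFacetMap_same, ← hσl, Equiv.symm_apply_apply, bary_refFacetMap_same]
  · have h1 : σ.symm (l'.succAbove j) = l.succAbove (τ.symm j) := by
      rw [Equiv.symm_apply_eq, ← hf]
      exact congrArg _ (Equiv.apply_symm_apply τ j).symm
    rw [h1, bary_refFacetMap_succAbove, bary_refFacetMap_succAbove, bary_relabel]

end Mesh

namespace ALEMap

variable {n m : ℕ} {M : Mesh n m} {T : ℝ} (A : ALEMap M T)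

theorem facetMap_eq_of_map_eq {K K' : M.Elem} {l l' : Fin (n + 2)} {z z' : Vec n}
    (h : M.map K (refFacetMap l z) = M.map K' (refFacetMap l' z')) (t : ℝ) :
    A.facetMap t K l z = A.facetMap t K' l' z' := congrArg (A.φ t) h

/-- Near a point in the relative interior of a facet, an element contains the rays that point
against the outward normal. -/
theorem eventually_mem_elem {t : ℝ} (ht : t ∈ Icc 0 T) (K : M.Elem) (l : Fin (n + 2))
    {z : Vec n} (hz : z ∈ openSimplex n) {v : Vec (n + 1)}
    (hv : inner ℝ v (A.normal t K l (A.facetMap t K l z)) < 0) :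
    ∀ᶠ s : ℝ in nhdsWithin 0 (Ioi 0), ∃ y ∈ openSimplex (n + 1),
      A.elemMap t K y = A.facetMap t K l z + s • v := by
  set y := refFacetMap l z with hydef
  have hy : y ∈ refSimplex (n + 1) := refFacetMap_mem (openSimplex_subset hz)
  set P := A.elemPoly t K
  obtain ⟨e, he⟩ := exists_equiv_of_det_ne_zero (A.det_jac_pos ht K hy).ne'
  have hf : HasStrictFDerivAt (polyMap P) (e : Vec (n + 1) →L[ℝ] Vec (n + 1)) y := by
    rw [he]; exact hasStrictFDerivAt_polyMap P y
  have hx : A.facetMap t K l z = polyMap P y := A.elemMap_eq ht K hy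
  -- The polynomial extends the element map beyond the simplex, so the inverse function theorem
  -- applies even at a boundary point. The ray is pulled back by g, and its preimage is shown to
  -- enter the open simplex.
  set g := hf.localInverse (polyMap P) e y with hg
  have hg0 : g (polyMap P y) = y := hf.localInverse_apply_image
  have hline : HasDerivAt (fun s : ℝ => polyMap P y + s • v) v 0 := by
    simpa using ((hasDerivAt_id (0 : ℝ)).smul_const v).const_add (polyMap P y)
  have hc : HasDerivAt (fun s : ℝ => g (polyMap P y + s • v)) (e.symm v) 0 := by
    have h1 : HasFDerivAt g (e.symm : Vec (n + 1) →L[ℝ] Vec (n + 1))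
        (polyMap P y + (0 : ℝ) • v) := by
      simpa using hf.to_localInverse.hasFDerivAt
    exact h1.comp_hasDerivAt (0 : ℝ) hline
  have hneg : inner ℝ (e.symm v) (areaNormal l) < 0 := by
    have h1 : inner ℝ (e.symm v) (areaNormal l) = inner ℝ v (A.conormal t K l y) := by
      rw [conormal, ContinuousLinearMap.adjoint_inner_right, ← he]
      simp
    have h2 := A.normal_elemMap ht K l hy
    have h3 : A.facetMap t K l z = A.elemMap t K y := rfl
    rw [h3, h2, inner_smul_right] at hv
    rw [h1]
    by_contra hcon
    exact absurd hv (not_lt.2 (mul_nonneg (by positivity) (not_lt.1 hcon)))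
  -- Coordinate l starts at zero and has positive derivative there, because v makes a negative inner
  -- product with the outward normal.
  have hl : ∀ᶠ s : ℝ in nhdsWithin 0 (Ioi 0), 0 < bary (g (polyMap P y + s • v)) l := by
    have hb : ∀ s : ℝ, bary (g (polyMap P y + s • v)) l =
        -inner ℝ (g (polyMap P y + s • v) - y) (areaNormal l) := by
      intro s
      rw [← bary_sub_bary, hydef, bary_refFacetMap_same, sub_zero]
    have hd : HasDerivAt (fun s : ℝ => bary (g (polyMap P y + s • v)) l)
        (-inner ℝ (e.symm v) (areaNormal l)) 0 := by
      simp only [hb]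
      have h1 := ((hc.sub_const y).inner ℝ (hasDerivAt_const (0 : ℝ) (areaNormal l))).neg
      refine HasDerivAt.congr_deriv h1 ?_
      simp
    have h0 : bary (g (polyMap P y + (0 : ℝ) • v)) l = 0 := by
      rw [zero_smul, add_zero, hg0, hydef, bary_refFacetMap_same]
    have hs := (hasDerivAt_iff_tendsto_slope_zero.1 hd).mono_left
      (nhdsWithin_mono 0 (fun s (hs : s ∈ Ioi (0 : ℝ)) => ne_of_gt hs))
    have hpos : 0 < -inner ℝ (e.symm v) (areaNormal l) := by linarith
    filter_upwards [hs.eventually (lt_mem_nhds hpos), self_mem_nhdsWithin] with s h1 h2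
    rw [zero_add, h0, sub_zero, smul_eq_mul] at h1
    have h3 : (0 : ℝ) < s := h2
    exact (pos_iff_pos_of_mul_pos h1).1 (inv_pos.2 h3)
  have hcont : Filter.Tendsto (fun s : ℝ => g (polyMap P y + s • v)) (nhdsWithin 0 (Ioi 0))
      (nhds y) := by
    have h1 := hc.continuousAt.tendsto.mono_left (nhdsWithin_le_nhds (s := Ioi (0 : ℝ)))
    simpa [hg0] using h1
  -- The other coordinates are already positive on the relative interior of the facet and stay so by
  -- continuity.
  have hother : ∀ᶠ s : ℝ in nhdsWithin 0 (Ioi 0), ∀ i, i ≠ l →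
      0 < bary (g (polyMap P y + s • v)) i := by
    rw [Filter.eventually_all]
    intro i
    by_cases hi : i = l
    · exact Filter.Eventually.of_forall fun s h => absurd hi h
    · have h1 := ((continuous_bary i).tendsto y).comp hcont
      filter_upwards [h1.eventually (lt_mem_nhds (Mesh.bary_refFacetMap_pos hz hi))] with s hs _
      exact hs
  have hright : ∀ᶠ s : ℝ in nhdsWithin 0 (Ioi 0),
      polyMap P (g (polyMap P y + s • v)) = polyMap P y + s • v := by
    have h1 : Filter.Tendsto (fun s : ℝ => polyMap P y + s • v) (nhdsWithin 0 (Ioi 0))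
        (nhds (polyMap P y)) := by
      have := hline.continuousAt.tendsto.mono_left (nhdsWithin_le_nhds (s := Ioi (0 : ℝ)))
      simpa using this
    exact h1.eventually hf.eventually_right_inverse
  filter_upwards [hl, hother, hright] with s h1 h2 h3
  have hmem : g (polyMap P y + s • v) ∈ openSimplex (n + 1) := fun i => by
    by_cases hi : i = l
    · rw [hi]; exact h1
    · exact h2 i hi
  refine ⟨_, hmem, ?_⟩
  rw [A.elemMap_eq ht K (openSimplex_subset hmem), h3, hx]

/-- Distinct elements meet in a proper face, on which some barycentric coordinate vanishes; interior
points have none. -/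
theorem elemMap_openSimplex_ne {t : ℝ} (ht : t ∈ Icc 0 T) {K K' : M.Elem} (hK : K ≠ K')
    {y y' : Vec (n + 1)} (hy : y ∈ openSimplex (n + 1)) (hy' : y' ∈ openSimplex (n + 1)) :
    A.elemMap t K y ≠ A.elemMap t K' y' := by
  intro h
  have hy0 := openSimplex_subset hy
  have hy0' := openSimplex_subset hy'
  have h1 : M.map K y = M.map K' y' :=
    A.inj t ht (map_mem_domain K hy0) (map_mem_domain K' hy0') h
  obtain ⟨S, σ, hS, hinter, -⟩ := M.conforming K K' hK
  have h2 : M.map K y ∈ M.map K '' refSimplex (n + 1) ∩ M.map K' '' refSimplex (n + 1) :=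
    ⟨⟨y, hy0, rfl⟩, ⟨y', hy0', h1.symm⟩⟩
  rw [hinter] at h2
  obtain ⟨x, hx, hxy⟩ := h2
  have h3 := M.map_inj K hx.1 hy0 hxy
  obtain ⟨i, hi⟩ : ∃ i, i ∉ S := by
    by_contra hcon
    exact hS (Finset.eq_univ_iff_forall.2 fun i => not_not.1 fun h => hcon ⟨i, h⟩)
  have h4 := hx.2 i hi
  rw [h3] at h4
  exact (hy i).ne' h4

/-- Two elements have opposite outward normals on a common facet. -/
theorem normal_eq_neg {t : ℝ} (ht : t ∈ Icc 0 T) {K K' : M.Elem} (hK : K ≠ K')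
    {l l' : Fin (n + 2)} {z z' : Vec n} (hz : z ∈ openSimplex n) (hz' : z' ∈ openSimplex n)
    (h : A.facetMap t K l z = A.facetMap t K' l' z') :
    A.normal t K' l' (A.facetMap t K' l' z') = -A.normal t K l (A.facetMap t K l z) := by
  set ν := A.normal t K l (A.facetMap t K l z) with hν
  set ν' := A.normal t K' l' (A.facetMap t K' l' z') with hν'
  have h1 : ‖ν‖ = 1 := A.norm_normal ht K l (refFacetMap_mem (openSimplex_subset hz))
  have h1' : ‖ν'‖ = 1 := A.norm_normal ht K' l' (refFacetMap_mem (openSimplex_subset hz'))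
  by_contra hne
  have h2 : inner ℝ ν' ν ≠ -1 := fun h2 =>
    hne ((inner_eq_neg_one_iff_of_norm_eq_one h1' h1).1 h2)
  have h3 : -1 ≤ inner ℝ ν' ν := by
    have := neg_le_of_abs_le (abs_real_inner_le_norm ν' ν)
    rwa [h1, h1', mul_one] at this
  have h4 : -1 < inner ℝ ν' ν := lt_of_le_of_ne h3 (Ne.symm h2)
  -- Unless ν' = -ν, the direction -(ν + ν') points strictly into both elements, whose interiors
  -- would then overlap.
  have hv : inner ℝ (-(ν + ν')) ν < 0 := by
    rw [inner_neg_left, inner_add_left, real_inner_self_eq_norm_sq, h1]; linarith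
  have hv' : inner ℝ (-(ν + ν')) ν' < 0 := by
    rw [inner_neg_left, inner_add_left, real_inner_self_eq_norm_sq, h1', real_inner_comm]; linarith
  obtain ⟨s, ⟨y, hy, hys⟩, ⟨y', hy', hys'⟩⟩ :=
    ((A.eventually_mem_elem ht K l hz hv).and (A.eventually_mem_elem ht K' l' hz' hv')).exists
  exact A.elemMap_openSimplex_ne ht hK hy hy' (by rw [hys, hys', h])

theorem relabel_mem_openSimplex {τ : Equiv.Perm (Fin (n + 1))} {z : Vec n}
    (hz : z ∈ openSimplex n) : relabel τ z ∈ openSimplex n := fun i => by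
  rw [bary_relabel]; exact hz _

/-- A facet belongs to at most two elements. -/
theorem eq_of_facet_eq (A : ALEMap M T) {t : ℝ} (ht : t ∈ Icc 0 T) {q q' q'' : M.Elem × Fin (n + 2)}
    (hq' : q' ≠ q) (hq'' : q'' ≠ q) (h' : M.facet q'.1 q'.2 = M.facet q.1 q.2)
    (h'' : M.facet q''.1 q''.2 = M.facet q.1 q.2) : q' = q'' := by
  by_contra hne
  have h12 := Mesh.elem_ne_of_facet_eq hq' h'
  have h13 := Mesh.elem_ne_of_facet_eq hq'' h''
  have h23 := Mesh.elem_ne_of_facet_eq hne (h'.trans h''.symm)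
  obtain ⟨τ, hτ⟩ := Mesh.exists_relabel h12.symm h'.symm
  obtain ⟨τ', hτ'⟩ := Mesh.exists_relabel h13.symm h''.symm
  obtain ⟨z, hz⟩ := openSimplex_nonempty (n := n)
  have e1 := A.facetMap_eq_of_map_eq (hτ z (openSimplex_subset hz)) t
  have e2 := A.facetMap_eq_of_map_eq (hτ' z (openSimplex_subset hz)) t
  have n1 := A.normal_eq_neg ht h12.symm hz (relabel_mem_openSimplex hz) e1
  have n2 := A.normal_eq_neg ht h13.symm hz (relabel_mem_openSimplex hz) e2
  -- Three sides would give three pairwise opposite unit vectors, which is impossible.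
  have n3 := A.normal_eq_neg ht h23 (relabel_mem_openSimplex hz) (relabel_mem_openSimplex hz)
    (e1.symm.trans e2)
  rw [n1, n2, neg_neg] at n3
  have h1 := A.norm_normal ht q.1 q.2 (refFacetMap_mem (l := q.2) (openSimplex_subset hz))
  have h0 : A.normal t q.1 q.2 (A.facetMap t q.1 q.2 z) = 0 := by
    ext i
    have h2 := congrArg (fun w : Vec (n + 1) => w i) n3
    simp only [PiLp.neg_apply] at h2
    rw [PiLp.zero_apply]
    linarith
  rw [facetMap] at h0
  rw [h0, norm_zero] at h1
  exact zero_ne_one h1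

/-- The facet Jacobians of the two sides differ by the linear part of the relabelling, of
determinant ±1, which enters the Gram determinant squared. -/
theorem facetDet_relabel {t : ℝ} (ht : t ∈ Icc 0 T) {K K' : M.Elem} {l l' : Fin (n + 2)}
    {τ : Equiv.Perm (Fin (n + 1))}
    (hτ : ∀ z ∈ refSimplex n, A.facetMap t K l z = A.facetMap t K' l' (relabel τ z))
    {z : Vec n} (hz : z ∈ refSimplex n) :
    A.facetDet t K l z = A.facetDet t K' l' (relabel τ z) := by
  have h1 := (A.hasFDerivWithinAt_facetMap ht K' l' (relabel_mem (σ := τ) hz)).comp z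
    (hasFDerivAt_relabel τ z).hasFDerivWithinAt fun _ hz => relabel_mem hz
  have h2 : A.facetJac t K l z = (A.facetJac t K' l' (relabel τ z)).comp
      (affLin fun i => refVertex (τ i)) := by
    rw [A.facetJac_eq ht K' l' (relabel_mem hz)]
    exact (h1.congr hτ (hτ z hz)).fderivWithin (uniqueDiffOn_refSimplex z hz)
  rw [facetDet, facetDet, h2]
  congr 1
  set B := A.facetJac t K' l' (relabel τ z)
  set L : Vec n →L[ℝ] Vec n := affLin fun i => refVertex (τ i) with hL
  have h3 : (ContinuousLinearMap.adjoint (B.comp L)).comp (B.comp L) =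
      (ContinuousLinearMap.adjoint L).comp
        (((ContinuousLinearMap.adjoint B).comp B).comp L) := by
    rw [ContinuousLinearMap.adjoint_comp]; rfl
  have hadj : (ContinuousLinearMap.adjoint L).det = L.det := by
    rw [clm_det_eq, clm_det_eq, ← Matrix.det_transpose]
    congr 1
    ext i j
    have h4 := ContinuousLinearMap.adjoint_inner_right L (EuclideanSpace.single j (1 : ℝ))
      (EuclideanSpace.single i (1 : ℝ))
    rw [EuclideanSpace.inner_single_left, EuclideanSpace.inner_single_right] at h4
    simpa using h4
  have hmul : ∀ X Y : Vec n →L[ℝ] Vec n, (X.comp Y).det = X.det * Y.det := fun X Y => by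
    simp [ContinuousLinearMap.det]
  have hsq : L.det * L.det = 1 := by
    have h5 := abs_det_relabel τ
    rw [← hL] at h5
    rw [← abs_mul_abs_self, h5, one_mul]
  rw [h3, hmul, hmul, hadj]
  linear_combination (((ContinuousLinearMap.adjoint B).comp B).det) * hsq

end ALEMap


/-- The tangential part does not depend on the side from which the facet is seen. -/
theorem tng_neg {d : ℕ} (ν v : Vec d) : tng (-ν) v = tng ν v := by
  simp [tng, inner_neg_right]

namespace ALEMap

variable {n m k : ℕ} {M : Mesh n m} {T : ℝ} (A : ALEMap M T)

/-! ### Continuity of the normal component -/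

/-- The normal component times the area element, in the reference variable of a facet. -/
def normalFlux (t : ℝ) (v : M.Elem → Vec (n + 1) → Vec (n + 1)) (q : M.Elem × Fin (n + 2))
    (z : Vec n) : ℝ :=
  inner ℝ (v q.1 (A.facetMap t q.1 q.2 z)) (A.normal t q.1 q.2 (A.facetMap t q.1 q.2 z)) *
    A.facetDet t q.1 q.2 z

/-- By Nanson's formula and the Piola map this flux is Q·N restricted to the facet. Having degree at
most k, it is an admissible test function for the normal continuity equation. -/
theorem isPoly_normalFlux (hn : n = 1 ∨ n = 2) {t : ℝ} (ht : t ∈ Icc 0 T)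
    {v : M.Elem → Vec (n + 1) → Vec (n + 1)} (hv : v ∈ A.Vh k t) (q : M.Elem × Fin (n + 2)) :
    IsPoly k (A.normalFlux t v q) := by
  have h1 : IsPoly k (pev (∑ i, areaNormal q.2 i • A.piolaPoly k v t q.1 i)) :=
    isPoly_pev (MvPolynomial.totalDegree_finsetSum_le fun i _ =>
      (MvPolynomial.totalDegree_smul_le _ _).trans (A.totalDegree_piolaPoly_le v t q.1 i))
  refine (h1.comp_sum_bary (fun j => refVertex (q.2.succAbove j))
    fun z hz => refFacetMap_mem hz).congr fun z hz => ?_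
  rw [normalFlux, A.inner_normal_mul_facetDet_piola hn ht hv q.1 q.2 hz]
  simp only [PiLp.inner_apply, pev_sum, pev_smul, polyMap]
  exact Finset.sum_congr rfl fun i _ => rfl

theorem isPoly_comp_relabel {g : Vec n → ℝ} (hg : IsPoly k g) (τ : Equiv.Perm (Fin (n + 1))) :
    IsPoly k fun z => g (relabel τ z) :=
  hg.comp_sum_bary (fun j => refVertex (τ j)) fun _ hz => relabel_mem hz

open Classical in
/-- The skeleton function that equals `j` on the facet `q` and vanishes on the other facets. -/
def facetFun (t : ℝ) (q : M.Elem × Fin (n + 2)) (j : Vec n → ℝ) :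
    M.Facet → Vec (n + 1) → ℝ := fun E x =>
  if E = M.facet q.1 q.2 then j (Function.invFunOn (A.facetMap t q.1 q.2) (refSimplex n) x) else 0

theorem injOn_facetMap {t : ℝ} (ht : t ∈ Icc 0 T) (K : M.Elem) (l : Fin (n + 2)) :
    InjOn (A.facetMap t K l) (refSimplex n) := fun _ hz _ hz' h =>
  refFacetMap_injective l (A.injOn_elemMap ht K (refFacetMap_mem hz) (refFacetMap_mem hz') h)

theorem facetFun_self {t : ℝ} (ht : t ∈ Icc 0 T) (q : M.Elem × Fin (n + 2)) (j : Vec n → ℝ)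
    {z : Vec n} (hz : z ∈ refSimplex n) :
    A.facetFun t q j (M.facet q.1 q.2) (A.facetMap t q.1 q.2 z) = j z := by
  rw [facetFun, if_pos rfl, (A.injOn_facetMap ht q.1 q.2).leftInvOn_invFunOn hz]

theorem facetFun_of_eq {t : ℝ} (ht : t ∈ Icc 0 T) {q q' : M.Elem × Fin (n + 2)}
    (h : M.facet q'.1 q'.2 = M.facet q.1 q.2) {τ : Equiv.Perm (Fin (n + 1))}
    (hτ : ∀ z ∈ refSimplex n,
      A.facetMap t q'.1 q'.2 z = A.facetMap t q.1 q.2 (relabel τ z)) (j : Vec n → ℝ)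
    {z : Vec n} (hz : z ∈ refSimplex n) :
    A.facetFun t q j (M.facet q'.1 q'.2) (A.facetMap t q'.1 q'.2 z) = j (relabel τ z) := by
  rw [h, hτ z hz, A.facetFun_self ht q j (relabel_mem hz)]

theorem facetFun_of_ne {t : ℝ} {q q' : M.Elem × Fin (n + 2)}
    (h : M.facet q'.1 q'.2 ≠ M.facet q.1 q.2) (j : Vec n → ℝ) (x : Vec (n + 1)) :
    A.facetFun t q j (M.facet q'.1 q'.2) x = 0 := if_neg h

/-- Membership has to be checked from each side of a facet; seen from the other side, `j` is
composed with a relabelling and keeps its degree. -/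
theorem facetFun_mem {t : ℝ} (ht : t ∈ Icc 0 T) (q : M.Elem × Fin (n + 2)) {j : Vec n → ℝ}
    (hj : IsPoly k j) : A.facetFun t q j ∈ A.Wt k t := by
  intro K l
  by_cases h : M.facet K l = M.facet q.1 q.2
  · by_cases hq : (K, l) = q
    · subst hq
      exact ⟨j, hj, fun z hz => A.facetFun_self ht (K, l) j hz⟩
    · obtain ⟨τ, hτ⟩ := Mesh.exists_relabel (Mesh.elem_ne_of_facet_eq (q := (K, l)) hq h) h
      exact ⟨fun z => j (relabel τ z), isPoly_comp_relabel hj τ, fun z hz =>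
        A.facetFun_of_eq ht (q' := (K, l)) h
          (fun z hz => A.facetMap_eq_of_map_eq (hτ z hz) t) j hz⟩
  · exact ⟨fun _ => 0, isPoly_zero, fun z hz => A.facetFun_of_ne (q' := (K, l)) h j _⟩

theorem bdry_eq_sum (t : ℝ) (g : M.Elem → Fin (n + 2) → Vec (n + 1) → ℝ) :
    A.bdry t g = ∑ q : M.Elem × Fin (n + 2), ∫ z in refSimplex n,
      g q.1 q.2 (A.facetMap t q.1 q.2 z) * A.facetDet t q.1 q.2 z := by
  rw [bdry, Fintype.sum_prod_type]

theorem bdry_normal_facetFun {t : ℝ} (v : M.Elem → Vec (n + 1) → Vec (n + 1))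
    (w : M.Facet → Vec (n + 1) → ℝ) :
    A.bdry t (fun K l x => inner ℝ (v K x) (A.normal t K l x) * w (M.facet K l) x) =
      ∑ q : M.Elem × Fin (n + 2), ∫ z in refSimplex n,
        A.normalFlux t v q z * w (M.facet q.1 q.2) (A.facetMap t q.1 q.2 z) := by
  rw [bdry_eq_sum]
  refine Finset.sum_congr rfl fun q _ => ?_
  congr 1
  funext z
  rw [normalFlux]; ring

/-- A facet that is not shared is a boundary facet, on which the normal component vanishes. -/
theorem normalFlux_eq_zero (hn : n = 1 ∨ n = 2) {t : ℝ} (ht : t ∈ Icc 0 T)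
    {v : M.Elem → Vec (n + 1) → Vec (n + 1)} (hv : v ∈ A.Vh k t)
    (hcont : ∀ w ∈ A.Wt k t,
      A.bdry t (fun K l x => inner ℝ (v K x) (A.normal t K l x) * w (M.facet K l) x) = 0)
    {q : M.Elem × Fin (n + 2)} (hq : ∀ q', M.facet q'.1 q'.2 = M.facet q.1 q.2 → q' = q)
    {z : Vec n} (hz : z ∈ refSimplex n) : A.normalFlux t v q z = 0 := by
  have hp := A.isPoly_normalFlux hn ht hv q
  -- The test function is the flux itself; the equation reduces to the integral of its square.
  have h := hcont _ (A.facetFun_mem ht q hp)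
  rw [bdry_normal_facetFun, Finset.sum_eq_single q] at h
  · refine eq_zero_of_integral_sq_eq_zero hp.continuousOn ?_ z hz
    rw [← h]
    refine setIntegral_congr_fun measurableSet_refSimplex fun z hz => ?_
    simp only [A.facetFun_self ht q _ hz, sq]
  · intro q' _ hne
    have hne' : M.facet q'.1 q'.2 ≠ M.facet q.1 q.2 := fun h => hne (hq q' h)
    simp [A.facetFun_of_ne hne']
  · simp

/-- Test with the jump of the flux, supported on this facet. The two sides together then contribute
the integral of the squared jump, no third side exists, and continuity makes the jump vanish
everywhere. -/
theorem normalFlux_add_eq_zero (hn : n = 1 ∨ n = 2) {t : ℝ} (ht : t ∈ Icc 0 T)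
    {v : M.Elem → Vec (n + 1) → Vec (n + 1)} (hv : v ∈ A.Vh k t)
    (hcont : ∀ w ∈ A.Wt k t,
      A.bdry t (fun K l x => inner ℝ (v K x) (A.normal t K l x) * w (M.facet K l) x) = 0)
    {q q' : M.Elem × Fin (n + 2)} (hqq : q' ≠ q) (hf : M.facet q'.1 q'.2 = M.facet q.1 q.2)
    {τ : Equiv.Perm (Fin (n + 1))}
    (hτ : ∀ z ∈ refSimplex n, A.facetMap t q.1 q.2 z = A.facetMap t q'.1 q'.2 (relabel τ z))
    {z : Vec n} (hz : z ∈ refSimplex n) :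
    A.normalFlux t v q z + A.normalFlux t v q' (relabel τ z) = 0 := by
  set j : Vec n → ℝ := fun z => A.normalFlux t v q z + A.normalFlux t v q' (relabel τ z) with hj
  have hp : IsPoly k j := (A.isPoly_normalFlux hn ht hv q).add
    (isPoly_comp_relabel (A.isPoly_normalFlux hn ht hv q') τ)
  have hp0 := A.isPoly_normalFlux hn ht hv q
  have hp1 := isPoly_comp_relabel (A.isPoly_normalFlux hn ht hv q') τ
  have h := hcont _ (A.facetFun_mem ht q hp)
  rw [bdry_normal_facetFun, Finset.sum_eq_add q q' hqq.symm] at h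
  · refine eq_zero_of_integral_sq_eq_zero (f := j) hp.continuousOn ?_ z hz
    rw [← h, ← integral_relabel τ fun z => A.normalFlux t v q' z *
      A.facetFun t q j (M.facet q'.1 q'.2) (A.facetMap t q'.1 q'.2 z), ← integral_add]
    · refine setIntegral_congr_fun measurableSet_refSimplex fun z hz => ?_
      simp only [A.facetFun_self ht q _ hz]
      rw [hf, ← hτ z hz, A.facetFun_self ht q _ hz]
      simp only [hj]
      ring
    · refine IntegrableOn.congr_fun ((hp0.continuousOn.mul
        hp.continuousOn).integrableOn_compact isCompact_refSimplex) (fun z hz => ?_)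
        measurableSet_refSimplex
      simp only [A.facetFun_self ht q _ hz, Pi.mul_apply]
    · refine IntegrableOn.congr_fun ((hp1.continuousOn.mul
        hp.continuousOn).integrableOn_compact isCompact_refSimplex) (fun z hz => ?_)
        measurableSet_refSimplex
      rw [hf, ← hτ z hz, A.facetFun_self ht q _ hz, Pi.mul_apply]
  · intro q'' _ hne
    have hne' : M.facet q''.1 q''.2 ≠ M.facet q.1 q.2 := fun h =>
      hne.2 (A.eq_of_facet_eq ht hqq hne.1 hf h).symm
    simp [A.facetFun_of_ne hne']
  · simp
  · simp

/-! ### Cancellation on the skeleton -/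

/-- A sum over all sides of facets vanishes if the contributions of unshared facets vanish and
those of the two sides of a shared facet cancel. -/
theorem sum_facets_eq_zero (A : ALEMap M T) {t : ℝ} (ht : t ∈ Icc 0 T) {H : M.Elem × Fin (n + 2) → ℝ}
    (hbdry : ∀ q, (∀ q', M.facet q'.1 q'.2 = M.facet q.1 q.2 → q' = q) → H q = 0)
    (hinter : ∀ q q', q' ≠ q → M.facet q'.1 q'.2 = M.facet q.1 q.2 → H q + H q' = 0) :
    ∑ q, H q = 0 := by
  classical
  let g : M.Elem × Fin (n + 2) → M.Elem × Fin (n + 2) := fun q =>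
    if h : ∃ q', q' ≠ q ∧ M.facet q'.1 q'.2 = M.facet q.1 q.2 then h.choose else q
  have hg1 : ∀ q, (∃ q', q' ≠ q ∧ M.facet q'.1 q'.2 = M.facet q.1 q.2) →
      g q ≠ q ∧ M.facet (g q).1 (g q).2 = M.facet q.1 q.2 := by
    intro q h
    simp only [g, dif_pos h]
    exact h.choose_spec
  have hg2 : ∀ q, (¬ ∃ q', q' ≠ q ∧ M.facet q'.1 q'.2 = M.facet q.1 q.2) → g q = q ∧ H q = 0 := by
    intro q h
    refine ⟨by simp only [g, dif_neg h], hbdry q fun q' hq' => ?_⟩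
    by_contra hne
    exact h ⟨q', hne, hq'⟩
  -- `g` exchanges the two sides of a shared facet and fixes unshared ones; it is an involution
  -- because a facet has at most two sides.
  refine Finset.sum_involution (fun q _ => g q) ?_ ?_ (fun q _ => Finset.mem_univ _) ?_
  · intro q _
    by_cases h : ∃ q', q' ≠ q ∧ M.facet q'.1 q'.2 = M.facet q.1 q.2
    · exact hinter q (g q) (hg1 q h).1 (hg1 q h).2
    · rw [(hg2 q h).1, (hg2 q h).2, add_zero]
  · intro q _ hq
    by_cases h : ∃ q', q' ≠ q ∧ M.facet q'.1 q'.2 = M.facet q.1 q.2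
    · exact (hg1 q h).1
    · exact absurd (hg2 q h).2 hq
  · intro q _
    by_cases h : ∃ q', q' ≠ q ∧ M.facet q'.1 q'.2 = M.facet q.1 q.2
    · obtain ⟨h1, h2⟩ := hg1 q h
      obtain ⟨h3, h4⟩ := hg1 (g q) ⟨q, h1.symm, h2.symm⟩
      exact (A.eq_of_facet_eq ht h1.symm h3 h2.symm h4).symm
    · simp only [(hg2 q h).1]

/-- The contributions of the normal velocity and of the tangential skeleton velocity to the
convective flux cancel. -/
theorem bdry_convection_eq_zero (hn : n = 1 ∨ n = 2) {t : ℝ} (ht : t ∈ Icc 0 T)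
    {v : M.Elem → Vec (n + 1) → Vec (n + 1)} (hv : v ∈ A.Vh k t)
    (hcont : ∀ w ∈ A.Wt k t,
      A.bdry t (fun K l x => inner ℝ (v K x) (A.normal t K l x) * w (M.facet K l) x) = 0)
    {vt : M.Facet → Vec (n + 1) → Vec (n + 1)} (hvt : A.VanishBdry t vt) :
    A.bdry t (fun K l x => A.relVel t v K l x * (inner ℝ (v K x) (A.normal t K l x) ^ 2 -
      ‖tng (A.normal t K l x) (vt (M.facet K l) x)‖ ^ 2)) = 0 := by
  rw [bdry_eq_sum]
  refine A.sum_facets_eq_zero ht (fun q hq => ?_) (fun q q' hqq hf => ?_)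
  -- On the boundary ω·n need not vanish; it is the bracket that vanishes, since u·n and the
  -- skeleton velocity are both zero there.
  · refine setIntegral_eq_zero_of_forall_eq_zero fun z hz => ?_
    have h1 : inner ℝ (v q.1 (A.facetMap t q.1 q.2 z))
        (A.normal t q.1 q.2 (A.facetMap t q.1 q.2 z)) = 0 :=
      (mul_eq_zero.1 (A.normalFlux_eq_zero hn ht hv hcont hq hz)).resolve_right
        (A.facetDet_pos hn ht q.1 q.2 hz).ne'
    have h2 : vt (M.facet q.1 q.2) (A.facetMap t q.1 q.2 z) = 0 :=
      hvt q.1 q.2 ⟨q, rfl, fun q' hq' => hq q' hq'⟩ _ ⟨z, hz, rfl⟩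
    rw [h1, h2]
    simp [tng]
  · have hK := Mesh.elem_ne_of_facet_eq hqq hf
    obtain ⟨τ, hτ0⟩ := Mesh.exists_relabel hK.symm hf.symm
    have hτ : ∀ z ∈ refSimplex n,
        A.facetMap t q.1 q.2 z = A.facetMap t q'.1 q'.2 (relabel τ z) := fun z hz =>
      A.facetMap_eq_of_map_eq (hτ0 z hz) t
    rw [← integral_relabel τ fun z => A.relVel t v q'.1 q'.2 (A.facetMap t q'.1 q'.2 z) *
      (inner ℝ (v q'.1 (A.facetMap t q'.1 q'.2 z))
        (A.normal t q'.1 q'.2 (A.facetMap t q'.1 q'.2 z)) ^ 2 -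
      ‖tng (A.normal t q'.1 q'.2 (A.facetMap t q'.1 q'.2 z))
        (vt (M.facet q'.1 q'.2) (A.facetMap t q'.1 q'.2 z))‖ ^ 2) *
      A.facetDet t q'.1 q'.2 z, ← eq_neg_iff_add_eq_zero, ← integral_neg]
    -- Opposite normals are available only at relative interior points, hence almost everywhere.
    refine integral_congr_ae ?_
    filter_upwards [ae_mem_openSimplex] with z hz
    have hz0 := openSimplex_subset hz
    have hν := A.normal_eq_neg ht hK.symm hz (relabel_mem_openSimplex hz) (hτ z hz0)
    have hdet := A.facetDet_relabel ht hτ hz0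
    have hsum := A.normalFlux_add_eq_zero hn ht hv hcont hqq hf hτ hz0
    simp only [normalFlux] at hsum
    rw [← hdet, ← add_mul] at hsum
    have hun := (mul_eq_zero.1 hsum).resolve_right (A.facetDet_pos hn ht q.1 q.2 hz0).ne'
    rw [← hdet]
    -- ω is single valued and u·n changes only its sign between the sides, although u itself may
    -- jump. So (u-ω)·n is odd and the bracket even under the exchange of sides.
    simp only [relVel, inner_sub_left]
    rw [← hτ z hz0] at hun hν ⊢
    rw [hν] at hun ⊢
    rw [hf, tng_neg]
    have hun2 := neg_eq_of_add_eq_zero_right hun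
    rw [← hun2, inner_neg_right]
    ring

end ALEMap


/-! ### Algebra of tangential projections and Frobenius products -/

section Pointwise

variable {d : ℕ}

theorem inner_tng_left (ν v w : Vec d) : inner ℝ (tng ν v) w =
    inner ℝ v w - inner ℝ v ν * inner ℝ ν w := by
  rw [tng, inner_sub_left, inner_smul_left]; simp

theorem inner_tng_right (ν v w : Vec d) : inner ℝ v (tng ν w) =
    inner ℝ v w - inner ℝ w ν * inner ℝ v ν := by
  rw [tng, inner_sub_right, inner_smul_right]

theorem inner_tng_tng {ν : Vec d} (hν : ‖ν‖ = 1) (v w : Vec d) :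
    inner ℝ (tng ν v) (tng ν w) = inner ℝ v w - inner ℝ v ν * inner ℝ w ν := by
  rw [inner_tng_left, inner_tng_right, inner_tng_right, real_inner_self_eq_norm_sq, hν,
    real_inner_comm w ν]
  ring

theorem continuousOn_tng {X : Type*} [TopologicalSpace X] {s : Set X} {ν v : X → Vec d}
    (hν : ContinuousOn ν s) (hv : ContinuousOn v s) :
    ContinuousOn (fun x => tng (ν x) (v x)) s := by
  have h : ContinuousOn (fun x => inner ℝ (v x) (ν x) • ν x) s := (hv.inner (𝕜 := ℝ) hν).smul hν
  exact hv.sub h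

theorem continuousOn_app {X : Type*} [TopologicalSpace X] {s : Set X}
    {E : X → Matrix (Fin d) (Fin d) ℝ} {v : X → Vec d}
    (hE : ∀ i j, ContinuousOn (fun x => E x i j) s) (hv : ContinuousOn v s) :
    ContinuousOn (fun x => app (E x) (v x)) s := by
  refine (PiLp.continuous_toLp 2 _).comp_continuousOn (continuousOn_pi.2 fun i => ?_)
  exact continuousOn_finsetSum _ fun j _ => (hE i j).mul
    ((EuclideanSpace.proj j : Vec d →L[ℝ] ℝ).continuous.comp_continuousOn hv)

theorem frob_symGrad {E : Matrix (Fin d) (Fin d) ℝ} (hE : E.IsSymm) (s : Set (Vec d))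
    (v : Vec d → Vec d) (x : Vec d) : frob E (grad s v x) = frob (symGrad s v x) E := by
  have h1 : ∑ i, ∑ j, grad s v x j i * E i j = ∑ i, ∑ j, grad s v x i j * E i j := by
    rw [Finset.sum_comm]
    refine Finset.sum_congr rfl fun i _ => Finset.sum_congr rfl fun j _ => ?_
    rw [hE.apply]
  have h2 : frob (symGrad s v x) E = 1 / 2 * (∑ i, ∑ j, grad s v x i j * E i j +
      ∑ i, ∑ j, grad s v x j i * E i j) := by
    simp only [frob, symGrad, Matrix.smul_apply, Matrix.add_apply, Matrix.transpose_apply,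
      smul_eq_mul, ← Finset.sum_add_distrib, Finset.mul_sum]
    exact Finset.sum_congr rfl fun i _ => Finset.sum_congr rfl fun j _ => by ring
  rw [h2, h1, frob, ← two_mul, ← mul_assoc]
  norm_num
  exact Finset.sum_congr rfl fun i _ => Finset.sum_congr rfl fun j _ => by ring

theorem frob_sub_left (E F G : Matrix (Fin d) (Fin d) ℝ) :
    frob (E - F) G = frob E G - frob F G := by
  simp only [frob, Matrix.sub_apply, sub_mul, Finset.sum_sub_distrib]

end Pointwise

namespace ALEMap

variable {n m k : ℕ} {M : Mesh n m} {T : ℝ} (A : ALEMap M T)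

/-! ### Pointwise identity of the numerical fluxes -/

/-- The upwind value jumps where the relative normal velocity changes sign, but its product with
that velocity is continuous; positive and negative parts make this visible. -/
theorem relVel_smul_upwind (t : ℝ) (u : M.Elem → Vec (n + 1) → Vec (n + 1))
    (ut : M.Facet → Vec (n + 1) → Vec (n + 1)) (K : M.Elem) (l : Fin (n + 2)) (x : Vec (n + 1)) :
    A.relVel t u K l x • A.upwind t u ut K l x =
      max (A.relVel t u K l x) 0 • tng (A.normal t K l x) (u K x) +
        min (A.relVel t u K l x) 0 • tng (A.normal t K l x) (ut (M.facet K l) x) := by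
  rw [upwind]
  split_ifs with h
  · rw [max_eq_left h.le, min_eq_right h.le, zero_smul, add_zero]
  · rw [max_eq_right (not_lt.1 h), min_eq_left (not_lt.1 h), zero_smul, zero_add]

theorem fluxC_eq (ρ t : ℝ) (u : M.Elem → Vec (n + 1) → Vec (n + 1))
    (ut : M.Facet → Vec (n + 1) → Vec (n + 1)) (K : M.Elem) (l : Fin (n + 2)) (x : Vec (n + 1)) :
    A.fluxC ρ t u ut K l x =
      ρ • (A.relVel t u K l x • (inner ℝ (u K x) (A.normal t K l x) • A.normal t K l x) +
        (max (A.relVel t u K l x) 0 • tng (A.normal t K l x) (u K x) +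
        min (A.relVel t u K l x) 0 • tng (A.normal t K l x) (ut (M.facet K l) x))) := by
  rw [fluxC, ← relVel_smul_upwind, ← smul_add, smul_smul]

/-- The normal parts of convection cancel as 1 - ½ - ½. For w = (u-ω)·n the tangential ones are ρw
times tng ǔ·tng(u-ũ) - ½|tng u|² + ½|tng ũ|², and upwinding makes this ½ρ|w||tng(u-ũ)|² for either
sign of w. The σ̃ and ε terms cancel, and the α term is already a square. -/
theorem flux_identity (ρ μ α t : ℝ)
    (ε : M.Elem → Vec (n + 1) → Matrix (Fin (n + 1)) (Fin (n + 1)) ℝ)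
    (u : M.Elem → Vec (n + 1) → Vec (n + 1)) (σt : M.Facet → Vec (n + 1) → ℝ)
    (ut : M.Facet → Vec (n + 1) → Vec (n + 1)) (K : M.Elem) (l : Fin (n + 2)) (x : Vec (n + 1))
    (hν : ‖A.normal t K l x‖ = 1) :
    A.gam ρ α t u K l x * ‖tng (A.normal t K l x) (u K x - ut (M.facet K l) x)‖ ^ 2 =
      inner ℝ (u K x) (A.normal t K l x) * σt (M.facet K l) x
      + inner ℝ (A.fluxV μ α t ε u σt ut K l x - A.fluxC ρ t u ut K l x)
          (tng (A.normal t K l x) (ut (M.facet K l) x))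
      + 2 * μ * inner ℝ (tng (A.normal t K l x) (u K x - ut (M.facet K l) x))
          (app (ε K x) (A.normal t K l x))
      - (inner ℝ (A.fluxV μ α t ε u σt ut K l x - A.fluxC ρ t u ut K l x) (u K x)
        + ρ * A.relVel t u K l x * (1 / 2 * ‖u K x‖ ^ 2)
        + ρ / 2 * (A.relVel t u K l x * (inner ℝ (u K x) (A.normal t K l x) ^ 2 -
          ‖tng (A.normal t K l x) (ut (M.facet K l) x)‖ ^ 2))) := by
  have hνν : inner ℝ (A.normal t K l x) (A.normal t K l x) = (1 : ℝ) := by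
    rw [real_inner_self_eq_norm_sq, hν]; norm_num
  rw [fluxC_eq, fluxV, gam]
  set ν := A.normal t K l x
  set U := u K x
  set V := ut (M.facet K l) x
  set w := A.relVel t u K l x
  set e := app (ε K x) ν
  simp only [← real_inner_self_eq_norm_sq, inner_sub_left, inner_add_left, inner_smul_left,
    inner_tng_tng hν, inner_tng_left, inner_tng_right, inner_sub_right, conj_trivial, hνν]
  rw [real_inner_comm U V, real_inner_comm ν V, real_inner_comm ν U, real_inner_comm U e,
    real_inner_comm V e, real_inner_comm ν e]
  rcases le_total 0 w with h | h
  · rw [max_eq_left h, min_eq_right h, abs_of_nonneg h]; ring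
  · rw [max_eq_right h, min_eq_left h, abs_of_nonpos h]; ring

/-! ### Linearity of the integrals -/

theorem continuousOn_conormal {t : ℝ} (ht : t ∈ Icc 0 T) (K : M.Elem) (l : Fin (n + 2)) :
    ContinuousOn (A.conormal t K l) (refSimplex (n + 1)) := by
  have h : ContinuousOn (fun y => WithLp.toLp 2 fun j : Fin (n + 1) =>
      (∑ b, pev ((jacPoly (A.elemPoly t K)).adjugate b j) y * areaNormal l b) /
        pev (jacPoly (A.elemPoly t K)).det y) (refSimplex (n + 1)) := by
    refine (PiLp.continuous_toLp 2 _).comp_continuousOn (continuousOn_pi.2 fun j => ?_)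
    refine ContinuousOn.div ?_ (continuous_pev _).continuousOn
      fun y hy => (A.pev_det_pos ht K hy).ne'
    exact continuousOn_finsetSum _ fun b _ => (continuous_pev _).continuousOn.mul continuousOn_const
  refine h.congr fun y hy => ?_
  have hJ := A.det_jac_pos ht K hy
  ext j
  have h1 : A.conormal t K l y j = inner ℝ ((polyJac (A.elemPoly t K) y).inverse
      (EuclideanSpace.single j 1)) (areaNormal l) := by
    rw [← ContinuousLinearMap.adjoint_inner_right, EuclideanSpace.inner_single_left]
    simp [conormal]
  rw [h1, eq_div_iff (A.pev_det_pos ht K hy).ne', PiLp.inner_apply, Finset.sum_mul]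
  refine Finset.sum_congr rfl fun b _ => ?_
  have h2 := det_smul_inverse_polyJac hJ.ne' (EuclideanSpace.single j 1) b
  rw [Finset.sum_eq_single j (fun c _ hc => by simp [hc]) (by simp), det_polyJac] at h2
  simp only [PiLp.single_apply, if_true, mul_one] at h2
  rw [← h2]
  simp only [RCLike.inner_apply, conj_trivial]
  ring

theorem continuousOn_normal {t : ℝ} (ht : t ∈ Icc 0 T) (K : M.Elem) (l : Fin (n + 2)) :
    ContinuousOn (fun z => A.normal t K l (A.facetMap t K l z)) (refSimplex n) := by
  have h := (A.continuousOn_conormal ht K l).comp (continuous_refFacetMap l).continuousOn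
    fun z hz => refFacetMap_mem hz
  refine ((h.norm.inv₀ fun z hz => norm_ne_zero_iff.2
    (A.conormal_ne_zero ht K l (refFacetMap_mem hz))).smul h).congr fun z hz => ?_
  exact A.normal_elemMap ht K l (refFacetMap_mem hz)

theorem continuousOn_facetDet (hn : n = 1 ∨ n = 2) {t : ℝ} (ht : t ∈ Icc 0 T) (K : M.Elem)
    (l : Fin (n + 2)) : ContinuousOn (A.facetDet t K l) (refSimplex n) := by
  have h := (A.continuousOn_conormal ht K l).comp (continuous_refFacetMap l).continuousOn
    fun z hz => refFacetMap_mem hz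
  refine (((continuous_pev (jacPoly (A.elemPoly t K)).det).comp
    (continuous_refFacetMap l)).continuousOn.mul h.norm).congr fun z hz => ?_
  rw [A.facetDet_eq hn ht K l hz, det_polyJac]
  rfl

/-- The integrand is continuous on each side of each facet. -/
def FacetCont (t : ℝ) (g : M.Elem → Fin (n + 2) → Vec (n + 1) → ℝ) : Prop :=
  ∀ K l, ContinuousOn (fun z => g K l (A.facetMap t K l z)) (refSimplex n)

theorem FacetCont.integrableOn {A : ALEMap M T} (hn : n = 1 ∨ n = 2) {t : ℝ} (ht : t ∈ Icc 0 T)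
    {g : M.Elem → Fin (n + 2) → Vec (n + 1) → ℝ} (hg : A.FacetCont t g) (K : M.Elem)
    (l : Fin (n + 2)) :
    IntegrableOn (fun z => g K l (A.facetMap t K l z) * A.facetDet t K l z) (refSimplex n) :=
  ((hg K l).mul (A.continuousOn_facetDet hn ht K l)).integrableOn_compact isCompact_refSimplex

theorem bdry_add (hn : n = 1 ∨ n = 2) {t : ℝ} (ht : t ∈ Icc 0 T)
    {g h : M.Elem → Fin (n + 2) → Vec (n + 1) → ℝ} (hg : A.FacetCont t g)
    (hh : A.FacetCont t h) :
    A.bdry t (fun K l x => g K l x + h K l x) = A.bdry t g + A.bdry t h := by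
  simp only [bdry, ← Finset.sum_add_distrib]
  refine Finset.sum_congr rfl fun K _ => Finset.sum_congr rfl fun l _ => ?_
  rw [← integral_add (hg.integrableOn hn ht K l) (hh.integrableOn hn ht K l)]
  simp only [add_mul]

theorem bdry_const_mul (t c : ℝ) (g : M.Elem → Fin (n + 2) → Vec (n + 1) → ℝ) :
    A.bdry t (fun K l x => c * g K l x) = c * A.bdry t g := by
  simp only [bdry, Finset.mul_sum, ← integral_const_mul, mul_assoc]

theorem bdry_sub (hn : n = 1 ∨ n = 2) {t : ℝ} (ht : t ∈ Icc 0 T)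
    {g h : M.Elem → Fin (n + 2) → Vec (n + 1) → ℝ} (hg : A.FacetCont t g)
    (hh : A.FacetCont t h) :
    A.bdry t (fun K l x => g K l x - h K l x) = A.bdry t g - A.bdry t h := by
  simp only [bdry, ← Finset.sum_sub_distrib]
  refine Finset.sum_congr rfl fun K _ => Finset.sum_congr rfl fun l _ => ?_
  rw [← integral_sub (hg.integrableOn hn ht K l) (hh.integrableOn hn ht K l)]
  simp only [sub_mul]

theorem bdry_congr {t : ℝ} {g h : M.Elem → Fin (n + 2) → Vec (n + 1) → ℝ}
    (hgh : ∀ K l, ∀ z ∈ refSimplex n, g K l (A.facetMap t K l z) = h K l (A.facetMap t K l z)) :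
    A.bdry t g = A.bdry t h := by
  refine Finset.sum_congr rfl fun K _ => Finset.sum_congr rfl fun l _ =>
    setIntegral_congr_fun measurableSet_refSimplex fun z hz => ?_
  simp only [hgh K l z hz]

theorem vol_sub {t : ℝ} (ht : t ∈ Icc 0 T) {g h : M.Elem → Vec (n + 1) → ℝ}
    (hg : ∀ K, ContinuousOn (fun y => g K (A.elemMap t K y)) (refSimplex (n + 1)))
    (hh : ∀ K, ContinuousOn (fun y => h K (A.elemMap t K y)) (refSimplex (n + 1))) :
    A.vol t (fun K x => g K x - h K x) = A.vol t g - A.vol t h := by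
  simp only [vol, ← Finset.sum_sub_distrib]
  refine Finset.sum_congr rfl fun K _ => ?_
  have hJ : ContinuousOn (pev (jacPoly (A.elemPoly t K)).det) (refSimplex (n + 1)) :=
    (continuous_pev _).continuousOn
  have hig : IntegrableOn (fun y => pev (jacPoly (A.elemPoly t K)).det y * g K (A.elemMap t K y))
      (refSimplex (n + 1)) := (hJ.mul (hg K)).integrableOn_compact isCompact_refSimplex
  have hih : IntegrableOn (fun y => pev (jacPoly (A.elemPoly t K)).det y * h K (A.elemMap t K y))
      (refSimplex (n + 1)) := (hJ.mul (hh K)).integrableOn_compact isCompact_refSimplex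
  rw [A.integral_elem ht K, A.integral_elem ht K, A.integral_elem ht K, ← integral_sub hig hih]
  simp only [mul_sub]

theorem vol_congr {t : ℝ} (ht : t ∈ Icc 0 T) {g h : M.Elem → Vec (n + 1) → ℝ}
    (hgh : ∀ K, ∀ x ∈ A.elem t K, g K x = h K x) : A.vol t g = A.vol t h := by
  refine Finset.sum_congr rfl fun K _ => ?_
  rw [A.integral_elem ht K, A.integral_elem ht K]
  refine setIntegral_congr_fun measurableSet_refSimplex fun y hy => ?_
  simp only [hgh K _ ⟨y, hy, rfl⟩]

/-! ### Continuity of the discrete fields -/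

theorem continuousOn_Wh {t : ℝ} {w : M.Elem → Vec (n + 1) → ℝ} (hw : w ∈ A.Wh k t) (K : M.Elem) :
    ContinuousOn (fun y => w K (A.elemMap t K y)) (refSimplex (n + 1)) := by
  obtain ⟨wh, hp, hwh⟩ := hw K
  exact hp.continuousOn.congr hwh

theorem continuousOn_Vh {t : ℝ} (ht : t ∈ Icc 0 T) {v : M.Elem → Vec (n + 1) → Vec (n + 1)}
    (hv : v ∈ A.Vh k t) (K : M.Elem) :
    ContinuousOn (fun y => v K (A.elemMap t K y)) (refSimplex (n + 1)) :=
  (continuousOn_piola _ fun _ hy => (A.pev_det_pos ht K hy).ne').congr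
    fun _ hy => A.eq_piola ht hv K hy

theorem continuousOn_grad_Vh {t : ℝ} (ht : t ∈ Icc 0 T)
    {v : M.Elem → Vec (n + 1) → Vec (n + 1)} (hv : v ∈ A.Vh k t) (K : M.Elem)
    (i j : Fin (n + 1)) :
    ContinuousOn (fun y => grad (A.elem t K) (v K) (A.elemMap t K y) i j)
      (refSimplex (n + 1)) := by
  have hJ : ∀ y ∈ refSimplex (n + 1), pev (jacPoly (A.elemPoly t K)).det y ≠ 0 := fun y hy =>
    (A.pev_det_pos ht K hy).ne'
  have h : ContinuousOn (fun y => (∑ b, pev ((jacPoly (A.elemPoly t K)).adjugate b i) y *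
      fderiv ℝ (piola (A.elemPoly t K) (A.piolaPoly k v t K)) y (EuclideanSpace.single b 1) j) /
      pev (jacPoly (A.elemPoly t K)).det y) (refSimplex (n + 1)) :=
    ContinuousOn.div (continuousOn_finsetSum _ fun b _ => (continuous_pev _).continuousOn.mul
      (continuousOn_fderiv_piola _ hJ b j)) (continuous_pev _).continuousOn hJ
  refine h.congr fun y hy => ?_
  rw [eq_div_iff (hJ y hy), mul_comm]
  exact A.det_mul_grad_push ht K hy (fun y hy => A.eq_piola ht hv K hy)
    (hasFDerivAt_piola _ (hJ y hy)) i j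

theorem continuousOn_facet {E : Type*} [TopologicalSpace E] {t : ℝ} {g : Vec (n + 1) → E}
    {K : M.Elem} (hg : ContinuousOn (fun y => g (A.elemMap t K y)) (refSimplex (n + 1)))
    (l : Fin (n + 2)) : ContinuousOn (fun z => g (A.facetMap t K l z)) (refSimplex n) :=
  hg.comp (continuous_refFacetMap l).continuousOn fun _ hz => refFacetMap_mem hz

theorem continuousOn_Wt {t : ℝ} {w : M.Facet → Vec (n + 1) → ℝ} (hw : w ∈ A.Wt k t)
    (K : M.Elem) (l : Fin (n + 2)) :
    ContinuousOn (fun z => w (M.facet K l) (A.facetMap t K l z)) (refSimplex n) := by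
  obtain ⟨wh, hp, hwh⟩ := hw K l
  exact hp.continuousOn.congr hwh

theorem continuous_polyJac {d : ℕ} (P : Fin d → MvPolynomial (Fin d) ℝ) :
    Continuous (polyJac P) := by
  have h : Continuous (jacMat P) := by
    refine continuous_pi fun i => continuous_pi fun j => ?_
    exact continuous_pev (MvPolynomial.pderiv j (P i))
  exact (LinearMap.continuous_of_finiteDimensional
    (Matrix.toEuclideanCLM (n := Fin d) (𝕜 := ℝ)).toAlgEquiv.toLinearMap).comp h

/-- The Gram operator is invertible because the area element is positive, and inversion of operators
is continuous at invertible ones. -/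
theorem continuousOn_facetPinvT (hn : n = 1 ∨ n = 2) {t : ℝ} (ht : t ∈ Icc 0 T) (K : M.Elem)
    (l : Fin (n + 2)) : ContinuousOn (A.facetPinvT t K l) (refSimplex n) := by
  have hJ : ContinuousOn (A.facetJac t K l) (refSimplex n) := by
    have h : Continuous fun z => (polyJac (A.elemPoly t K) (refFacetMap l z)).comp
        (affLin fun i => refVertex (l.succAbove i)) :=
      ((continuous_polyJac _).comp (continuous_refFacetMap l)).clm_comp continuous_const
    exact h.continuousOn.congr fun z hz => A.facetJac_eq ht K l hz
  have hG : ContinuousOn (fun z => (ContinuousLinearMap.adjoint (A.facetJac t K l z)).comp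
      (A.facetJac t K l z)) (refSimplex n) :=
    (ContinuousLinearMap.adjoint.continuous.comp_continuousOn hJ).clm_comp hJ
  refine hJ.clm_comp fun z hz => ?_
  have hdet : ((ContinuousLinearMap.adjoint (A.facetJac t K l z)).comp
      (A.facetJac t K l z)).det ≠ 0 := fun h0 => by
    have h1 := A.facetDet_pos hn ht K l hz
    rw [facetDet, h0, Real.sqrt_zero] at h1
    exact lt_irrefl _ h1
  obtain ⟨e, he⟩ := exists_equiv_of_det_ne_zero hdet
  have hc : ContinuousAt (ContinuousLinearMap.inverse : (Vec n →L[ℝ] Vec n) → _)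
      ((ContinuousLinearMap.adjoint (A.facetJac t K l z)).comp (A.facetJac t K l z)) := by
    rw [← he]
    exact (contDiffAt_map_inverse (n := 1) e).continuousAt
  exact ContinuousAt.comp_continuousWithinAt
    (f := fun z => (ContinuousLinearMap.adjoint (A.facetJac t K l z)).comp (A.facetJac t K l z))
    hc (hG z hz)

theorem continuousOn_Vt (hn : n = 1 ∨ n = 2) {t : ℝ} (ht : t ∈ Icc 0 T)
    {v : M.Facet → Vec (n + 1) → Vec (n + 1)} (hv : v ∈ A.Vt k t)
    (K : M.Elem) (l : Fin (n + 2)) :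
    ContinuousOn (fun z => v (M.facet K l) (A.facetMap t K l z)) (refSimplex n) := by
  obtain ⟨vh, hp, hvh⟩ := hv K l
  refine ContinuousOn.congr (continuousOn_tng (A.continuousOn_normal ht K l)
    ((A.continuousOn_facetPinvT hn ht K l).clm_apply ?_)) hvh
  have := continuousOn_pi.2 fun i => (hp i).continuousOn
  exact (PiLp.continuous_toLp 2 _).comp_continuousOn this

theorem continuousOn_vel (hT : 0 < T) {t : ℝ} (ht : t ∈ Icc 0 T) (K : M.Elem) :
    ContinuousOn (fun y => A.vel t (A.elemMap t K y)) (refSimplex (n + 1)) :=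
  (continuous_polyMap _).continuousOn.congr fun _ hy => A.vel_elemMap ht K hT hy

end ALEMap


/-! ### Continuity of the numerical fluxes and the tested equations -/

theorem continuousOn_frob {d : ℕ} {X : Type*} [TopologicalSpace X] {s : Set X}
    {E F : X → Matrix (Fin d) (Fin d) ℝ} (hE : ∀ i j, ContinuousOn (fun x => E x i j) s)
    (hF : ∀ i j, ContinuousOn (fun x => F x i j) s) :
    ContinuousOn (fun x => frob (E x) (F x)) s :=
  continuousOn_finsetSum _ fun i _ => continuousOn_finsetSum _ fun j _ => (hE i j).mul (hF i j)

namespace ALEMap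

variable {n m k : ℕ} {M : Mesh n m} {T : ℝ} (A : ALEMap M T)

theorem continuousOn_relVel (hT : 0 < T) {t : ℝ} (ht : t ∈ Icc 0 T)
    {v : M.Elem → Vec (n + 1) → Vec (n + 1)} (hv : v ∈ A.Vh k t) :
    A.FacetCont t (A.relVel t v) := fun K l =>
  ((A.continuousOn_facet (A.continuousOn_Vh ht hv K) l).sub
    (A.continuousOn_facet (A.continuousOn_vel hT ht K) l)).inner (𝕜 := ℝ)
    (A.continuousOn_normal ht K l)

theorem continuousOn_fluxV (hn : n = 1 ∨ n = 2) (μ α : ℝ) {t : ℝ} (ht : t ∈ Icc 0 T)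
    {ε : M.Elem → Vec (n + 1) → Matrix (Fin (n + 1)) (Fin (n + 1)) ℝ} (hε : ε ∈ A.Sh k t)
    {u : M.Elem → Vec (n + 1) → Vec (n + 1)} (hu : u ∈ A.Vh k t)
    {σt : M.Facet → Vec (n + 1) → ℝ} (hσ : σt ∈ A.Wt k t)
    {ut : M.Facet → Vec (n + 1) → Vec (n + 1)} (hut : ut ∈ A.Vt k t)
    (K : M.Elem) (l : Fin (n + 2)) :
    ContinuousOn (fun z => A.fluxV μ α t ε u σt ut K l (A.facetMap t K l z))
      (refSimplex n) := by
  have hν := A.continuousOn_normal ht K l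
  have hε' := continuousOn_app (fun i j => A.continuousOn_facet (g := fun x => ε K x i j)
    (A.continuousOn_Wh (hε.1 i j) K) l) hν
  have hju := (A.continuousOn_facet (A.continuousOn_Vh ht hu K) l).sub
    (A.continuousOn_Vt hn ht hut K l)
  exact (((A.continuousOn_Wt hσ K l).smul hν).add ((continuousOn_tng hν hε').const_smul (2 * μ))).sub
    ((continuousOn_tng hν hju).const_smul α)

theorem continuousOn_fluxC (hn : n = 1 ∨ n = 2) (hT : 0 < T) (ρ : ℝ) {t : ℝ} (ht : t ∈ Icc 0 T)
    {u : M.Elem → Vec (n + 1) → Vec (n + 1)} (hu : u ∈ A.Vh k t)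
    {ut : M.Facet → Vec (n + 1) → Vec (n + 1)} (hut : ut ∈ A.Vt k t)
    (K : M.Elem) (l : Fin (n + 2)) :
    ContinuousOn (fun z => A.fluxC ρ t u ut K l (A.facetMap t K l z)) (refSimplex n) := by
  have hν := A.continuousOn_normal ht K l
  have hu' := A.continuousOn_facet (A.continuousOn_Vh ht hu K) l
  have hw := A.continuousOn_relVel hT ht hu K l
  -- In this form the case distinction of the upwind value is replaced by a maximum and a minimum,
  -- which are continuous.
  simp only [fluxC_eq]
  exact ((hw.smul ((hu'.inner (𝕜 := ℝ) hν).smul hν)).add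
    (((hw.sup continuousOn_const).smul (continuousOn_tng hν hu')).add
    ((hw.inf continuousOn_const).smul
      (continuousOn_tng hν (A.continuousOn_Vt hn ht hut K l))))).const_smul ρ

/-- The kinetic energy is differentiable, and half its derivative consists of the volume terms of
the momentum equation tested with the velocity and a convective boundary term. -/
theorem hasDerivWithinAt_kinetic (hn : n = 1 ∨ n = 2) (hT : 0 < T) {ρ μ α : ℝ}
    {f : ℝ → Vec (n + 1) → Vec (n + 1)} {p : ℝ → M.Elem → Vec (n + 1) → ℝ}
    {ε : ℝ → M.Elem → Vec (n + 1) → Matrix (Fin (n + 1)) (Fin (n + 1)) ℝ}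
    {u : ℝ → M.Elem → Vec (n + 1) → Vec (n + 1)} {σt : ℝ → M.Facet → Vec (n + 1) → ℝ}
    {ut : ℝ → M.Facet → Vec (n + 1) → Vec (n + 1)}
    (hsol : A.IsSolution k ρ μ α f p ε u σt ut) {t : ℝ} (ht : t ∈ Icc 0 T) :
    HasDerivWithinAt (fun s => A.vol s (fun K x => ρ * inner ℝ (u s K x) (u s K x)))
      (2 * (A.vol t (fun K x => ρ * inner ℝ (A.aleDeriv u t K x) (u t K x))
        + A.vol t (fun K x => ρ * divg (A.elem t K) (A.vel t) x * inner ℝ (u t K x) (u t K x))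
        - A.vol t (fun K x =>
            ρ * frob (tens (u t K x - A.vel t x) (u t K x)) (grad (A.elem t K) (u t K) x))
        + A.bdry t (fun K l x => ρ * A.relVel t (u t) K l x * (1 / 2 * ‖u t K x‖ ^ 2))))
      (Icc 0 T) t := by
  refine (HasDerivWithinAt.fun_sum (u := Finset.univ) fun K _ =>
    A.hasDerivWithinAt_energy hn hT ht hsol.mem_u K (hsol.diff_u t ht K)
      (fun y hy => A.pev_div_piolaPoly_eq_zero hn ht (hsol.mem_u t ht) (hsol.divergence t ht) K hy)
      ρ).congr_deriv ?_
  rw [← Finset.mul_sum, Finset.sum_add_distrib, Finset.sum_sub_distrib, Finset.sum_add_distrib]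
  rfl

/-- The strain-velocity equation tested with the strain. -/
theorem vol_strain {ρ μ α : ℝ}
    {f : ℝ → Vec (n + 1) → Vec (n + 1)} {p : ℝ → M.Elem → Vec (n + 1) → ℝ}
    {ε : ℝ → M.Elem → Vec (n + 1) → Matrix (Fin (n + 1)) (Fin (n + 1)) ℝ}
    {u : ℝ → M.Elem → Vec (n + 1) → Vec (n + 1)} {σt : ℝ → M.Facet → Vec (n + 1) → ℝ}
    {ut : ℝ → M.Facet → Vec (n + 1) → Vec (n + 1)}
    (hsol : A.IsSolution k ρ μ α f p ε u σt ut) {t : ℝ} (ht : t ∈ Icc 0 T) :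
    2 * μ * A.vol t (fun K x => frob (ε t K x) (grad (A.elem t K) (u t K) x)) =
      2 * μ * A.vol t (fun K x => frob (ε t K x) (ε t K x)) +
        2 * μ * A.bdry t (fun K l x =>
          inner ℝ (tng (A.normal t K l x) (u t K x - ut t (M.facet K l) x))
            (app (ε t K x) (A.normal t K l x))) := by
  have hε := hsol.mem_ε t ht
  have hε' := fun K i j => A.continuousOn_Wh (hε.1 i j) K
  have hg := fun K i j => A.continuousOn_grad_Vh ht (hsol.mem_u t ht) K i j
  have hs := hsol.strain t ht (ε t) hε
  simp only [frob_sub_left] at hs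
  rw [A.vol_sub ht (fun K => continuousOn_frob (hε' K) (hε' K)) (fun K => continuousOn_frob
    (fun i j => ((hg K i j).add (hg K j i)).const_smul (1 / 2 : ℝ)) (hε' K))] at hs
  rw [A.vol_congr ht fun K x hx => frob_symGrad (hε.2 K x hx) (A.elem t K) (u t K) x]
  linarith

/-- The stabilization terms are the sum of the boundary terms in the tested equations. -/
theorem bdry_dissipation (hn : n = 1 ∨ n = 2) (hT : 0 < T) {ρ μ α : ℝ}
    {f : ℝ → Vec (n + 1) → Vec (n + 1)} {p : ℝ → M.Elem → Vec (n + 1) → ℝ}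
    {ε : ℝ → M.Elem → Vec (n + 1) → Matrix (Fin (n + 1)) (Fin (n + 1)) ℝ}
    {u : ℝ → M.Elem → Vec (n + 1) → Vec (n + 1)} {σt : ℝ → M.Facet → Vec (n + 1) → ℝ}
    {ut : ℝ → M.Facet → Vec (n + 1) → Vec (n + 1)}
    (hsol : A.IsSolution k ρ μ α f p ε u σt ut) {t : ℝ} (ht : t ∈ Icc 0 T) :
    A.bdry t (fun K l x => A.gam ρ α t (u t) K l x *
        ‖tng (A.normal t K l x) (u t K x - ut t (M.facet K l) x)‖ ^ 2) =
      2 * μ * A.bdry t (fun K l x =>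
        inner ℝ (tng (A.normal t K l x) (u t K x - ut t (M.facet K l) x))
          (app (ε t K x) (A.normal t K l x)))
      - A.bdry t (fun K l x => inner ℝ (A.fluxV μ α t (ε t) (u t) (σt t) (ut t) K l x
          - A.fluxC ρ t (u t) (ut t) K l x) (u t K x))
      - A.bdry t (fun K l x => ρ * A.relVel t (u t) K l x * (1 / 2 * ‖u t K x‖ ^ 2)) := by
  have hu := hsol.mem_u t ht
  have hut := hsol.mem_ut t ht
  have hε := hsol.mem_ε t ht
  have hν := A.continuousOn_normal ht
  have hu' := fun K l => A.continuousOn_facet (A.continuousOn_Vh ht hu K) l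
  have hut' := A.continuousOn_Vt hn ht hut
  have hw := A.continuousOn_relVel hT ht hu
  have hfl := fun K l => (A.continuousOn_fluxV hn μ α ht hε hu (hsol.mem_σt t ht) hut K l).sub
    (A.continuousOn_fluxC hn hT ρ ht hu hut K l)
  have c1 : A.FacetCont t fun K l x =>
      inner ℝ (u t K x) (A.normal t K l x) * σt t (M.facet K l) x := fun K l =>
    ((hu' K l).inner (𝕜 := ℝ) (hν K l)).mul (A.continuousOn_Wt (hsol.mem_σt t ht) K l)
  have c2 : A.FacetCont t fun K l x =>
      inner ℝ (A.fluxV μ α t (ε t) (u t) (σt t) (ut t) K l x - A.fluxC ρ t (u t) (ut t) K l x)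
        (tng (A.normal t K l x) (ut t (M.facet K l) x)) := fun K l =>
    (hfl K l).inner (𝕜 := ℝ) (continuousOn_tng (hν K l) (hut' K l))
  have c3 : A.FacetCont t fun K l x =>
      2 * μ * inner ℝ (tng (A.normal t K l x) (u t K x - ut t (M.facet K l) x))
          (app (ε t K x) (A.normal t K l x)) := fun K l =>
    continuousOn_const.mul ((continuousOn_tng (hν K l) ((hu' K l).sub (hut' K l))).inner (𝕜 := ℝ)
      (continuousOn_app (fun i j => A.continuousOn_facet (g := fun x => ε t K x i j)
        (A.continuousOn_Wh (hε.1 i j) K) l) (hν K l)))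
  have c4 : A.FacetCont t fun K l x =>
      inner ℝ (A.fluxV μ α t (ε t) (u t) (σt t) (ut t) K l x - A.fluxC ρ t (u t) (ut t) K l x)
        (u t K x) := fun K l => (hfl K l).inner (𝕜 := ℝ) (hu' K l)
  have c5 : A.FacetCont t fun K l x =>
      ρ * A.relVel t (u t) K l x * (1 / 2 * ‖u t K x‖ ^ 2) := fun K l =>
    (continuousOn_const.mul (hw K l)).mul (continuousOn_const.mul ((hu' K l).norm.pow 2))
  have c6 : A.FacetCont t fun K l x =>
      ρ / 2 * (A.relVel t (u t) K l x * (inner ℝ (u t K x) (A.normal t K l x) ^ 2 -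
          ‖tng (A.normal t K l x) (ut t (M.facet K l) x)‖ ^ 2)) := fun K l =>
    continuousOn_const.mul ((hw K l).mul ((((hu' K l).inner (𝕜 := ℝ) (hν K l)).pow 2).sub
      ((continuousOn_tng (hν K l) (hut' K l)).norm.pow 2)))
  have c12 : A.FacetCont t fun K l x =>
      inner ℝ (u t K x) (A.normal t K l x) * σt t (M.facet K l) x +
      inner ℝ (A.fluxV μ α t (ε t) (u t) (σt t) (ut t) K l x - A.fluxC ρ t (u t) (ut t) K l x)
        (tng (A.normal t K l x) (ut t (M.facet K l) x)) := fun K l => (c1 K l).add (c2 K l)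
  have c45 : A.FacetCont t fun K l x =>
      inner ℝ (A.fluxV μ α t (ε t) (u t) (σt t) (ut t) K l x - A.fluxC ρ t (u t) (ut t) K l x)
        (u t K x) + ρ * A.relVel t (u t) K l x * (1 / 2 * ‖u t K x‖ ^ 2) :=
    fun K l => (c4 K l).add (c5 K l)
  -- The pointwise identity is integrated and split, which is legitimate because every summand is
  -- continuous on each facet. Three integrals then vanish: normal continuity tested with σ̃, flux
  -- continuity tested with ũ, and the skew convective term.
  rw [A.bdry_congr (h := fun K l x =>
      inner ℝ (u t K x) (A.normal t K l x) * σt t (M.facet K l) x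
      + inner ℝ (A.fluxV μ α t (ε t) (u t) (σt t) (ut t) K l x - A.fluxC ρ t (u t) (ut t) K l x)
          (tng (A.normal t K l x) (ut t (M.facet K l) x))
      + 2 * μ * inner ℝ (tng (A.normal t K l x) (u t K x - ut t (M.facet K l) x))
          (app (ε t K x) (A.normal t K l x))
      - (inner ℝ (A.fluxV μ α t (ε t) (u t) (σt t) (ut t) K l x - A.fluxC ρ t (u t) (ut t) K l x)
          (u t K x)
        + ρ * A.relVel t (u t) K l x * (1 / 2 * ‖u t K x‖ ^ 2)
        + ρ / 2 * (A.relVel t (u t) K l x * (inner ℝ (u t K x) (A.normal t K l x) ^ 2 -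
          ‖tng (A.normal t K l x) (ut t (M.facet K l) x)‖ ^ 2))))
    fun K l z hz => A.flux_identity ρ μ α t (ε t) (u t) (σt t) (ut t) K l
    (A.facetMap t K l z) (A.norm_normal ht K l (refFacetMap_mem hz)),
    A.bdry_sub hn ht (fun K l => (c12 K l).add (c3 K l)) (fun K l => (c45 K l).add (c6 K l)),
    A.bdry_add hn ht c12 c3, A.bdry_add hn ht c1 c2, A.bdry_add hn ht c45 c6,
    A.bdry_add hn ht c4 c5, A.bdry_const_mul t (2 * μ), A.bdry_const_mul t (ρ / 2),
    hsol.normal_cont t ht (σt t) (hsol.mem_σt t ht),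
    hsol.flux_cont t ht (ut t) hut (hsol.ut_bdry t ht),
    A.bdry_convection_eq_zero hn ht hu (hsol.normal_cont t ht) (hsol.ut_bdry t ht)]
  ring

end ALEMap

end ALEHDG

end

/-! ### The energy identity -/

theorem theorem2p2 {n m k : ℕ} (hn : n = 1 ∨ n = 2) (hm : 1 ≤ m) (hk : 1 ≤ k)
    {T : ℝ} (hT : 0 < T) (M : ALEHDG.Mesh n m) (A : ALEHDG.ALEMap M T)
    (ρ μ α : ℝ) (hρ : 0 < ρ) (hμ : 0 < μ) (hα : 0 < α)
    (f : ℝ → ALEHDG.Vec (n + 1) → ALEHDG.Vec (n + 1))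
    (hf : ∀ t ∈ Set.Icc 0 T, MeasureTheory.IntegrableOn (f t) (A.domain t))
    (p : ℝ → M.Elem → ALEHDG.Vec (n + 1) → ℝ)
    (ε : ℝ → M.Elem → ALEHDG.Vec (n + 1) → Matrix (Fin (n + 1)) (Fin (n + 1)) ℝ)
    (u : ℝ → M.Elem → ALEHDG.Vec (n + 1) → ALEHDG.Vec (n + 1))
    (σt : ℝ → M.Facet → ALEHDG.Vec (n + 1) → ℝ)
    (ut : ℝ → M.Facet → ALEHDG.Vec (n + 1) → ALEHDG.Vec (n + 1))
    (hsol : A.IsSolution k ρ μ α f p ε u σt ut) :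
    ∀ t ∈ Set.Icc 0 T,
      DifferentiableWithinAt ℝ
          (fun s => A.vol s (fun K x => ρ * inner ℝ (u s K x) (u s K x))) (Set.Icc 0 T) t ∧
        1 / 2 * derivWithin
            (fun s => A.vol s (fun K x => ρ * inner ℝ (u s K x) (u s K x))) (Set.Icc 0 T) t
          + 2 * μ * A.vol t (fun K x => ALEHDG.frob (ε t K x) (ε t K x))
          + A.bdry t (fun K l x => A.gam ρ α t (u t) K l x *
              ‖ALEHDG.tng (A.normal t K l x) (u t K x - ut t (M.facet K l) x)‖ ^ 2)
          = A.vol t (fun K x => ρ * inner ℝ (f t x) (u t K x)) ∧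
        ∀ K l, ∀ x ∈ A.facetSet t K l, 0 < A.gam ρ α t (u t) K l x := by
  intro t ht
  have hd := A.hasDerivWithinAt_kinetic hn hT hsol ht
  refine ⟨hd.differentiableWithinAt, ?_, fun K l x _ => ?_⟩
  · rw [hd.derivWithin (uniqueDiffOn_Icc hT t ht), A.bdry_dissipation hn hT hsol ht]
    have hmom := hsol.momentum t ht (u t) (hsol.mem_u t ht)
    -- The pressure is its own test function, so the pressure term of the momentum equation is zero.
    have hp := hsol.divergence t ht (p t) (hsol.mem_p t ht)
    simp only [mul_comm (ALEHDG.divg _ _ _) (p t _ _)] at hp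
    have hs := A.vol_strain hsol ht
    linarith
  · have : 0 ≤ 1 / 2 * (ρ * |A.relVel t (u t) K l x|) := by positivity
    exact add_pos_of_pos_of_nonneg hα this
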